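/- Let $\mathcal A$ be an abelian category and let $n\ge 0$. For $i=1,\dots,n$ let $F_i\colon\mathcal A\to\mathcal A$ be exact functors, $\eta_i\colon F_i\to \mathrm{id}_{\mathcal A}$ natural transformations and $p_i\ge 2$ integers. The $F_i$ commute, strictly or up to coherent natural isomorphisms $F_iF_j\cong F_jF_i$ (inverse to each other for $(i,j)$ and $(j,i)$, and such that the two ways of reversing the order of three distinct functors agree), and for $i\neq j$ the $\eta_i$ are compatible with this: $F_j(\eta_i(M))$ and $\eta_i(F_jM)$ correspond under $F_jF_iM\cong F_iF_jM$. Let $S=\prod_i\{1,\dots,p_i\}$ with unit vectors $e_i$. The grid category $\mathcal A[\eta_1^{1/p_1},\dots,\eta_n^{1/p_n}]$ has as objects the families $(M_s)_{s\in S}$ of objects of $\mathcal A$ with maps $f^i_s\colon M_{s-e_i}\to M_s$, where objects and maps with a nonpositive index are read through $M_s:=F_iM_{s+p_ie_i}$, such that all squares commute and, for all $i$ and $s$, the composite of the $p_i$ consecutive maps $M_{s-p_ie_i}=F_iM_s\to\dots\to M_s$ in direction $i$ is $\eta_i(M_s)$. Morphisms are families of maps $M_s\to N_s$ commuting with all $f^i_s$.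 This category is abelian. For $H\subseteq\{1,\dots,n\}$ write $\mathcal A[\eta^H]$ for the grid category formed with the $i\in H$ only. For $I\subseteq\{1,\dots,n\}$ let $\mathcal A_I$ be the (abelian) full subcategory of all $M\in\mathcal A$ with $\eta_i(M)=0$ for all $i\in I$. For $M\in\mathcal A_I$ and $K=\{c_1,\dots,c_k\}$ disjoint from $I$ put $M|_K=\operatorname{cok}\eta_{c_1}(\operatorname{cok}\eta_{c_2}(\cdots\operatorname{cok}\eta_{c_k}(M)))\in\mathcal A_{I\cup K}$. Let $\mathcal A_H[0^H]$ be the category of functors from the poset $\prod_{i\in H}\{1,\dots,p_i-1\}$ to $\mathcal A_H$. For $T_H\in\mathcal A_H$ let $T_H^H\in\mathcal A_H[0^H]$ be the direct sum, over all $k\in\prod_{i\in H}\{1,\dots,p_i-1\}$, of the functors that are $T_H$ at all $s\le k$ (with identity maps between these) and zero elsewhere; that is, $T^H_H$ arises by applying $\delta(M)=(M\to\dots\to M)\oplus\dots\oplus(M\to0\to\dots\to0)$ in each direction $i\in H$. Let $\iota^H\colon\mathcal A_H[0^H]\to\mathcal A[\eta^H]$ be extension by zero to all indices $s$ with $s_i=p_i$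 for some $i\in H$. Let $\pi_\rho^{[1,n]\setminus H}\colon\mathcal A[\eta^H]\to\mathcal A[\eta_1^{1/p_1},\dots,\eta_n^{1/p_n}]$ send $M$ to the grid with entry $M_{s|_H}$ at $s$, the maps of $M$ in the directions $i\in H$, and, in a direction $i\notin H$, identities for $s_i>1$ and $\eta_i\colon F_iM_{s|_H}\to M_{s|_H}$ for $s_i=1$. An object $T$ of an abelian category is *cotilting* if $\operatorname{Ext}^i(T,T)=0$ for all $i>0$, and every $M$ with $\operatorname{Ext}^i(M,T)=0$ for all $i\ge0$ is zero. **Theorem.** Assume that for all $I\subseteq\{1,\dots,n\}$ and $i\notin I$, every object of $\mathcal A_I$ is a quotient in $\mathcal A_I$ of some $M\in\mathcal A_I$ such that $\eta_i(M)$ is a monomorphism. For each $H\subseteq\{1,\dots,n\}$ let $T_H$ be a cotilting object of $\mathcal A_H$, such that for all disjoint $H,J\subseteq\{1,\dots,n\}$: * $\eta_a(T_H|_J)$ is a monomorphism for every $a\notin H\cup J$; * $\operatorname{Ext}^i_{\mathcal A_{H\cup J}}(T_H|_J,\,T_{H\cup J})=0$ for all $i>0$. Then $$\bigoplus_{H\subseteq\{1,\dots,n\}}\pi_\rho^{[1,n]\setminus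 H}\,\iota^H\,T_H^H$$ is a cotilting object of $\mathcal A[\eta_1^{1/p_1},\dots,\eta_n^{1/p_n}]$. -/

import Mathlib

open CategoryTheory CategoryTheory.Limits
open scoped ZeroObject

universe u v

noncomputable section

/-- `Ext^i(X, Y) = 0` in the abelian category `A`. -/
def ExtVanishes {A : Type u} [Category.{v} A] [Abelian A] (X Y : A) (i : ℕ) : Prop :=
  letI : HasExt.{max u v} A := HasExt.standard A
  Subsingleton (Abelian.Ext X Y i)

/-- `T` is cotilting: it is rigid, and every `M` with `Ext^i(M, T) = 0` for all `i ≥ 0` is zero. -/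
structure IsCotilting {A : Type u} [Category.{v} A] [Abelian A] (T : A) : Prop where
  rigid : ∀ i : ℕ, 0 < i → ExtVanishes T T i
  cogenerates : ∀ M : A, (∀ i : ℕ, ExtVanishes M T i) → IsZero M

/-- The product `{1, …, p_1} × ⋯ × {1, …, p_n}` of chains (here shifted to start at `0`), with the
product order. -/
@[ext]
structure Box {σ : Type} (p : σ → ℕ) : Type where
  coord : ∀ i, Fin (p i)

namespace Box

variable {σ : Type} {p : σ → ℕ}

instance : PartialOrder (Box p) :=
  PartialOrder.lift Box.coord fun _ _ h => Box.ext h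

instance [Finite σ] : Finite (Box p) :=
  Finite.of_injective Box.coord fun _ _ h => Box.ext h

lemma le_def {s t : Box p} : s ≤ t ↔ ∀ i, s.coord i ≤ t.coord i := Iff.rfl

variable [DecidableEq σ]

/-- Replace the `i`-th coordinate of `s` by `x`. -/
def set (s : Box p) (i : σ) (x : Fin (p i)) : Box p := ⟨Function.update s.coord i x⟩

@[simp] lemma set_self (s : Box p) (i : σ) (x : Fin (p i)) : (s.set i x).coord i = x := by
  simp [set]

lemma set_of_ne (s : Box p) {i j : σ} (x : Fin (p i)) (h : j ≠ i) :
    (s.set i x).coord j = s.coord j := by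
  simp [set, h]

lemma set_comm (s : Box p) {i j : σ} (h : i ≠ j) (x : Fin (p i)) (y : Fin (p j)) :
    (s.set j y).set i x = (s.set i x).set j y :=
  Box.ext (Function.update_comm h.symm _ _ _)

lemma set_mono (i : σ) (x : Fin (p i)) {s t : Box p} (h : s ≤ t) : s.set i x ≤ t.set i x := by
  intro j
  by_cases hj : j = i
  · subst hj; simp
  · simpa [set_of_ne _ _ hj] using h j

end Box

/-- Commuting exact endofunctors `F i` of `C` with natural transformations `η i : F i ⟶ 𝟭 C`
and integer weights `p i ≥ 2`.  Commutation is given by coherent isomorphisms `comm i j`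
(identities when the `F i` commute strictly), with which the `η i` are compatible. -/
structure RootData (C : Type u) [Category.{v} C] [Abelian C] (σ : Type) where
  F : σ → C ⥤ C
  leftExact : ∀ i, PreservesFiniteLimits (F i)
  rightExact : ∀ i, PreservesFiniteColimits (F i)
  η : ∀ i, F i ⟶ 𝟭 C
  comm : ∀ i j, F i ⋙ F j ≅ F j ⋙ F i
  comm_symm : ∀ i j, comm j i = (comm i j).symm
  /-- The two ways of reversing the order of three of the functors agree. -/
  comm_hexagon : ∀ i j k, i ≠ j → i ≠ k → j ≠ k → ∀ X : C,
    (F k).map ((comm i j).hom.app X) ≫ (comm i k).hom.app ((F j).obj X) ≫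
        (F i).map ((comm j k).hom.app X) =
      (comm j k).hom.app ((F i).obj X) ≫ (F j).map ((comm i k).hom.app X) ≫
        (comm i j).hom.app ((F k).obj X)
  /-- `F_j (η_i (X)) = η_i (F_j X)`, modulo `F_j F_i X ≅ F_i F_j X`. -/
  η_comm : ∀ i j, i ≠ j → ∀ X : C,
    (F j).map ((η i).app X) = (comm i j).hom.app X ≫ (η i).app ((F j).obj X)
  p : σ → ℕ
  two_le_p : ∀ i, 2 ≤ p i

namespace RootData

variable {C : Type u} [Category.{v} C] [Abelian C] {σ : Type}

section Vanishing

variable (D : RootData C σ)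

instance (i : σ) : PreservesFiniteLimits (D.F i) := D.leftExact i
instance (i : σ) : PreservesFiniteColimits (D.F i) := D.rightExact i
instance (i : σ) : (D.F i).Additive := (D.F i).additive_of_preserves_binary_products

/-- The objects `M` of `C` with `η_i (M) = 0` for all `i ∈ I`.  The full subcategory on them
is the category `C_I`. -/
def vanishing (I : Finset σ) : ObjectProperty C := fun M => ∀ i ∈ I, (D.η i).app M = 0

/-- The category `C_I`. -/
abbrev Vanish (I : Finset σ) := (D.vanishing I).FullSubcategory

variable (I : Finset σ)

instance : (D.vanishing I).IsClosedUnderSubobjects where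
  prop_of_mono {X Y} f _ hY i hi := by
    rw [← cancel_mono f]
    have := (D.η i).naturality f
    simp only [Functor.id_obj, Functor.id_map] at this
    rw [← this, hY i hi]; simp

instance : (D.vanishing I).IsClosedUnderQuotients where
  prop_of_epi {X Y} f _ hX i hi := by
    rw [← cancel_epi ((D.F i).map f)]
    have := (D.η i).naturality f
    simp only [Functor.id_obj, Functor.id_map] at this
    rw [this, hX i hi]; simp

instance : (D.vanishing I).ContainsZero where
  exists_zero := ⟨0, isZero_zero C, fun _ _ => (isZero_zero C).eq_of_tgt _ _⟩

instance : (D.vanishing I).IsClosedUnderFiniteProducts where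
  isClosedUnderLimitsOfShape J _ := ⟨by
    rintro X ⟨h⟩ i hi
    refine h.isLimit.hom_ext fun j => ?_
    have := (D.η i).naturality (h.π.app j)
    simp only [Functor.id_map] at this
    have h2 := h.prop_diag_obj j i hi
    dsimp at this ⊢
    rw [← this, h2]
    simp⟩

instance : Abelian (D.Vanish I) := inferInstance

end Vanishing

section Lemmas

variable {D : RootData C σ}

lemma η_nat (i : σ) {X Y : C} (f : X ⟶ Y) :
    (D.F i).map f ≫ (D.η i).app Y = (D.η i).app X ≫ f := by
  simp

lemma η_comm' {i j : σ} (h : j ≠ i) (X : C) :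
    (D.comm i j).hom.app X ≫ (D.F i).map ((D.η j).app X) = (D.η j).app ((D.F i).obj X) := by
  rw [D.η_comm j i h, D.comm_symm i j]
  simp

lemma thin {Q : Type} [PartialOrder Q] (M : Q ⥤ C) {s t r : Q} (h : s ≤ t) (h' : t ≤ r) :
    M.map (homOfLE h) ≫ M.map (homOfLE h') = M.map (homOfLE (h.trans h')) := by
  rw [← Functor.map_comp, homOfLE_comp]

lemma F_thin {Q : Type} [PartialOrder Q] (G : C ⥤ C) (M : Q ⥤ C) {s t r : Q} (h : s ≤ t)
    (h' : t ≤ r) :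
    G.map (M.map (homOfLE h)) ≫ G.map (M.map (homOfLE h')) =
      G.map (M.map (homOfLE (h.trans h'))) := by
  rw [← Functor.map_comp, thin]

lemma FF_thin {Q : Type} [PartialOrder Q] (G G' : C ⥤ C) (M : Q ⥤ C) {s t r : Q} (h : s ≤ t)
    (h' : t ≤ r) :
    G.map (G'.map (M.map (homOfLE h))) ≫ G.map (G'.map (M.map (homOfLE h'))) =
      G.map (G'.map (M.map (homOfLE (h.trans h')))) := by
  rw [← Functor.map_comp, F_thin]

end Lemmas

section Grid

variable [DecidableEq σ] (D : RootData C σ)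

/-- The index set `{1, …, p_1} × ⋯ × {1, …, p_n}` of the grids. -/
abbrev Idx := Box D.p

/-- Replace the `i`-th coordinate by the largest one, `p_i`. -/
def top (i : σ) (s : D.Idx) : D.Idx :=
  s.set i ⟨D.p i - 1, by have := D.two_le_p i; omega⟩

/-- Replace the `i`-th coordinate by the smallest one, `1`. -/
def bot (i : σ) (s : D.Idx) : D.Idx :=
  s.set i ⟨0, by have := D.two_le_p i; omega⟩

lemma le_top (i : σ) (s : D.Idx) : s ≤ D.top i s := by
  intro j
  by_cases h : j = i
  · subst h
    have := (s.coord j).2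
    simp only [top, Box.set_self, Fin.le_def]
    omega
  · simp [top, Box.set_of_ne _ _ h]

lemma bot_le (i : σ) (s : D.Idx) : D.bot i s ≤ s := by
  intro j
  by_cases h : j = i
  · subst h
    simp [bot, Fin.le_def]
  · simp [bot, Box.set_of_ne _ _ h]

lemma top_mono (i : σ) {s t : D.Idx} (h : s ≤ t) : D.top i s ≤ D.top i t := Box.set_mono _ _ h

lemma bot_mono (i : σ) {s t : D.Idx} (h : s ≤ t) : D.bot i s ≤ D.bot i t := Box.set_mono _ _ h

lemma bot_top {i j : σ} (h : i ≠ j) (s : D.Idx) : D.bot i (D.top j s) = D.top j (D.bot i s) :=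
  Box.set_comm _ h _ _

lemma top_top {i j : σ} (h : i ≠ j) (s : D.Idx) : D.top i (D.top j s) = D.top j (D.top i s) :=
  Box.set_comm _ h _ _

lemma bot_bot {i j : σ} (h : i ≠ j) (s : D.Idx) : D.bot i (D.bot j s) = D.bot j (D.bot i s) :=
  Box.set_comm _ h _ _

/-- The objects of the grid category `C[η_1^{1/p_1}, …, η_n^{1/p_n}]`.

A commuting grid `(M_s)` with step maps `M_{s - e_i} ⟶ M_s` for `s_i > 1` is the same as a functor
`M` on the product `Idx` of chains, the composite of steps from `s` to `t` being the value at
`s ≤ t`.  The steps `M_{s - e_i} = F_i M_{s + (p_i - 1) e_i} ⟶ M_s` at `s_i = 1` are the maps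
`wrap i s`: the source is `F_i` of `M` at `s` with `s_i` replaced by `p_i`, the target is `M` at `s`
with `s_i` replaced by `1` (so `wrap i s` does not depend on `s_i`, by `wrap_natural`). -/
structure Grid where
  M : D.Idx ⥤ C
  wrap : ∀ i (s : D.Idx), (D.F i).obj (M.obj (D.top i s)) ⟶ M.obj (D.bot i s)
  /-- Commutativity of the squares with source `F_i M`. -/
  wrap_natural : ∀ i {s t : D.Idx} (h : s ≤ t),
    (D.F i).map (M.map (homOfLE (D.top_mono i h))) ≫ wrap i t =
      wrap i s ≫ M.map (homOfLE (D.bot_mono i h))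
  /-- Commutativity of the squares with source `F_j F_i M ≅ F_i F_j M`. -/
  wrap_comm : ∀ i j (h : i ≠ j) (s : D.Idx),
    (D.F j).map (wrap i (D.top j s)) ≫
        (D.F j).map (M.map (homOfLE (D.bot_top h s).le)) ≫ wrap j (D.bot i s) =
      (D.comm i j).hom.app (M.obj (D.top i (D.top j s))) ≫
        (D.F i).map ((D.F j).map (M.map (homOfLE (D.top_top h s).le))) ≫
        (D.F i).map (wrap j (D.top i s)) ≫
        (D.F i).map (M.map (homOfLE (D.bot_top h.symm s).le)) ≫
        wrap i (D.bot j s) ≫ M.map (homOfLE (D.bot_bot h s).le)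
  /-- The cycle condition. -/
  cycle : ∀ i (s : D.Idx),
    (D.F i).map (M.map (homOfLE (D.le_top i s))) ≫ wrap i s ≫
        M.map (homOfLE (D.bot_le i s)) = (D.η i).app (M.obj s)

namespace Grid

variable {D}

/-- Morphisms of grids: families of maps commuting with all step maps. -/
@[ext]
structure Hom (X Y : D.Grid) where
  app : X.M ⟶ Y.M
  comm : ∀ i (s : D.Idx),
    X.wrap i s ≫ app.app (D.bot i s) =
      (D.F i).map (app.app (D.top i s)) ≫ Y.wrap i s

instance : Category D.Grid where
  Hom := Hom
  id X := ⟨𝟙 _, by intros; simp⟩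
  comp f g := ⟨f.app ≫ g.app, by
    intro i s
    have h1 := f.comm i s
    have h2 := g.comm i s
    simp only [NatTrans.comp_app, Functor.map_comp, Category.assoc]
    rw [← h2, ← Category.assoc, h1, Category.assoc]⟩
  id_comp f := Hom.ext (Category.id_comp _)
  comp_id f := Hom.ext (Category.comp_id _)
  assoc f g h := Hom.ext (Category.assoc _ _ _)

variable {X Y Z : D.Grid}

@[ext]
lemma hom_ext {f g : X ⟶ Y} (h : f.app = g.app) : f = g := Hom.ext h

@[simp] lemma id_app : Hom.app (𝟙 X) = 𝟙 X.M := rfl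
@[simp] lemma comp_app (f : X ⟶ Y) (g : Y ⟶ Z) : (f ≫ g).app = f.app ≫ g.app := rfl

instance : Zero (X ⟶ Y) := ⟨⟨0, by intros; simp⟩⟩
instance : Add (X ⟶ Y) := ⟨fun f g => ⟨f.app + g.app, by
  intro i s; simp [Functor.map_add, f.comm i s, g.comm i s]⟩⟩
instance : Neg (X ⟶ Y) := ⟨fun f => ⟨-f.app, by
  intro i s; simp [Functor.map_neg, f.comm i s]⟩⟩
instance : Sub (X ⟶ Y) := ⟨fun f g => ⟨f.app - g.app, by
  intro i s; simp [Functor.map_sub, f.comm i s, g.comm i s]⟩⟩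
instance : SMul ℕ (X ⟶ Y) := ⟨fun k f => ⟨k • f.app, by
  intro i s; simp [f.comm i s]⟩⟩
instance : SMul ℤ (X ⟶ Y) := ⟨fun k f => ⟨k • f.app, by
  intro i s; simp [f.comm i s]⟩⟩

instance : AddCommGroup (X ⟶ Y) :=
  Function.Injective.addCommGroup (fun f : X ⟶ Y => f.app) (fun _ _ h => hom_ext h)
    rfl (fun _ _ => rfl) (fun _ => rfl) (fun _ _ => rfl) (fun _ _ => rfl) (fun _ _ => rfl)

@[simp] lemma zero_app : Hom.app (0 : X ⟶ Y) = 0 := rfl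
@[simp] lemma add_app (f g : X ⟶ Y) : (f + g).app = f.app + g.app := rfl

instance : Preadditive D.Grid where
  add_comp _ _ _ f g h := hom_ext (Preadditive.add_comp _ _ _ f.app g.app h.app)
  comp_add _ _ _ f g h := hom_ext (Preadditive.comp_add _ _ _ f.app g.app h.app)

variable (D) in
/-- The functor that forgets the steps `wrap`. -/
@[simps]
def forget : D.Grid ⥤ (D.Idx ⥤ C) where
  obj X := X.M
  map f := f.app

instance : (forget D).Additive where
  map_add := rfl
instance : (forget D).Faithful := ⟨fun h => hom_ext h⟩

instance : (forget D).ReflectsIsomorphisms where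
  reflects {X Y} f h := by
    have h' : IsIso f.app := h
    refine ⟨⟨⟨inv f.app, fun i s => ?_⟩, hom_ext (IsIso.hom_inv_id f.app),
      hom_ext (IsIso.inv_hom_id f.app)⟩⟩
    have := f.comm i s
    simp only [NatIso.isIso_inv_app, Functor.map_inv]
    rw [IsIso.comp_inv_eq, Category.assoc, this, IsIso.inv_hom_id_assoc]

/-- A functor `K` with jointly monic maps to (the functors of) grids inherits a grid structure. -/
@[simps]
def ofMono {A : Type} (X : A → D.Grid) (K : D.Idx ⥤ C) (ι : ∀ a, K ⟶ (X a).M)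
    (hι : ∀ s {Z : C} (f g : Z ⟶ K.obj s), (∀ a, f ≫ (ι a).app s = g ≫ (ι a).app s) → f = g)
    (w : ∀ i (s : D.Idx), (D.F i).obj (K.obj (D.top i s)) ⟶ K.obj (D.bot i s))
    (hw : ∀ i s a, w i s ≫ (ι a).app (D.bot i s) =
      (D.F i).map ((ι a).app (D.top i s)) ≫ (X a).wrap i s) : D.Grid where
  M := K
  wrap := w
  wrap_natural i s t h := by
    refine hι _ _ _ fun a => ?_
    simp only [Category.assoc, hw, NatTrans.naturality]
    rw [← Functor.map_comp_assoc, NatTrans.naturality, Functor.map_comp_assoc,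
      (X a).wrap_natural i h, reassoc_of% hw i s a]
  wrap_comm i j h s := by
    refine hι _ _ _ fun a => ?_
    have := (X a).wrap_comm i j h s
    have e1 : ∀ (i : σ) {x y : D.Idx} (f : x ⟶ y), (D.F i).map (K.map f) ≫
        (D.F i).map ((ι a).app y) = (D.F i).map ((ι a).app x) ≫ (D.F i).map ((X a).M.map f) := by
      intros; simp only [← Functor.map_comp, NatTrans.naturality]
    have e2 : ∀ (i j : σ) {x y : D.Idx} (f : x ⟶ y), (D.F i).map ((D.F j).map (K.map f)) ≫
        (D.F i).map ((D.F j).map ((ι a).app y)) =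
        (D.F i).map ((D.F j).map ((ι a).app x)) ≫ (D.F i).map ((D.F j).map ((X a).M.map f)) := by
      intros; simp only [← Functor.map_comp, NatTrans.naturality]
    have e3 : ∀ (i j : σ) (s : D.Idx), (D.F j).map (w i s) ≫
        (D.F j).map ((ι a).app (D.bot i s)) =
        (D.F j).map ((D.F i).map ((ι a).app (D.top i s))) ≫ (D.F j).map ((X a).wrap i s) := by
      intros; simp only [← Functor.map_comp, hw]
    have e4 := (D.comm i j).hom.naturality ((ι a).app (D.top i (D.top j s)))
    simp only [Functor.comp_map] at e4
    simp only [Category.assoc, NatTrans.naturality, hw, reassoc_of% hw, reassoc_of% e1,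
      reassoc_of% e3, reassoc_of% e2, this, reassoc_of% e4]
  cycle i s := by
    refine hι _ _ _ fun a => ?_
    have := (X a).cycle i s
    simp only [Category.assoc, NatTrans.naturality]
    rw [reassoc_of% hw i s a, ← Functor.map_comp_assoc, NatTrans.naturality,
      Functor.map_comp_assoc, this]
    simp

/-- A quotient of (the functor of) a grid, compatible with `wrap`, inherits a grid structure. -/
@[simps]
def ofEpi (X : D.Grid) (Q : D.Idx ⥤ C) (π : X.M ⟶ Q) [∀ s, Epi (π.app s)]
    (w : ∀ i (s : D.Idx), (D.F i).obj (Q.obj (D.top i s)) ⟶ Q.obj (D.bot i s))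
    (hw : ∀ i s, (D.F i).map (π.app (D.top i s)) ≫ w i s =
      X.wrap i s ≫ π.app (D.bot i s)) : D.Grid where
  M := Q
  wrap := w
  wrap_natural i s t h := by
    rw [← cancel_epi ((D.F i).map (π.app _))]
    rw [← Functor.map_comp_assoc, ← NatTrans.naturality, Functor.map_comp_assoc, hw,
      reassoc_of% X.wrap_natural i h, reassoc_of% hw i s, ← NatTrans.naturality]
  wrap_comm i j h s := by
    rw [← cancel_epi ((D.F j).map ((D.F i).map (π.app _)))]
    have := X.wrap_comm i j h s
    have e1 : ∀ (i : σ) {x y : D.Idx} (f : x ⟶ y), (D.F i).map (π.app x) ≫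
        (D.F i).map (Q.map f) = (D.F i).map (X.M.map f) ≫ (D.F i).map (π.app y) := by
      intros; simp only [← Functor.map_comp, NatTrans.naturality]
    have e2 : ∀ (i j : σ) {x y : D.Idx} (f : x ⟶ y), (D.F i).map ((D.F j).map (π.app x)) ≫
        (D.F i).map ((D.F j).map (Q.map f)) =
        (D.F i).map ((D.F j).map (X.M.map f)) ≫ (D.F i).map ((D.F j).map (π.app y)) := by
      intros; simp only [← Functor.map_comp, NatTrans.naturality]
    have e3 : ∀ (i j : σ) (s : D.Idx), (D.F j).map ((D.F i).map (π.app (D.top i s))) ≫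
        (D.F j).map (w i s) = (D.F j).map (X.wrap i s) ≫
        (D.F j).map (π.app (D.bot i s)) := by
      intros; simp only [← Functor.map_comp, hw]
    have e4 := (D.comm i j).hom.naturality (π.app (D.top i (D.top j s)))
    simp only [Functor.comp_map] at e4
    simp only [reassoc_of% e3, reassoc_of% e1, reassoc_of% e4, reassoc_of% e2, hw,
      reassoc_of% hw, ← NatTrans.naturality, reassoc_of% this]
  cycle i s := by
    rw [← cancel_epi ((D.F i).map (π.app _))]
    have := X.cycle i s
    have e := (D.η i).naturality (π.app s)
    simp only [Functor.id_map] at e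
    rw [← Functor.map_comp_assoc, ← NatTrans.naturality, Functor.map_comp_assoc,
      reassoc_of% hw, ← NatTrans.naturality, e, ← this]
    simp

/-- A map of functors into a grid is a morphism if its composites with jointly monic ones are. -/
@[simps]
def homOfMono {A : Type} {K W : D.Grid} {X : A → D.Grid} (j : ∀ a, K ⟶ X a)
    (hj : ∀ s {Z : C} (f g : Z ⟶ K.M.obj s),
      (∀ a, f ≫ (j a).app.app s = g ≫ (j a).app.app s) → f = g)
    (k : ∀ a, W ⟶ X a) (l : W.M ⟶ K.M) (h : ∀ a, l ≫ (j a).app = (k a).app) : W ⟶ K where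
  app := l
  comm i s := by
    refine hj _ _ _ fun a => ?_
    have h3 : ∀ s, l.app s ≫ (j a).app.app s = (k a).app.app s := fun s => by
      rw [← NatTrans.comp_app, h]
    rw [Category.assoc, Category.assoc, h3, (j a).comm, ← Functor.map_comp_assoc, h3, (k a).comm]

/-- A map of functors out of a grid is a morphism if its composite with an epic one is. -/
@[simps]
def homOfEpi {Q W X : D.Grid} (j : X ⟶ Q) [∀ s, Epi (j.app.app s)]
    (k : X ⟶ W) (l : Q.M ⟶ W.M) (h : j.app ≫ l = k.app) : Q ⟶ W where
  app := l
  comm i s := by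
    rw [← cancel_epi ((D.F i).map (j.app.app (D.top i s)))]
    have h3 : ∀ s, j.app.app s ≫ l.app s = k.app.app s := fun s => by
      rw [← NatTrans.comp_app, h]
    rw [← reassoc_of% j.comm, h3, ← Functor.map_comp_assoc, h3, k.comm]

section Kernels

variable (f : X ⟶ Y)

lemma kernel_lift_exists (s : D.Idx) {A : C} (h : A ⟶ X.M.obj s) (w : h ≫ f.app.app s = 0) :
    ∃ l : A ⟶ (kernel f.app).obj s, l ≫ (kernel.ι f.app).app s = h := by
  have := KernelFork.IsLimit.lift' (KernelFork.mapIsLimit _ (kernelIsKernel f.app)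
    ((evaluation D.Idx C).obj s)) h w
  exact ⟨this.1, this.2⟩

lemma cokernel_desc_exists (s : D.Idx) (G : C ⥤ C) [PreservesFiniteColimits G] {A : C}
    (h : G.obj (Y.M.obj s) ⟶ A) (w : G.map (f.app.app s) ≫ h = 0) :
    ∃ l : G.obj ((cokernel f.app).obj s) ⟶ A, G.map ((cokernel.π f.app).app s) ≫ l = h := by
  have := CokernelCofork.IsColimit.desc' (CokernelCofork.mapIsColimit _
    (cokernelIsCokernel f.app) ((evaluation D.Idx C).obj s ⋙ G)) h w
  exact ⟨this.1, this.2⟩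

lemma ker_wrap_exists (i : σ) (s : D.Idx) :
    ∃ l : (D.F i).obj ((kernel f.app).obj (D.top i s)) ⟶ (kernel f.app).obj (D.bot i s),
      l ≫ (kernel.ι f.app).app (D.bot i s) =
        (D.F i).map ((kernel.ι f.app).app (D.top i s)) ≫ X.wrap i s :=
  kernel_lift_exists f _ _ (by
    rw [Category.assoc, f.comm, ← Functor.map_comp_assoc, ← NatTrans.comp_app,
      kernel.condition]; simp)

/-- The kernel, computed pointwise. -/
def ker : D.Grid :=
  ofMono (A := Unit) (fun _ => X) (kernel f.app) (fun _ => kernel.ι f.app)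
    (fun s _ _ _ h => (cancel_mono ((kernel.ι f.app).app s)).1 (h ()))
    (fun i s => (ker_wrap_exists f i s).choose)
    (fun i s _ => (ker_wrap_exists f i s).choose_spec)

/-- The inclusion of the kernel. -/
def kerι : ker f ⟶ X where
  app := kernel.ι f.app
  comm i s := (ker_wrap_exists f i s).choose_spec

instance : Mono (kerι f) :=
  (forget D).mono_of_mono_map (inferInstanceAs (Mono (kernel.ι f.app)))

lemma kerι_comp : kerι f ≫ f = 0 := hom_ext (kernel.condition f.app)

/-- `ker f` is a kernel of `f`. -/
def kerIsLimit : IsLimit (KernelFork.ofι (kerι f) (kerι_comp f)) :=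
  KernelFork.IsLimit.ofι' _ _ fun k hk =>
    ⟨homOfMono (A := Unit) (fun _ => kerι f)
      (fun s _ _ _ h => (cancel_mono ((kernel.ι f.app).app s)).1 (h ())) (fun _ => k)
      (kernel.lift f.app k.app (congrArg Hom.app hk)) (fun _ => kernel.lift_ι _ _ _),
      hom_ext (kernel.lift_ι _ _ _)⟩

lemma coker_wrap_exists (i : σ) (s : D.Idx) :
    ∃ l : (D.F i).obj ((cokernel f.app).obj (D.top i s)) ⟶ (cokernel f.app).obj (D.bot i s),
      (D.F i).map ((cokernel.π f.app).app (D.top i s)) ≫ l =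
        Y.wrap i s ≫ (cokernel.π f.app).app (D.bot i s) :=
  cokernel_desc_exists f _ _ _ (by
    rw [← Category.assoc, ← f.comm, Category.assoc, ← NatTrans.comp_app,
      cokernel.condition]; simp)

/-- The cokernel, computed pointwise. -/
def coker : D.Grid :=
  ofEpi Y (cokernel f.app) (cokernel.π f.app)
    (fun i s => (coker_wrap_exists f i s).choose)
    (fun i s => (coker_wrap_exists f i s).choose_spec)

/-- The projection to the cokernel. -/
def cokerπ : Y ⟶ coker f where
  app := cokernel.π f.app
  comm i s := (coker_wrap_exists f i s).choose_spec.symm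

instance (s : D.Idx) : Epi ((cokerπ f).app.app s) :=
  inferInstanceAs (Epi ((cokernel.π f.app).app s))

instance : Epi (cokerπ f) :=
  (forget D).epi_of_epi_map (inferInstanceAs (Epi (cokernel.π f.app)))

lemma comp_cokerπ : f ≫ cokerπ f = 0 := hom_ext (cokernel.condition f.app)

/-- `coker f` is a cokernel of `f`. -/
def cokerIsColimit : IsColimit (CokernelCofork.ofπ (cokerπ f) (comp_cokerπ f)) :=
  CokernelCofork.IsColimit.ofπ' _ _ fun k hk =>
    ⟨homOfEpi (cokerπ f) k (cokernel.desc f.app k.app (congrArg Hom.app hk))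
      (cokernel.π_desc _ _ _), hom_ext (cokernel.π_desc _ _ _)⟩

instance : HasKernels D.Grid := ⟨fun f => ⟨⟨⟨_, kerIsLimit f⟩⟩⟩⟩
instance : HasCokernels D.Grid := ⟨fun f => ⟨⟨⟨_, cokerIsColimit f⟩⟩⟩⟩

instance : PreservesLimit (parallelPair f 0) (forget D) :=
  preservesLimit_of_preserves_limit_cone (kerIsLimit f)
    ((KernelFork.isLimitMapConeEquiv _ _).symm (kernelIsKernel f.app))

instance : PreservesColimit (parallelPair f 0) (forget D) :=
  preservesColimit_of_preserves_colimit_cocone (cokerIsColimit f)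
    ((CokernelCofork.isColimitMapCoconeEquiv _ _).symm (cokernelIsCokernel f.app))

instance : IsIso (Abelian.coimageImageComparison f) := by
  have : IsIso ((forget D).map (Abelian.coimageImageComparison f)) := by
    rw [Arrow.isIso_iff_isIso_of_isIso
      (Abelian.PreservesCoimageImageComparison.iso (forget D) f).hom]
    infer_instance
  exact isIso_of_reflects_iso _ (forget D)

end Kernels

section Products

variable {A : Type} [Finite A] (X : A → D.Grid)

lemma prod_lift_exists (s : D.Idx) {Z : C} (h : ∀ a, Z ⟶ (X a).M.obj s) :
    ∃ l : Z ⟶ (∏ᶜ fun a => (X a).M).obj s, ∀ a, l ≫ (Pi.π (fun a => (X a).M) a).app s = h a :=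
  ⟨(isLimitOfPreserves ((evaluation D.Idx C).obj s)
    (limit.isLimit (Discrete.functor fun a => (X a).M))).lift
      ⟨Z, Discrete.natTrans fun a => h a.as⟩,
    fun a => (isLimitOfPreserves ((evaluation D.Idx C).obj s)
      (limit.isLimit (Discrete.functor fun a => (X a).M))).fac _ ⟨a⟩⟩

lemma prod_hom_ext (s : D.Idx) {Z : C} (f g : Z ⟶ (∏ᶜ fun a => (X a).M).obj s)
    (h : ∀ a, f ≫ (Pi.π (fun a => (X a).M) a).app s = g ≫ (Pi.π (fun a => (X a).M) a).app s) :
    f = g :=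
  (isLimitOfPreserves ((evaluation D.Idx C).obj s)
    (limit.isLimit (Discrete.functor fun a => (X a).M))).hom_ext fun a => h a.as

/-- Finite products, computed pointwise. -/
def prod : D.Grid :=
  ofMono X (∏ᶜ fun a => (X a).M) (fun a => Pi.π _ a) (prod_hom_ext X)
    (fun i s => (prod_lift_exists X (D.bot i s) fun a =>
      (D.F i).map ((Pi.π (fun a => (X a).M) a).app (D.top i s)) ≫ (X a).wrap i s).choose)
    (fun i s => (prod_lift_exists X (D.bot i s) _).choose_spec)

/-- The projections from the product. -/
def prodπ (a : A) : prod X ⟶ X a where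
  app := Pi.π (fun a => (X a).M) a
  comm i s := (prod_lift_exists X (D.bot i s) _).choose_spec a

/-- `prod X` is a product. -/
def prodIsLimit : IsLimit (Fan.mk (prod X) (prodπ X)) :=
  Fan.IsLimit.mk _ (fun t => homOfMono (prodπ X) (prod_hom_ext X) t.proj
      (Pi.lift fun a => (t.proj a).app) (fun _ => Pi.lift_π _ _))
    (fun _ _ => hom_ext (Pi.lift_π _ _))
    (fun t _ hm => hom_ext (Pi.hom_ext _ _ fun a =>
      (congrArg Hom.app (hm a)).trans (Pi.lift_π (fun a => (t.proj a).app) a).symm))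

instance : HasFiniteProducts D.Grid where
  out n := ⟨fun K => by
    have : HasLimit (Discrete.functor (K.obj ∘ Discrete.mk)) :=
      ⟨⟨⟨_, prodIsLimit fun a => K.obj ⟨a⟩⟩⟩⟩
    exact hasLimit_of_iso (Discrete.natIsoFunctor (F := K)).symm⟩

end Products

instance : Abelian D.Grid := Abelian.ofCoimageImageComparisonIsIso

instance : HasFiniteBiproducts D.Grid := HasFiniteBiproducts.of_hasFiniteProducts

end Grid

/-- The data `(F_i, η_i, p_i)` for `i ∈ H`. -/
abbrev restrict (H : Finset σ) : RootData C H where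
  F i := D.F i
  leftExact i := D.leftExact i
  rightExact i := D.rightExact i
  η i := D.η i
  comm i j := D.comm i j
  comm_symm i j := D.comm_symm i j
  comm_hexagon i j k hij hik hjk X :=
    D.comm_hexagon i j k (fun h => hij (Subtype.ext h)) (fun h => hik (Subtype.ext h))
      (fun h => hjk (Subtype.ext h)) X
  η_comm i j hij X := D.η_comm i j (fun h => hij (Subtype.ext h)) X
  p i := D.p i
  two_le_p i := D.two_le_p i

/-- Restriction of an index to the coordinates in `H`. -/
def res (H : Finset σ) (s : D.Idx) : (D.restrict H).Idx := ⟨fun i => s.coord i⟩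

lemma res_mono (H : Finset σ) {s t : D.Idx} (h : s ≤ t) : D.res H s ≤ D.res H t := fun i => h i

lemma res_set {H : Finset σ} {i : σ} (h : i ∈ H) (s : D.Idx) (x : Fin (D.p i)) :
    D.res H (s.set i x) = (D.res H s).set (p := (D.restrict H).p) ⟨i, h⟩ x := by
  ext j : 2
  by_cases hj : j = ⟨i, h⟩
  · subst hj
    rw [Box.set_self]
    exact Box.set_self s i x
  · rw [Box.set_of_ne _ _ hj]
    exact Box.set_of_ne s x (fun e => hj (Subtype.ext e))

lemma res_set_of_notMem {H : Finset σ} {i : σ} (h : i ∉ H) (s : D.Idx) (x : Fin (D.p i)) :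
    D.res H (s.set i x) = D.res H s := by
  ext j : 2
  exact Box.set_of_ne s x (fun e => h (e ▸ j.2))

lemma res_top {H : Finset σ} {i : σ} (h : i ∈ H) (s : D.Idx) :
    D.res H (D.top i s) = (D.restrict H).top ⟨i, h⟩ (D.res H s) :=
  D.res_set h s _

lemma res_bot {H : Finset σ} {i : σ} (h : i ∈ H) (s : D.Idx) :
    D.res H (D.bot i s) = (D.restrict H).bot ⟨i, h⟩ (D.res H s) :=
  D.res_set h s _

lemma res_top_of_notMem {H : Finset σ} {i : σ} (h : i ∉ H) (s : D.Idx) :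
    D.res H (D.top i s) = D.res H s := D.res_set_of_notMem h s _

lemma res_bot_of_notMem {H : Finset σ} {i : σ} (h : i ∉ H) (s : D.Idx) :
    D.res H (D.bot i s) = D.res H s := D.res_set_of_notMem h s _

variable {D} in
lemma Grid.wrap_eq (X : D.Grid) (i : σ) {s t : D.Idx} (h : s = t) :
    X.wrap i s = (D.F i).map (X.M.map (homOfLE (D.top_mono i h.le))) ≫ X.wrap i t ≫
      X.M.map (homOfLE (D.bot_mono i h.ge)) := by
  subst h; simp

open Classical in
/-- The functor with value `M` at all `s ≤ k`, with identities between them, and zero elsewhere. -/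
def block {Q : Type} [PartialOrder Q] {A : Type u} [Category.{v} A] [Abelian A] (k : Q) (M : A) :
    Q ⥤ A where
  obj s := if s ≤ k then M else 0
  map {s t} f := if h : t ≤ k then eqToHom (by rw [if_pos (f.le.trans h), if_pos h]) else 0
  map_id s := by
    split_ifs with h
    · simp
    · exact (IsZero.of_iso (isZero_zero A) (eqToIso (if_neg h))).eq_of_src _ _
  map_comp {s t r} f g := by
    by_cases h : r ≤ k
    · simp [h, g.le.trans h]
    · simp [h]

/-- `π_ρ^K : C[η^H] → C[η^{[1,n]}]` on objects, for `K` the complement of `H`: the grid is constant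
in the directions `i ∉ H`, the step to the first entry in such a direction being `η_i`. -/
def piRho (H : Finset σ) (X : (D.restrict H).Grid) : D.Grid where
  M :=
    { obj s := X.M.obj (D.res H s)
      map f := X.M.map (homOfLE (D.res_mono H f.le))
      map_id s := by simp
      map_comp f g := by rw [← Functor.map_comp, homOfLE_comp] }
  wrap i s :=
    if h : i ∈ H then
      (D.F i).map (X.M.map (homOfLE (D.res_top h s).le)) ≫ X.wrap ⟨i, h⟩ (D.res H s) ≫
        X.M.map (homOfLE (D.res_bot h s).ge)
    else
      (D.F i).map (X.M.map (homOfLE (D.res_top_of_notMem h s).le)) ≫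
        (D.η i).app (X.M.obj (D.res H s)) ≫ X.M.map (homOfLE (D.res_bot_of_notMem h s).ge)
  wrap_natural i s t hst := by
    by_cases h : i ∈ H
    · have := X.wrap_natural ⟨i, h⟩ (D.res_mono H hst)
      dsimp only at this
      simp only [h, dite_true, Category.assoc]
      have e : X.M.map (homOfLE ((D.res_mono H (D.bot_mono i hst)).trans'
          (D.res_bot h s).ge)) = X.M.map (homOfLE ((D.restrict H).bot_mono ⟨i, h⟩
          (D.res_mono H hst))) ≫ X.M.map (homOfLE (D.res_bot h t).ge) := by
        rw [← Functor.map_comp, homOfLE_comp]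
      rw [thin, e, ← reassoc_of% this, reassoc_of% F_thin, reassoc_of% F_thin]
    · simp only [h, dite_false, Category.assoc, reassoc_of% η_nat, thin]
  wrap_comm i j hij s := by
    by_cases h : i ∈ H <;> by_cases h' : j ∈ H
    · have := X.wrap_comm ⟨i, h⟩ ⟨j, h'⟩ (fun e => hij (congrArg Subtype.val e)) (D.res H s)
      dsimp only at this
      simp only [h, h', dite_true, Functor.map_comp, Category.assoc,
        X.wrap_eq ⟨i, h⟩ (D.res_top h' s), X.wrap_eq ⟨i, h⟩ (D.res_bot h' s),
        X.wrap_eq ⟨j, h'⟩ (D.res_top h s), X.wrap_eq ⟨j, h'⟩ (D.res_bot h s), thin,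
        reassoc_of% F_thin]
      have e := (D.comm i j).hom.naturality (X.M.map (homOfLE
        (show D.res H (D.top i (D.top j s)) ≤ (D.restrict H).top ⟨i, h⟩
          ((D.restrict H).top ⟨j, h'⟩ (D.res H s)) by rw [D.res_top h, D.res_top h'])))
      simp only [Functor.comp_map] at e
      rw [reassoc_of% this, reassoc_of% e, reassoc_of% FF_thin, reassoc_of% FF_thin, thin]
    · simp only [h, h', dite_true, dite_false, Functor.map_comp, Category.assoc,
        reassoc_of% η_nat, X.wrap_eq ⟨i, h⟩ (D.res_top_of_notMem h' s),
        X.wrap_eq ⟨i, h⟩ (D.res_bot_of_notMem h' s), reassoc_of% F_thin, thin]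
      rw [← Functor.map_comp_assoc (D.F i) ((D.F j).map _), η_nat, Functor.map_comp_assoc,
        reassoc_of% η_comm' hij.symm, reassoc_of% F_thin]
    · simp only [h, h', dite_true, dite_false, Functor.map_comp, Category.assoc,
        reassoc_of% η_nat, X.wrap_eq ⟨j, h'⟩ (D.res_top_of_notMem h s),
        X.wrap_eq ⟨j, h'⟩ (D.res_bot_of_notMem h s), reassoc_of% F_thin, thin]
      rw [D.η_comm i j hij, Category.assoc]
    · simp only [h, h', dite_false, Functor.map_comp, Category.assoc,
        reassoc_of% η_nat, thin]
      rw [← reassoc_of% η_comm' hij.symm, reassoc_of% η_nat]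
  cycle i s := by
    by_cases h : i ∈ H
    · have := X.cycle ⟨i, h⟩ (D.res H s)
      simp only [h, dite_true, Category.assoc]
      rw [reassoc_of% F_thin, thin]
      exact this
    · simp only [h, dite_false, Category.assoc]
      rw [reassoc_of% F_thin, thin]
      simp

/-- The index set `∏_{i ∈ H} {1, …, p_i - 1}`.  As the `F_i`, `i ∈ H`, are replaced by `0` and the
`η_i` vanish on `C_H`, the category `C_H[0^H]` is that of functors from `SubIdx H` to `C_H`. -/
abbrev SubIdx (H : Finset σ) := Box fun i : H => D.p i - 1

instance (H : Finset σ) : HasFiniteBiproducts (D.SubIdx H ⥤ D.Vanish H) :=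
  HasFiniteBiproducts.of_hasFiniteProducts

/-- `δ^H (M)`, the iteration over `i ∈ H` of
`δ (M) = (M → ⋯ → M → M) ⊕ (M → ⋯ → M → 0) ⊕ ⋯ ⊕ (M → 0 → ⋯ → 0)` with `p_i - 1` terms. -/
def delta (H : Finset σ) (M : D.Vanish H) : D.SubIdx H ⥤ D.Vanish H :=
  ⨁ fun k : D.SubIdx H => block k M

/-- No coordinate of the index `s` of a grid over `H` is maximal. -/
def IsLower (H : Finset σ) (s : (D.restrict H).Idx) : Prop :=
  ∀ i : H, (s.coord i : ℕ) < D.p i - 1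

variable {D} in
lemma IsLower.of_le {H : Finset σ} {s t : (D.restrict H).Idx} (h : s ≤ t) (ht : D.IsLower H t) :
    D.IsLower H s := fun i => lt_of_le_of_lt (Fin.le_def.1 (h i)) (ht i)

/-- Such an `s` as an element of `SubIdx H`. -/
def lower (H : Finset σ) (s : (D.restrict H).Idx) (h : D.IsLower H s) : D.SubIdx H :=
  ⟨fun i => ⟨s.coord i, h i⟩⟩

open Classical in
/-- `ι^H : C_H[0^H] → C[η^H]` on objects: extension by zero to the indices `s` with `s_i = p_i`
for some `i ∈ H`. -/
def iota (H : Finset σ) (N : D.SubIdx H ⥤ D.Vanish H) : (D.restrict H).Grid where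
  M :=
    { obj s := if h : D.IsLower H s then (N.obj (D.lower H s h)).obj else 0
      map {s t} f :=
        if h : D.IsLower H t then
          eqToHom (by rw [dif_pos (h.of_le f.le)]) ≫
            (N.map (homOfLE (show D.lower H s (h.of_le f.le) ≤ D.lower H t h from
              fun i => f.le i))).hom ≫
            eqToHom (by rw [dif_pos h])
        else 0
      map_id s := by
        by_cases h : D.IsLower H s
        · simp [h]
        · exact (IsZero.of_iso (isZero_zero C) (eqToIso (dif_neg h))).eq_of_src _ _
      map_comp {s t r} f g := by
        by_cases h : D.IsLower H r
        · have h' := h.of_le g.le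
          simp only [h, h', dite_true, Category.assoc, eqToHom_trans_assoc,
            eqToHom_refl, Category.id_comp]
          rw [← ObjectProperty.FullSubcategory.comp_hom_assoc, ← Functor.map_comp, homOfLE_comp]
        · simp [h] }
  wrap i s := 0
  wrap_natural i s t hst := by simp
  wrap_comm i j h s := by simp
  cycle i s := by
    simp only [zero_comp, comp_zero]
    have key : D.vanishing H (if h : D.IsLower H s then (N.obj (D.lower H s h)).obj else 0) := by
      split_ifs with h
      · exact (N.obj _).property
      · exact fun _ _ => (isZero_zero C).eq_of_tgt _ _
    exact (key i i.2).symm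

end Grid

section Main

variable (D : RootData C σ)

/-- For all `I` and all `i ∉ I`, the category `C_I` has enough objects `M` such that `η_i (M)` is a
monomorphism. -/
def EnoughMono : Prop :=
  ∀ (I : Finset σ) (i : σ), i ∉ I → ∀ X : D.Vanish I,
    ∃ (M : D.Vanish I) (q : M ⟶ X), Epi q ∧ Mono ((D.η i).app M.obj)

/-- `M|_K = cok η_{c_1} (cok η_{c_2} (⋯ cok η_{c_k} (M)))` for the list `c_1, …, c_k`. -/
def cokList : List σ → C → C
  | [], M => M
  | c :: L, M => cokernel ((D.η c).app (cokList L M))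

lemma η_cokernel (i c : σ) (M : C) (h : i = c ∨ (D.η i).app M = 0) :
    (D.η i).app (cokernel ((D.η c).app M)) = 0 := by
  rw [← cancel_epi ((D.F i).map (cokernel.π _)), comp_zero, η_nat]
  rcases h with rfl | h
  · exact cokernel.condition _
  · exact (congrArg (· ≫ cokernel.π ((D.η c).app M)) h).trans zero_comp

lemma cokList_prop (I : Finset σ) (L : List σ) (M : C) (hM : D.vanishing I M) (i : σ)
    (hi : i ∈ I ∨ i ∈ L) : (D.η i).app (D.cokList L M) = 0 := by
  induction L with
  | nil => exact hM i (by simpa using hi)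
  | cons c L ih =>
    refine D.η_cokernel i c _ ?_
    by_cases h : i = c
    · exact Or.inl h
    · exact Or.inr (ih (by simpa [h] using hi))

end Main

end RootData

section

variable {C : Type u} [Category.{v} C] [Abelian C] {n : ℕ} (D : RootData C (Fin n))

/-- The restriction `M|_J` of an object `M` of `C_H`, as an object of `C_{H ∪ J}`. -/
def RootData.restr (H J : Finset (Fin n)) (M : D.Vanish H) : D.Vanish (H ∪ J) :=
  ⟨D.cokList (J.sort (· ≤ ·)) M.obj, fun i hi => D.cokList_prop H _ _ M.property i (by
    simpa using hi)⟩

end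

end

/-!
The idea is to compute `Ext` in the category of grids one direction at a time.

Fix an index `k`. A grid is of the type given by `k` in the direction `i` (`RootData.Typed`) if it
is zero for `s_i > k_i` and all maps `M_s ⟶ M_{s with s_i = k_i}` for `s_i ≤ k_i` are isomorphisms:
for `k_i = p_i` it is constant in this direction, for `k_i < p_i` it is a block. The grids of this
type in the directions in `S` form an abelian subcategory `Shape k S`. The grids that are so in all
directions are equivalent, by evaluation at `k`, to `C_I`, where `I` (the support of `k`) consists
of the `i` with `k_i < p_i` (`RootData.evCenter`). The given object is the direct sum of one such grid
for each `k`, with value `T_I` at `k` (`Grid.piRhoIotaDeltaIso`).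

The inclusion of `Shape k (insert i S)` into `Shape k S` is exact and has a left adjoint. For
`k_i = p_i` the adjoint is exact: it replaces all entries by the last ones in the direction `i`. For
`k_i < p_i` it takes the cokernel of the steps `F_i M_{s with s_i = p_i} ⟶ M_{s with s_i = k_i}`
(`Grid.cut`), and it is exact on the class of grids on which these steps are monomorphisms, by the
snake lemma. This class is closed under subobjects, and every object is a quotient of one in it
(`RootData.exists_cover`, the only place where `EnoughMono` is used). This suffices for
`Ext^n(L X, Y) ≅ Ext^n(X, Y)` for `X` in the class (`extVanishes_adj_iff`), so that the extensions
of `X` by a grid concentrated at `k` can be computed in `C_I` by applying the adjoints in all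
directions successively, as long as one remains in the class.

For rigidity, let `X` be concentrated at `l` with value `T_H`, and let `I` be the support of `k`.
If `H` is not contained in `I`, one of the adjoints kills `X`. Otherwise the adjoints in the
directions in `I \ H`, in descending order, replace the value `T_H` by the successive cokernels of
the `η_c`, the first hypothesis on the restrictions `T_H|_J` keeps the process within the class, and
the second one says that the result has no extensions by `T_I` (`RootData.extVanishes_of_support`).

For cogeneration, let `X` have no extensions by any of the summands, and let `X_t = 0` for all `t`
of smaller support than `k`. Then all steps involved in the adjoints have source zero, the value at
`k` does not change, and `X_k = 0` since `T_I` cogenerates (`RootData.isZero_of_extVanishes`).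
-/

noncomputable section

-- With this instance, `M ⟶ N` for functors `M` and `N` is not read as the type of natural
-- transformations.
attribute [-instance] catToReflQuiver

/-! ### Ext groups and adjoint functors -/

section ExtComparison

open Abelian DerivedCategory HomologicalComplex

universe w w' u₁ v₁ u₂ v₂

variable {A : Type u₁} [Category.{v₁} A] [Abelian A] {B : Type u₂} [Category.{v₂} B] [Abelian B]

/-- A quasi-isomorphism from a complex in nonpositive degrees to an object `X` is an epimorphism
onto `X` in degree zero. -/
lemma epi_f_zero_of_quasiIso {X : A} {K : CochainComplex A ℤ} [K.IsStrictlyLE 0]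
    (s : K ⟶ (single A (ComplexShape.up ℤ) 0).obj X) [QuasiIsoAt s 0] :
    Epi (s.f 0 ≫ (singleObjXSelf (ComplexShape.up ℤ) 0 X).hom) := by
  let e := K.iCyclesIso 0 1 (by simp)
    ((K.isZero_of_isStrictlyLE 0 1 (by simp)).eq_of_tgt _ _)
  have h : e.hom ≫ s.f 0 ≫ (singleObjXSelf (ComplexShape.up ℤ) 0 X).hom =
      K.homologyπ 0 ≫ homologyMap s 0 ≫ (singleObjHomologySelfIso _ _ _).hom := by
    dsimp [e]
    rw [homologyπ_naturality_assoc, homologyπ_singleObjHomologySelfIso_hom,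
      singleObjCyclesSelfIso_hom, cyclesMap_i_assoc, iCyclesIso_hom]
  have : Epi (e.hom ≫ s.f 0 ≫ (singleObjXSelf (ComplexShape.up ℤ) 0 X).hom) := by
    rw [h]
    exact epi_comp _ _
  exact epi_of_epi e.hom _

/-- Extensions of positive degree are effaceable: each becomes zero on some object that maps onto
`X`, namely the degree zero term of the source of a roof that represents it. -/
lemma ext_exists_epi_comp_eq_zero [HasExt.{w} A] {X Y : A} {n : ℕ} (e : Ext X Y (n + 1)) :
    ∃ (P : A) (π : P ⟶ X), Epi π ∧ (Ext.mk₀ π).comp e (zero_add _) = 0 := by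
  let := HasDerivedCategory.standard A
  let φ : Q.obj ((CochainComplex.singleFunctor A 0).obj X) ⟶
    Q.obj ((CochainComplex.singleFunctor A (-(n + 1))).obj Y) :=
    e.hom ≫ (((singleFunctors A).shiftIso (n + 1) (-(n + 1)) 0 (by lia)).hom.app Y)
  obtain ⟨K, _, s, hs, g, hg⟩ := right_fac_of_isStrictlyLE φ 0
  have hs' := hs
  rw [isIso_Q_map_iff_quasiIso] at hs'
  let s' : K ⟶ (single A (ComplexShape.up ℤ) 0).obj X := s
  have : QuasiIsoAt s' 0 := hs'.quasiIsoAt 0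
  refine ⟨K.X 0, _, epi_f_zero_of_quasiIso s', ?_⟩
  let j : (single A (ComplexShape.up ℤ) 0).obj (K.X 0) ⟶ K := mkHomFromSingle (𝟙 _) (by
      rintro _ rfl
      apply (K.isZero_of_isStrictlyLE 0 _ (by simp)).eq_of_tgt)
  have hj : j ≫ s' = (single A (ComplexShape.up ℤ) 0).map
      (s'.f 0 ≫ (singleObjXSelf (ComplexShape.up ℤ) 0 X).hom) := by
    apply HomologicalComplex.from_single_hom_ext
    simp [j, single_map_f_self]
  let j' : (CochainComplex.singleFunctor A 0).obj (K.X 0) ⟶ K := j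
  have hjg : j' ≫ g = 0 := by
    apply HomologicalComplex.from_single_hom_ext
    apply (CochainComplex.isZero_of_isStrictlyLE _ (-(n + 1)) 0 (by lia)).eq_of_tgt
  apply Ext.homEquiv.injective
  rw [← cancel_mono (((singleFunctors A).shiftIso (n + 1) (-(n + 1)) 0
    (by lia)).hom.app _)]
  have key : Q.map ((CochainComplex.singleFunctor A 0).map
      (s'.f 0 ≫ (singleObjXSelf (ComplexShape.up ℤ) 0 X).hom)) ≫ φ = 0 := by
    rw [hg]
    have : (CochainComplex.singleFunctor A 0).map
      (s'.f 0 ≫ (singleObjXSelf (ComplexShape.up ℤ) 0 X).hom) = j' ≫ s := hj.symm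
    rw [this, Functor.map_comp, Category.assoc, IsIso.hom_inv_id_assoc, ← Functor.map_comp, hjg,
      Functor.map_zero]
  change Ext.hom _ ≫ _ = Ext.hom _ ≫ _
  rw [Ext.zero_hom, Limits.zero_comp, Ext.comp_hom, Ext.mk₀_hom, ShiftedHom.mk₀_comp,
    Category.assoc]
  exact key

variable {L : A ⥤ B} {R : B ⥤ A} (adj : L ⊣ R) [R.Additive] [PreservesFiniteLimits R]
  [PreservesFiniteColimits R] [HasExt.{w} A] [HasExt.{w'} B]

/-- The comparison map `Ext^i(L X, Y) ⟶ Ext^i(X, R Y)` of an adjunction `L ⊣ R` with `R` exact. -/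
def extAdj {X : A} {Y : B} {i : ℕ} (e : Ext (L.obj X) Y i) : Ext X (R.obj Y) i :=
  (Ext.mk₀ (adj.unit.app X)).comp (e.mapExactFunctor R) (zero_add i)

lemma extAdj_mk₀ {X : A} {Y : B} (f : L.obj X ⟶ Y) :
    extAdj adj (Ext.mk₀ f) = Ext.mk₀ (adj.homEquiv _ _ f) := by
  simp [extAdj, Ext.mapExactFunctor_mk₀, Adjunction.homEquiv_unit]

lemma extAdj_add {X : A} {Y : B} {i : ℕ} (e e' : Ext (L.obj X) Y i) :
    extAdj adj (e + e') = extAdj adj e + extAdj adj e' := by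
  simp [extAdj, Ext.mapExactFunctor_add]

lemma extAdj_mk₀_comp {X X' : A} {Y : B} {i : ℕ} (f : X' ⟶ X) (e : Ext (L.obj X) Y i) :
    extAdj adj ((Ext.mk₀ (L.map f)).comp e (zero_add i)) =
      (Ext.mk₀ f).comp (extAdj adj e) (zero_add i) := by
  simp [extAdj, Ext.mapExactFunctor_comp, Ext.mapExactFunctor_mk₀]

/-- `extAdj` commutes with the connecting maps of a short exact sequence on which `L` is exact. -/
lemma extAdj_extClass_comp {X₁ X₂ X₃ : A} {f : X₁ ⟶ X₂} {g : X₂ ⟶ X₃} {w : f ≫ g = 0}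
    (hS : (ShortComplex.mk f g w).ShortExact) {w' : L.map f ≫ L.map g = 0}
    (hLS : (ShortComplex.mk (L.map f) (L.map g) w').ShortExact) {Y : B}
    {i : ℕ} (e : Ext (L.obj X₁) Y i) {j : ℕ} (h : 1 + i = j) :
    extAdj adj (hLS.extClass.comp e h) = hS.extClass.comp (extAdj adj e) h := by
  have w'' : R.map (L.map f) ≫ R.map (L.map g) = 0 := by rw [← R.map_comp, w', R.map_zero]
  have hRS : (ShortComplex.mk (R.map (L.map f)) (R.map (L.map g)) w'').ShortExact :=
    hLS.map_of_exact R
  have h1 : hLS.extClass.mapExactFunctor R = hRS.extClass := Ext.mapExactFunctor_extClass R hLS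
  let τ : ShortComplex.mk f g w ⟶ ShortComplex.mk (R.map (L.map f)) (R.map (L.map g)) w'' :=
    { τ₁ := adj.unit.app X₁
      τ₂ := adj.unit.app X₂
      τ₃ := adj.unit.app X₃
      comm₁₂ := adj.unit_naturality f
      comm₂₃ := adj.unit_naturality g }
  have h2 : hS.extClass.comp (Ext.mk₀ (adj.unit.app X₁)) (add_zero 1) =
      (Ext.mk₀ (adj.unit.app X₃)).comp hRS.extClass (zero_add 1) :=
    ShortComplex.ShortExact.extClass_naturality hS hRS τ
  have h3 : (hLS.extClass.comp e h).mapExactFunctor R =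
      hRS.extClass.comp (e.mapExactFunctor R) h := by
    rw [← h1]; exact Ext.mapExactFunctor_comp R _ _ _
  have h4 := congrArg (fun z => Ext.comp z (e.mapExactFunctor R) h) h2
  dsimp only at h4
  rw [Ext.comp_assoc (a₂₃ := i) _ _ _ (by lia) (by lia) (by lia),
    Ext.comp_assoc (a₂₃ := j) _ _ _ (by lia) (by lia) (by lia)] at h4
  exact (congrArg (fun z => (Ext.mk₀ (adj.unit.app X₃)).comp z (zero_add j)) h3).trans h4.symm

/-- The comparison `Ext^i(L X, Y) ⟶ Ext^i(X, R Y)` is bijective for good `X`. For the induction on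
the degree, an extension is effaced by an epimorphism from a good object; on its kernel sequence
`L` is exact, so that the two long exact sequences can be compared. -/
theorem extAdj_bijective (good : A → Prop)
    (good_of_mono : ∀ {X' X : A} (f : X' ⟶ X) [Mono f], good X → good X')
    (enough : ∀ X : A, ∃ (P : A) (π : P ⟶ X), good P ∧ Epi π)
    (mono_map : ∀ S : ShortComplex A, S.ShortExact → good S.X₂ → good S.X₃ → Mono (L.map S.f))
    (i : ℕ) : ∀ (X : A) (_ : good X) (Y : B),
    Function.Bijective (extAdj adj (X := X) (Y := Y) (i := i)) := by
  have := adj.leftAdjoint_preservesColimits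
  have : L.PreservesZeroMorphisms := inferInstance
  have hses : ∀ (X P : A) (π : P ⟶ X) [Epi π], good X → good P →
      (ShortComplex.mk (kernel.ι π) π (kernel.condition π)).ShortExact ∧
      ∃ w, (ShortComplex.mk (L.map (kernel.ι π)) (L.map π) w).ShortExact := by
    intro X P π _ hX hP
    have hS : (ShortComplex.mk (kernel.ι π) π (kernel.condition π)).ShortExact :=
      { exact := ShortComplex.exact_of_f_is_kernel _ (kernelIsKernel π) }
    have hm := mono_map _ hS hP hX
    have he : Epi (L.map π) := inferInstance
    exact ⟨hS, by rw [← L.map_comp, kernel.condition, L.map_zero],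
      { exact := hS.exact.map_of_epi_of_preservesCokernel L (by assumption) inferInstance
        mono_f := hm
        epi_g := he }⟩
  -- an epimorphism onto `X` can be dominated by one from a good object
  have cover : ∀ {X P : A} (π : P ⟶ X) [Epi π], ∃ (P' : A) (q : P' ⟶ P), good P' ∧ Epi (q ≫ π) :=
    fun {X P} π _ => by
      obtain ⟨P', q, h, _⟩ := enough P
      exact ⟨P', q, h, epi_comp _ _⟩
  induction i with
  | zero =>
    intro X _ Y
    have : (extAdj adj (X := X) (Y := Y) (i := 0)) =
        Ext.mk₀ ∘ adj.homEquiv X Y ∘ Ext.homEquiv₀ := by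
      funext e
      obtain ⟨f, rfl⟩ := (Ext.mk₀_bijective _ _).2 e
      simp [extAdj_mk₀, Ext.homEquiv₀]
    rw [this]
    exact (Ext.mk₀_bijective _ _).comp ((adj.homEquiv X Y).bijective.comp Ext.homEquiv₀.bijective)
  | succ i ih =>
    intro X hX Y
    constructor
    · suffices ∀ e : Ext (L.obj X) Y (i + 1), extAdj adj e = 0 → e = 0 by
        intro e e' h
        have h2 := this (e - e') (by
          have := extAdj_add adj (e - e') e'
          rw [sub_add_cancel, h] at this
          simpa using this)
        exact sub_eq_zero.1 h2
      intro e he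
      obtain ⟨B', b, _, hb⟩ := ext_exists_epi_comp_eq_zero e
      let u : X ⟶ R.obj (L.obj X) := adj.unit.app X
      have hu : (adj.homEquiv X (L.obj X)).symm u = 𝟙 _ := adj.homEquiv_symm_unit X
      obtain ⟨P, q, hP, _⟩ := cover (pullback.fst u (R.map b))
      let π := q ≫ pullback.fst u (R.map b)
      have hπ : L.map π = (adj.homEquiv _ _).symm (q ≫ pullback.snd u (R.map b)) ≫ b := by
        rw [← adj.homEquiv_naturality_right_symm, Category.assoc, ← pullback.condition,
          ← Category.assoc, adj.homEquiv_naturality_left_symm, hu, Category.comp_id]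
      have h0 : (Ext.mk₀ (L.map π)).comp e (zero_add _) = 0 := by
        rw [hπ, ← Ext.mk₀_comp_mk₀_assoc, hb, Ext.comp_zero]
      obtain ⟨hS, w, hLS⟩ := hses X P π hX hP
      obtain ⟨e', rfl⟩ := Ext.contravariant_sequence_exact₃ hLS Y e h0 (add_comm 1 i)
      rw [extAdj_extClass_comp adj hS hLS] at he
      obtain ⟨x, hx⟩ := Ext.contravariant_sequence_exact₁ hS _ _ _ he
      obtain ⟨e'', rfl⟩ := (ih P hP Y).2 x
      dsimp only at hx
      rw [← extAdj_mk₀_comp] at hx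
      rw [← (ih _ (good_of_mono (kernel.ι π) hP) Y).1 hx]
      exact hLS.extClass_comp_assoc _
    · intro a
      obtain ⟨X', b, _, hb⟩ := ext_exists_epi_comp_eq_zero a
      obtain ⟨P, q, hP, _⟩ := cover b
      obtain ⟨hS, w, hLS⟩ := hses X P (q ≫ b) hX hP
      obtain ⟨a', rfl⟩ := Ext.contravariant_sequence_exact₃ hS _ a (by
        dsimp only
        rw [← Ext.mk₀_comp_mk₀_assoc, hb, Ext.comp_zero]) (add_comm 1 i)
      obtain ⟨e, rfl⟩ := (ih _ (good_of_mono (kernel.ι (q ≫ b)) hP) Y).2 a'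
      exact ⟨hLS.extClass.comp e _, extAdj_extClass_comp adj hS hLS e _⟩

end ExtComparison

section ExtVanishes

universe u' v'

variable {A : Type u} [Category.{v} A] [Abelian A] {B : Type u'} [Category.{v'} B] [Abelian B]

/-- Let `L` be left adjoint to the exact functor `R`.  Then `Ext^i(L X, Y) ≅ Ext^i(X, R Y)` for all
`X` in a class of good objects that is closed under subobjects, has enough objects, and on whose
short exact sequences `L` is exact. -/
theorem extVanishes_adj_iff {L : A ⥤ B} {R : B ⥤ A} (adj : L ⊣ R) [PreservesFiniteLimits R]
    [PreservesFiniteColimits R] (good : A → Prop)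
    (good_of_mono : ∀ {X' X : A} (f : X' ⟶ X) [Mono f], good X → good X')
    (enough : ∀ X : A, ∃ (P : A) (π : P ⟶ X), good P ∧ Epi π)
    (mono_map : ∀ S : ShortComplex A, S.ShortExact → good S.X₂ → good S.X₃ → Mono (L.map S.f))
    {X : A} (hX : good X) (Y : B) (i : ℕ) :
    ExtVanishes (L.obj X) Y i ↔ ExtVanishes X (R.obj Y) i := by
  have : R.Additive := R.additive_of_preserves_binary_products
  let : HasExt.{max u v} A := HasExt.standard A
  let : HasExt.{max u' v'} B := HasExt.standard B
  exact (Equiv.ofBijective _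
    (extAdj_bijective adj good good_of_mono enough mono_map i X hX Y)).subsingleton_congr

/-- The case of `extVanishes_adj_iff` in which both adjoint functors are exact. -/
theorem extVanishes_adj_iff_of_exact {L : A ⥤ B} {R : B ⥤ A} (adj : L ⊣ R)
    [PreservesFiniteLimits R] [PreservesFiniteColimits R] [L.PreservesMonomorphisms]
    (X : A) (Y : B) (i : ℕ) :
    ExtVanishes (L.obj X) Y i ↔ ExtVanishes X (R.obj Y) i :=
  extVanishes_adj_iff adj (fun _ => True) (fun _ _ _ => trivial)
    (fun X => ⟨X, 𝟙 X, trivial, inferInstance⟩)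
    (fun S hS _ _ => by have := hS.mono_f; infer_instance) trivial Y i

lemma ExtVanishes.of_retract_left {X X' Y : A} {i : ℕ} (s : X ⟶ X') (r : X' ⟶ X)
    (h : s ≫ r = 𝟙 X) (hX' : ExtVanishes X' Y i) : ExtVanishes X Y i := by
  let : HasExt.{max u v} A := HasExt.standard A
  have : Subsingleton (Abelian.Ext X' Y i) := hX'
  refine ⟨fun a b => ?_⟩
  rw [← a.mk₀_id_comp, ← b.mk₀_id_comp, ← h, ← Abelian.Ext.mk₀_comp_mk₀_assoc,
    ← Abelian.Ext.mk₀_comp_mk₀_assoc]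
  congr 1
  exact Subsingleton.elim _ _

lemma ExtVanishes.of_retract_right {X Y Y' : A} {i : ℕ} (s : Y ⟶ Y') (r : Y' ⟶ Y)
    (h : s ≫ r = 𝟙 Y) (hY' : ExtVanishes X Y' i) : ExtVanishes X Y i := by
  let : HasExt.{max u v} A := HasExt.standard A
  have : Subsingleton (Abelian.Ext X Y' i) := hY'
  refine ⟨fun a b => ?_⟩
  rw [← a.comp_mk₀_id, ← b.comp_mk₀_id, ← h, ← Abelian.Ext.mk₀_comp_mk₀,
    ← Abelian.Ext.comp_assoc (a₁₂ := i) _ _ _ (by lia) (by lia) (by lia),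
    ← Abelian.Ext.comp_assoc (a₁₂ := i) _ _ _ (by lia) (by lia) (by lia)]
  congr 1
  exact Subsingleton.elim _ _

lemma ExtVanishes.congr_left {X X' Y : A} {i : ℕ} (e : X ≅ X') :
    ExtVanishes X Y i ↔ ExtVanishes X' Y i :=
  ⟨.of_retract_left e.inv e.hom e.inv_hom_id, .of_retract_left e.hom e.inv e.hom_inv_id⟩

lemma ExtVanishes.congr_right {X Y Y' : A} {i : ℕ} (e : Y ≅ Y') :
    ExtVanishes X Y i ↔ ExtVanishes X Y' i :=
  ⟨.of_retract_right e.inv e.hom e.inv_hom_id, .of_retract_right e.hom e.inv e.hom_inv_id⟩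

lemma ExtVanishes.of_isZero_left {X Y : A} (h : IsZero X) (i : ℕ) : ExtVanishes X Y i := by
  let : HasExt.{max u v} A := HasExt.standard A
  refine ⟨fun a b => ?_⟩
  rw [← a.mk₀_id_comp, ← b.mk₀_id_comp, h.eq_of_src (𝟙 X) 0]
  simp

lemma ExtVanishes.biproduct_left {J : Type} [Finite J] [HasFiniteBiproducts A] {X : J → A} {Y : A}
    {i : ℕ} (h : ∀ j, ExtVanishes (X j) Y i) : ExtVanishes (⨁ X) Y i := by
  let : HasExt.{max u v} A := HasExt.standard A
  have := Fintype.ofFinite J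
  have : ∀ j, Subsingleton (Abelian.Ext (X j) Y i) := h
  exact (Abelian.Ext.biproductAddEquiv (biproduct.isBilimit X) Y i).toEquiv.subsingleton

lemma ExtVanishes.biproduct_right {J : Type} [Finite J] [HasFiniteBiproducts A] {X : A} {Y : J → A}
    {i : ℕ} (h : ∀ j, ExtVanishes X (Y j) i) : ExtVanishes X (⨁ Y) i := by
  let : HasExt.{max u v} A := HasExt.standard A
  have := Fintype.ofFinite J
  have : ∀ j, Subsingleton (Abelian.Ext X (Y j) i) := h
  exact (Abelian.Ext.addEquivBiproduct X (biproduct.isBilimit Y) i).toEquiv.subsingleton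

end ExtVanishes

/-! ### Pointwise properties of grids -/

namespace RootData

variable {C : Type u} [Category.{v} C] [Abelian C] {σ : Type} [DecidableEq σ] {D : RootData C σ}

namespace Grid

instance : PreservesFiniteLimits (forget D) :=
  (forget D).preservesFiniteLimits_of_preservesKernels

instance : PreservesFiniteColimits (forget D) :=
  (forget D).preservesFiniteColimits_of_preservesCokernels

variable (D) in
/-- Evaluation of grids at an index. -/
abbrev ev (s : D.Idx) : D.Grid ⥤ C := forget D ⋙ (evaluation D.Idx C).obj s

instance (s : D.Idx) : PreservesFiniteLimits (ev D s) := comp_preservesFiniteLimits _ _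
instance (s : D.Idx) : PreservesFiniteColimits (ev D s) := comp_preservesFiniteColimits _ _

variable {X Y Z : D.Grid}

instance (f : X ⟶ Y) [Mono f] (s : D.Idx) : Mono (f.app.app s) :=
  inferInstanceAs (Mono ((ev D s).map f))

instance (f : X ⟶ Y) [Epi f] (s : D.Idx) : Epi (f.app.app s) :=
  inferInstanceAs (Epi ((ev D s).map f))

instance (f : X ⟶ Y) [IsIso f] (s : D.Idx) : IsIso (f.app.app s) :=
  inferInstanceAs (IsIso ((ev D s).map f))

lemma mono_of_app (f : X ⟶ Y) (h : ∀ s, Mono (f.app.app s)) : Mono f :=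
  (forget D).mono_of_mono_map (NatTrans.mono_of_mono_app f.app)

lemma epi_of_app (f : X ⟶ Y) (h : ∀ s, Epi (f.app.app s)) : Epi f :=
  (forget D).epi_of_epi_map (NatTrans.epi_of_epi_app f.app)

lemma isIso_of_app (f : X ⟶ Y) (h : ∀ s, IsIso (f.app.app s)) : IsIso f := by
  have : IsIso ((forget D).map f) := NatIso.isIso_of_isIso_app f.app
  exact isIso_of_reflects_iso f (forget D)

lemma isZero_iff : IsZero X ↔ ∀ s, IsZero (X.M.obj s) := by
  refine ⟨fun h s => (ev D s).map_isZero h, fun h => ?_⟩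
  rw [IsZero.iff_id_eq_zero]
  ext s
  exact (h s).eq_of_src _ _

lemma comp_app_app (f : X ⟶ Y) (g : Y ⟶ Z) (s : D.Idx) :
    (f ≫ g).app.app s = f.app.app s ≫ g.app.app s := rfl

lemma app_map (f : X ⟶ Y) {s t : D.Idx} (h : s ≤ t) :
    X.M.map (homOfLE h) ≫ f.app.app t = f.app.app s ≫ Y.M.map (homOfLE h) :=
  f.app.naturality _

lemma F_app_map (G : C ⥤ C) (f : X ⟶ Y) {s t : D.Idx} (h : s ≤ t) :
    G.map (X.M.map (homOfLE h)) ≫ G.map (f.app.app t) =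
      G.map (f.app.app s) ≫ G.map (Y.M.map (homOfLE h)) := by
  rw [← G.map_comp, app_map, G.map_comp]

lemma exact_app {S : ShortComplex D.Grid} (hS : S.ShortExact) (s : D.Idx) :
    (ShortComplex.mk (S.f.app.app s) (S.g.app.app s)
      (by rw [← comp_app_app, S.zero]; rfl)).ShortExact :=
  hS.map_of_exact (ev D s)

lemma exact_app' {X₁ X₂ X₃ : D.Grid} {f : X₁ ⟶ X₂} {g : X₂ ⟶ X₃} {w : f ≫ g = 0}
    (h : (ShortComplex.mk f g w).Exact) (s : D.Idx) :
    (ShortComplex.mk (f.app.app s) (g.app.app s)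
      (by rw [← comp_app_app, w]; rfl)).Exact :=
  h.map (ev D s)

end Grid

/-! ### Reindexing -/

variable (D) in
/-- A monotone self-map `fn` of the index set along which grids can be pulled back: by `top_le` and
`bot_le`, the step `wrap j (fn s)` induces one for the pullback at `s`. -/
structure Reindex where
  fn : D.Idx → D.Idx
  mono : ∀ {s t}, s ≤ t → fn s ≤ fn t
  top_le : ∀ j s, fn (D.top j s) ≤ D.top j (fn s)
  bot_le : ∀ j s, D.bot j (fn s) ≤ fn (D.bot j s)

namespace Grid

/-- The naturality of `wrap`, with an arbitrary map attached. -/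
lemma wrap_map (X : D.Grid) (i : σ) {s t : D.Idx} (h : s ≤ t) {Z : C}
    (g : X.M.obj (D.bot i t) ⟶ Z) :
    (D.F i).map (X.M.map (homOfLE (D.top_mono i h))) ≫ X.wrap i t ≫ g =
      X.wrap i s ≫ X.M.map (homOfLE (D.bot_mono i h)) ≫ g := by
  rw [reassoc_of% X.wrap_natural i h]

/-- Two consecutive steps in the directions `i` and `j`, taken at indices `q ≤ top j s` and
`w ≥ bot i s`, agree with those taken at `s`. -/
lemma wrap_wrap (X : D.Grid) {i j : σ} (hij : i ≠ j) (s : D.Idx) {p q w z : D.Idx}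
    (hq : q ≤ D.top j s) (hw : D.bot i s ≤ w) (h₁ : p ≤ D.top i q) (h₂ : D.bot i q ≤ D.top j w)
    (h₃ : D.bot j w ≤ z) :
    (D.F j).map ((D.F i).map (X.M.map (homOfLE h₁))) ≫ (D.F j).map (X.wrap i q) ≫
      (D.F j).map (X.M.map (homOfLE h₂)) ≫ X.wrap j w ≫ X.M.map (homOfLE h₃) =
    (D.F j).map ((D.F i).map (X.M.map (homOfLE (h₁.trans (D.top_mono i hq))))) ≫
      (D.F j).map (X.wrap i (D.top j s)) ≫ (D.F j).map (X.M.map (homOfLE (D.bot_top hij s).le)) ≫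
      X.wrap j (D.bot i s) ≫ X.M.map (homOfLE ((D.bot_mono j hw).trans h₃)) := by
  rw [← thin X.M (D.bot_mono j hw) h₃, ← X.wrap_map j hw, reassoc_of% F_thin,
    ← FF_thin (D.F j) (D.F i) X.M h₁ (D.top_mono i hq), Category.assoc,
    ← Functor.map_comp_assoc (D.F j) ((D.F i).map (X.M.map (homOfLE (D.top_mono i hq)))),
    X.wrap_natural i hq, Functor.map_comp_assoc, reassoc_of% F_thin]

/-- The pullback of a grid along a self-map of the index set. -/
@[simps, reducible]
def reindexObj (r : D.Reindex) (X : D.Grid) : D.Grid where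
  M :=
    { obj s := X.M.obj (r.fn s)
      map f := X.M.map (homOfLE (r.mono f.le))
      map_id s := by simp
      map_comp f g := by rw [thin] }
  wrap i s := (D.F i).map (X.M.map (homOfLE (r.top_le i s))) ≫ X.wrap i (r.fn s) ≫
    X.M.map (homOfLE (r.bot_le i s))
  wrap_natural i s t h := by
    simp only [Category.assoc, reassoc_of% F_thin, thin]
    rw [← thin X.M (D.bot_mono i (r.mono h)) (r.bot_le i t), ← X.wrap_map i (r.mono h),
      reassoc_of% F_thin]
  wrap_comm i j h s := by
    have e1 := X.wrap_comm i j h (r.fn s)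
    have e2 := (D.comm i j).hom.naturality (X.M.map (homOfLE
      (((r.top_le i (D.top j s)).trans (D.top_mono i (r.top_le j s))))))
    simp only [Functor.comp_map] at e2
    simp only [Functor.map_comp, Category.assoc, reassoc_of% F_thin, reassoc_of% FF_thin, thin]
    rw [X.wrap_wrap h (r.fn s) (r.top_le j s) (r.bot_le i s),
      X.wrap_wrap h.symm (r.fn s) (r.top_le i s) (r.bot_le j s), reassoc_of% e1,
      reassoc_of% e2, thin, reassoc_of% FF_thin]
  cycle i s := by
    simp only [Category.assoc, reassoc_of% F_thin, thin]
    exact X.cycle i (r.fn s)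

/-- Pullback of grids along a self-map of the index set, as a functor. -/
@[simps, reducible]
def reindex (r : D.Reindex) : D.Grid ⥤ D.Grid where
  obj := reindexObj r
  map f :=
    { app :=
        { app s := f.app.app (r.fn s)
          naturality s t h := f.app.naturality _ }
      comm i s := by
        simp only [Category.assoc]
        rw [app_map, ← reassoc_of% F_app_map, reassoc_of% f.comm] }
  map_id _ := rfl
  map_comp _ _ := rfl

/-- The map from a grid to its pullback along an increasing self-map. -/
@[simps]
def toReindex {r : D.Reindex} (h : ∀ s, s ≤ r.fn s) : 𝟭 _ ⟶ reindex r where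
  app X :=
    { app :=
        { app s := X.M.map (homOfLE (h s))
          naturality s t f := by
            simp only [thin]
            exact thin X.M f.le (h t) }
      comm i s := by
        simp only [reassoc_of% F_thin, Functor.id_obj]
        rw [X.wrap_map i (h s), thin] }
  naturality X Y f := by
    ext s
    exact (f.app.naturality _).symm

end Grid

/-- Changing the `i`-th coordinate by a monotone map. -/
@[simps]
def Reindex.coord (i : σ) (f : Fin (D.p i) →o Fin (D.p i)) : D.Reindex where
  fn s := s.set i (f (s.coord i))
  mono {s t} h j := by
    by_cases hj : j = i
    · subst hj; simpa using f.monotone (h j)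
    · simpa [Box.set_of_ne _ _ hj] using h j
  top_le j s k := by
    by_cases hk : k = i <;> by_cases hj : k = j
    · subst hk; subst hj
      simp only [top, Box.set_self, Fin.le_def]
      have := (f ⟨D.p k - 1, by have := D.two_le_p k; omega⟩).2
      omega
    · subst hk; simp [top, Box.set_of_ne _ _ hj]
    · subst hj; simp [top, Box.set_of_ne _ _ hk]
    · simp [top, Box.set_of_ne _ _ hk, Box.set_of_ne _ _ hj]
  bot_le j s k := by
    by_cases hk : k = i <;> by_cases hj : k = j
    · subst hk; subst hj
      simp only [bot, Box.set_self, Fin.le_def]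
      omega
    · subst hk; simp [bot, Box.set_of_ne _ _ hj]
    · subst hj; simp [bot, Box.set_of_ne _ _ hk]
    · simp [bot, Box.set_of_ne _ _ hk, Box.set_of_ne _ _ hj]

end RootData

/-! ### The block quotient of a grid -/

namespace RootData

variable {C : Type u} [Category.{v} C] [Abelian C]

lemma mono_η_of_mono {σ : Type} {D : RootData C σ} (i : σ) {A B : C} (f : A ⟶ B) [Mono f]
    (h : Mono ((D.η i).app B)) : Mono ((D.η i).app A) := by
  have h2 : Mono ((D.F i).map f ≫ (D.η i).app B) := mono_comp _ _
  rw [η_nat] at h2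
  exact mono_of_mono _ f

section Truncation

variable {Q : Type} [PartialOrder Q] (p : Q → Prop) (hp : ∀ s t, s ≤ t → p t → p s) (M : Q ⥤ C)

open Classical in
/-- The quotient of a functor on a poset that is zero outside of a lower set `p`. -/
def trunc : Q ⥤ C where
  obj s := if p s then M.obj s else 0
  map {s t} f := if h : p t then
    eqToHom (if_pos (hp _ _ f.le h)) ≫ M.map f ≫ eqToHom (if_pos h).symm else 0
  map_id s := by
    split_ifs with h
    · simp
    · exact (IsZero.of_iso (isZero_zero C) (eqToIso (if_neg h))).eq_of_src _ _
  map_comp {s t r} f g := by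
    by_cases h : p r
    · simp [h, hp _ _ g.le h]
    · simp [h]

lemma trunc_isZero {s : Q} (h : ¬ p s) : IsZero ((trunc p hp M).obj s) :=
  IsZero.of_iso (isZero_zero C) (eqToIso (if_neg h))

open Classical in
/-- The projection to the truncation. -/
def toTrunc : M ⟶ trunc p hp M where
  app s := if h : p s then eqToHom (if_pos h).symm else 0
  naturality s t f := by
    by_cases h : p t
    · simp [trunc, h, hp _ _ f.le h]
    · exact (trunc_isZero p hp M h).eq_of_tgt _ _

lemma isIso_toTrunc_app {s : Q} (h : p s) : IsIso ((toTrunc p hp M).app s) := by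
  have : (toTrunc p hp M).app s = eqToHom (if_pos h).symm := dif_pos h
  rw [this]
  exact (eqToIso (if_pos h).symm).isIso_hom

instance epi_toTrunc_app (s : Q) : Epi ((toTrunc p hp M).app s) := by
  by_cases h : p s
  · have := isIso_toTrunc_app p hp M h
    infer_instance
  · exact ⟨fun _ _ _ => (trunc_isZero p hp M h).eq_of_src _ _⟩

end Truncation

variable {σ : Type} [DecidableEq σ] {D : RootData C σ}

/-- The self-map of the index set that replaces the `i`-th coordinate by its maximum with `x`. -/
abbrev raise (i : σ) (x : Fin (D.p i)) : D.Reindex :=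
  Reindex.coord i ⟨fun y => max y x, fun _ _ h => max_le_max_right x h⟩

lemma le_raise (i : σ) (x : Fin (D.p i)) (s : D.Idx) : s ≤ (raise i x).fn s := by
  intro j
  by_cases hj : j = i
  · subst hj; rw [Reindex.coord_fn, Box.set_self]; exact le_max_left _ _
  · simp [Box.set_of_ne _ _ hj]

namespace Grid

variable (X : D.Grid) (i : σ) (x : Fin (D.p i))

/-- The functor of the sources of the steps in the direction `i`. -/
@[simps, reducible]
def wrapSource : D.Idx ⥤ C where
  obj s := (D.F i).obj (X.M.obj (D.top i s))
  map f := (D.F i).map (X.M.map (homOfLE (D.top_mono i f.le)))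
  map_id s := by simp
  map_comp f g := by rw [F_thin]

/-- The composites `F_i M_{s with s_i = p_i} ⟶ M_{s with s_i = max (s_i, x)}` of steps. -/
@[simps, reducible]
def wrapTo : wrapSource X i ⟶ ((reindex (raise i x)).obj X).M where
  app s := X.wrap i s ≫ X.M.map (homOfLE ((D.bot_le i s).trans (le_raise i x s)))
  naturality s t h := by
    simp only [Category.assoc, thin]
    rw [X.wrap_map i h.le, thin]

/-- The functor underlying `Grid.cut`: the cokernel of `wrapTo`, truncated to the range
`s_i ≤ x`. -/
abbrev cutFun : D.Idx ⥤ C :=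
  trunc (fun s => s.coord i ≤ x) (fun _ _ h h' => (h i).trans h') (cokernel (wrapTo X i x))

/-- The map of functors underlying `Grid.toCut`. -/
def toCutFun : ((reindex (raise i x)).obj X).M ⟶ cutFun X i x :=
  cokernel.π (wrapTo X i x) ≫ toTrunc _ (fun _ _ h h' => (h i).trans h') _

instance (s : D.Idx) : Epi ((toCutFun X i x).app s) := by
  have h1 : Epi ((cokernel.π (wrapTo X i x)).app s) := inferInstance
  exact epi_comp _ _

lemma cutFun_isZero {s : D.Idx} (h : ¬ s.coord i ≤ x) : IsZero ((cutFun X i x).obj s) :=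
  trunc_isZero _ (fun _ _ h h' => (h i).trans h') _ h

lemma wrapTo_toCutFun (s : D.Idx) : (wrapTo X i x).app s ≫ (toCutFun X i x).app s = 0 := by
  have h : wrapTo X i x ≫ toCutFun X i x = 0 := (cokernel.condition_assoc _ _).trans zero_comp
  exact congrArg (fun f => NatTrans.app f s) h

/-- The map `toCutFun` is, within the range `s_i ≤ x`, a cokernel of `wrapTo`, and remains one
after applying a right exact functor `G`. -/
lemma toCutFun_desc {s : D.Idx} (h : s.coord i ≤ x) (G : C ⥤ C) [PreservesFiniteColimits G] {A : C}
    (f : G.obj (X.M.obj ((raise i x).fn s)) ⟶ A) (w : G.map ((wrapTo X i x).app s) ≫ f = 0) :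
    ∃ l : G.obj ((cutFun X i x).obj s) ⟶ A, G.map ((toCutFun X i x).app s) ≫ l = f := by
  obtain ⟨l, hl⟩ : ∃ l : G.obj ((cokernel (wrapTo X i x)).obj s) ⟶ A,
      G.map ((cokernel.π (wrapTo X i x)).app s) ≫ l = f :=
    have := CokernelCofork.IsColimit.desc' (CokernelCofork.mapIsColimit _
      (cokernelIsCokernel (wrapTo X i x)) ((evaluation D.Idx C).obj s ⋙ G)) f w
    ⟨this.1, this.2⟩
  have := isIso_toTrunc_app (fun s : D.Idx => s.coord i ≤ x) (fun _ _ h h' => (h i).trans h')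
    (cokernel (wrapTo X i x)) h
  refine ⟨G.map (inv ((toTrunc (fun s : D.Idx => s.coord i ≤ x) (fun _ _ h h' => (h i).trans h')
    (cokernel (wrapTo X i x))).app s)) ≫ l, ?_⟩
  rw [← Functor.map_comp_assoc, toCutFun, NatTrans.comp_app, Category.assoc, IsIso.hom_inv_id,
    Category.comp_id, hl]

lemma raise_top_le (s : D.Idx) : (raise i x).fn (D.top i s) ≤ D.top i (D.bot i s) := by
  intro j
  by_cases hj : j = i
  · subst hj
    have := x.2
    simp only [top, raise, Reindex.coord_fn, Box.set_self, Fin.le_def]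
    omega
  · simp [top, bot, Box.set_of_ne _ _ hj]

/-- The steps in the direction `i` vanish on `cutFun`. -/
lemma reindex_wrap_toCutFun (s : D.Idx) :
    ((reindex (raise i x)).obj X).wrap i s ≫ (toCutFun X i x).app (D.bot i s) = 0 := by
  have h := wrapTo_toCutFun X i x (D.bot i s)
  have e := X.wrap_map i ((D.bot_le i s).trans (le_raise i x s))
    (X.M.map (homOfLE ((raise i x).bot_le i s)))
  simp only [thin] at e
  simp only [Category.assoc] at h ⊢
  rw [← F_thin (D.F i) X.M (raise_top_le i x s) (D.top_mono i ((D.bot_le i s).trans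
    (le_raise i x s))), Category.assoc, reassoc_of% e, h, comp_zero]

/-- The steps in a direction `j ≠ i` descend to `cutFun`, since they commute with those in the
direction `i`. -/
lemma wrapTo_wrap_toCutFun {j : σ} (hj : i ≠ j) (s : D.Idx) :
    (D.F j).map ((wrapTo X i x).app (D.top j s)) ≫
    ((reindex (raise i x)).obj X).wrap j s ≫ (toCutFun X i x).app (D.bot j s) = 0 := by
  have h := wrapTo_toCutFun X i x (D.bot j s)
  simp only [Functor.map_comp, Category.assoc, reassoc_of% F_thin] at h ⊢
  have e := X.wrap_wrap hj s le_rfl ((D.bot_le i s).trans (le_raise i x s)) le_rfl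
    (((D.bot_top hj s).le).trans (D.top_mono j ((D.bot_le i s).trans (le_raise i x s))))
    ((raise i x).bot_le j s)
  have e2 := X.wrap_comm i j hj s
  have e3 : (D.F j).map ((D.F i).map (X.M.map (homOfLE (le_refl (D.top i (D.top j s)))))) =
      𝟙 _ := by
    simp
  rw [e3, Category.id_comp, Category.id_comp] at e
  rw [reassoc_of% e, ← thin X.M (D.bot_bot hj s).ge ((D.bot_le i _).trans (le_raise i x _)),
    Category.assoc, reassoc_of% e2, reassoc_of% thin, reassoc_of% thin, h]
  simp

lemma cut_wrap_exists (j : σ) (s : D.Idx) :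
    ∃ l : (D.F j).obj ((cutFun X i x).obj (D.top j s)) ⟶ (cutFun X i x).obj (D.bot j s),
      (D.F j).map ((toCutFun X i x).app (D.top j s)) ≫ l =
        ((reindex (raise i x)).obj X).wrap j s ≫ (toCutFun X i x).app (D.bot j s) := by
  by_cases hj : i = j
  · subst hj
    exact ⟨0, by rw [reindex_wrap_toCutFun, comp_zero]⟩
  · by_cases h : (D.top j s).coord i ≤ x
    · exact toCutFun_desc X i x h _ _ (wrapTo_wrap_toCutFun X i x hj s)
    · refine ⟨0, ?_⟩
      rw [comp_zero]
      refine ((cutFun_isZero X i x (s := D.bot j s) ?_).eq_of_tgt _ _).symm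
      simpa [top, bot, Box.set_of_ne _ _ hj] using h

/-- The largest quotient of the pullback of `X` along `raise i x` that is zero for `s_i > x` and on
which the steps `wrap i s` vanish. Its entries for `s_i ≤ x` are the cokernels of
`F_i M_{s with s_i = p_i} ⟶ M_{s with s_i = x}`. -/
def cut : D.Grid :=
  ofEpi ((reindex (raise i x)).obj X) (cutFun X i x) (toCutFun X i x)
    (fun j s => (cut_wrap_exists X i x j s).choose)
    (fun j s => (cut_wrap_exists X i x j s).choose_spec)

/-- The projection to the block quotient. -/
def toCut : (reindex (raise i x)).obj X ⟶ cut X i x where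
  app := toCutFun X i x
  comm j s := (cut_wrap_exists X i x j s).choose_spec.symm

end Grid

end RootData

/-! ### Grids of a given type -/

section

variable {A : Type*} [Category* A]

lemma isIso_map_of_eq {Q : Type} [PartialOrder Q] (M : Q ⥤ A) {s t : Q} (h : s ≤ t) (e : s = t) :
    IsIso (M.map (homOfLE h)) := by
  subst e
  rw [show homOfLE h = 𝟙 _ from rfl]
  infer_instance

lemma isIso_map_congr {Q : Type} [PartialOrder Q] (M : Q ⥤ A) {s s' t t' : Q} {h : s ≤ t}
    (h' : s' ≤ t') (e : s = s') (e' : t = t') [IsIso (M.map (homOfLE h))] :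
    IsIso (M.map (homOfLE h')) := by
  subst e e'
  assumption

end

namespace RootData

variable {C : Type u} [Category.{v} C] [Abelian C] {σ : Type} [DecidableEq σ] {D : RootData C σ}

/-- The grid `X` is concentrated in the range `s_i ≤ k_i`, and constant there. For `k_i = p_i` this
means that `X` is constant in the direction `i`, and for `k_i < p_i` that `X` is a block. -/
structure Typed (k : D.Idx) (i : σ) (X : D.Grid) : Prop where
  isIso_map : ∀ s, IsIso (X.M.map (homOfLE (le_raise i (k.coord i) s)))
  isZero_obj : ∀ s : D.Idx, ¬ s.coord i ≤ k.coord i → IsZero (X.M.obj s)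

/-- The grids that are of the type given by `k` in all directions `i ∈ S`. -/
def shape (k : D.Idx) (S : Finset σ) : ObjectProperty D.Grid := fun X => ∀ i ∈ S, Typed k i X

/-- The full subcategory of grids of a given type in the directions `i ∈ S`. -/
abbrev Shape (k : D.Idx) (S : Finset σ) := (shape k S).FullSubcategory

section Closure

/-- A natural transformation that is invertible on a diagram is so on a preserved limit. -/
lemma isIso_app_of_isLimit {A B : Type*} [Category* A] [Category* B] {G G' : A ⥤ B} (α : G ⟶ G')
    {J : Type*} [Category* J] {K : J ⥤ A} {c : Cone K} (hc : IsLimit c) [PreservesLimit K G]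
    [PreservesLimit K G'] (h : ∀ j, IsIso (α.app (K.obj j))) : IsIso (α.app c.pt) := by
  let w : K ⋙ G ≅ K ⋙ G' := NatIso.ofComponents (fun j => asIso (α.app (K.obj j)))
  let e := IsLimit.conePointsIsoOfNatIso (isLimitOfPreserves G hc) (isLimitOfPreserves G' hc) w
  have : e.hom = α.app c.pt := (isLimitOfPreserves G' hc).hom_ext fun j => by
    rw [IsLimit.conePointsIsoOfNatIso_hom_comp]
    exact α.naturality (c.π.app j)
  exact this ▸ e.isIso_hom

/-- A natural transformation that is invertible on a diagram is so on a preserved colimit. -/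
lemma isIso_app_of_isColimit {A B : Type*} [Category* A] [Category* B] {G G' : A ⥤ B} (α : G ⟶ G')
    {J : Type*} [Category* J] {K : J ⥤ A} {c : Cocone K} (hc : IsColimit c) [PreservesColimit K G]
    [PreservesColimit K G'] (h : ∀ j, IsIso (α.app (K.obj j))) : IsIso (α.app c.pt) := by
  let w : K ⋙ G ≅ K ⋙ G' := NatIso.ofComponents (fun j => asIso (α.app (K.obj j)))
  let e := IsColimit.coconePointsIsoOfNatIso (isColimitOfPreserves G hc)
    (isColimitOfPreserves G' hc) w
  have : e.hom = α.app c.pt := (isColimitOfPreserves G hc).hom_ext fun j => by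
    rw [IsColimit.comp_coconePointsIsoOfNatIso_hom]
    exact (α.naturality (c.ι.app j)).symm
  exact this ▸ e.isIso_hom

lemma isZero_of_isLimit {A B : Type*} [Category* A] [Category* B] [HasZeroMorphisms B] (G : A ⥤ B)
    {J : Type*} [Category* J] {K : J ⥤ A} {c : Cone K} (hc : IsLimit c) [PreservesLimit K G]
    (h : ∀ j, IsZero (G.obj (K.obj j))) : IsZero (G.obj c.pt) := by
  rw [IsZero.iff_id_eq_zero]
  exact (isLimitOfPreserves G hc).hom_ext fun j => (h j).eq_of_tgt _ _

lemma isZero_of_isColimit {A B : Type*} [Category* A] [Category* B] [HasZeroMorphisms B]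
    (G : A ⥤ B) {J : Type*} [Category* J] {K : J ⥤ A} {c : Cocone K} (hc : IsColimit c)
    [PreservesColimit K G] (h : ∀ j, IsZero (G.obj (K.obj j))) : IsZero (G.obj c.pt) := by
  rw [IsZero.iff_id_eq_zero]
  exact (isColimitOfPreserves G hc).hom_ext fun j => (h j).eq_of_src _ _

/-- The maps `M_s ⟶ M_t` for `s ≤ t`, natural in the grid. -/
@[simps, reducible]
def evMap {s t : D.Idx} (h : s ≤ t) : Grid.ev D s ⟶ Grid.ev D t where
  app X := X.M.map (homOfLE h)
  naturality _ _ f := (f.app.naturality _).symm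

variable {k : D.Idx} {i : σ} {J : Type} [SmallCategory J] [FinCategory J] {K : J ⥤ D.Grid}

lemma Typed.of_isLimit {c : Cone K} (hc : IsLimit c) (h : ∀ j, Typed k i (K.obj j)) :
    Typed k i c.pt where
  isIso_map s := isIso_app_of_isLimit (evMap (le_raise i (k.coord i) s)) hc
    (fun j => (h j).isIso_map s)
  isZero_obj s hs := isZero_of_isLimit (Grid.ev D s) hc (fun j => (h j).isZero_obj s hs)

lemma Typed.of_isColimit {c : Cocone K} (hc : IsColimit c) (h : ∀ j, Typed k i (K.obj j)) :
    Typed k i c.pt where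
  isIso_map s := isIso_app_of_isColimit (evMap (le_raise i (k.coord i) s)) hc
    (fun j => (h j).isIso_map s)
  isZero_obj s hs := isZero_of_isColimit (Grid.ev D s) hc (fun j => (h j).isZero_obj s hs)

lemma Typed.of_isZero {X : D.Grid} (hX : IsZero X) : Typed k i X where
  isIso_map _ := isIso_of_source_target_iso_zero _ (Grid.isZero_iff.1 hX _).isoZero
    (Grid.isZero_iff.1 hX _).isoZero
  isZero_obj s _ := Grid.isZero_iff.1 hX s

variable (S : Finset σ)

instance : (shape k S).ContainsZero where
  exists_zero := ⟨0, isZero_zero _, fun _ _ => .of_isZero (isZero_zero _)⟩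

instance : (shape k S).IsClosedUnderKernels where
  kernels_le := by
    rintro _ ⟨_, c, hc, hX, hY⟩ i hi
    exact .of_isLimit hc (by rintro (_ | _); exacts [hX i hi, hY i hi])

instance : (shape k S).IsClosedUnderCokernels where
  cokernels_le := by
    rintro _ ⟨_, c, hc, hX, hY⟩ i hi
    exact .of_isColimit hc (by rintro (_ | _); exacts [hX i hi, hY i hi])

instance : (shape k S).IsClosedUnderFiniteProducts where
  isClosedUnderLimitsOfShape J _ := ⟨by
    rintro X ⟨h⟩ i hi
    have := Fintype.ofFinite J
    classical
    exact Typed.of_isLimit (K := h.diag) h.isLimit fun j => h.prop_diag_obj j i hi⟩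

instance : Abelian (Shape k S) := inferInstance

instance : PreservesFiniteLimits (shape k S).ι := by
  have := (shape k S).preservesKernels_ι
  exact (shape k S).ι.preservesFiniteLimits_of_preservesKernels

instance : PreservesFiniteColimits (shape k S).ι := by
  have := (shape k S).preservesCokernels_ι
  exact (shape k S).ι.preservesFiniteColimits_of_preservesCokernels

variable {S} {T : Finset σ}

lemma shape_anti {k : D.Idx} (h : S ⊆ T) : shape k T ≤ shape k S := fun _ hX i hi => hX i (h hi)

instance (h : shape k T ≤ shape k S) : PreservesFiniteLimits (ObjectProperty.ιOfLE h) where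
  preservesFiniteLimits J _ _ := by
    have : PreservesLimitsOfShape J (ObjectProperty.ιOfLE h ⋙ (shape k S).ι) :=
      inferInstanceAs (PreservesLimitsOfShape J (shape k T).ι)
    exact preservesLimitsOfShape_of_reflects_of_preserves _ (shape k S).ι

instance (h : shape k T ≤ shape k S) : PreservesFiniteColimits (ObjectProperty.ιOfLE h) where
  preservesFiniteColimits J _ _ := by
    have : PreservesColimitsOfShape J (ObjectProperty.ιOfLE h ⋙ (shape k S).ι) :=
      inferInstanceAs (PreservesColimitsOfShape J (shape k T).ι)
    exact preservesColimitsOfShape_of_reflects_of_preserves _ (shape k S).ι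

end Closure

end RootData

/-! ### Adjoint functors given by universal arrows -/

section

universe u' v'

variable {A : Type u} [Category.{v} A] [Abelian A]

/-- A part of the snake lemma: for a map `a ⟶ b ⟶ c` of short exact sequences with `c` a
monomorphism, the map `h` between the cokernels of `a` and `b` is a monomorphism. -/
lemma mono_of_cokernel {A₁ A₂ A₃ B₁ B₂ B₃ E₁ E₂ : A} (a : A₁ ⟶ B₁) (b : A₂ ⟶ B₂) (c : A₃ ⟶ B₃)
    [Mono c] (f : A₁ ⟶ A₂) (g : A₂ ⟶ A₃) (f' : B₁ ⟶ B₂) (g' : B₂ ⟶ B₃) [Mono f'] (w : f ≫ g = 0)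
    (hfg : (ShortComplex.mk f g w).Exact) (hf : f ≫ b = a ≫ f') (hg : g ≫ c = b ≫ g')
    (w' : f' ≫ g' = 0) (π₁ : B₁ ⟶ E₁) [Epi π₁] (π₂ : B₂ ⟶ E₂) (h₁ : a ≫ π₁ = 0) (h₂ : b ≫ π₂ = 0)
    (hb : (ShortComplex.mk b π₂ h₂).Exact) (h : E₁ ⟶ E₂) (hh : π₁ ≫ h = f' ≫ π₂) : Mono h := by
  refine Preadditive.mono_of_cancel_zero _ fun {Z} y hy => ?_
  obtain ⟨Z₁, q₁, _, y₁, hy₁⟩ := surjective_up_to_refinements_of_epi π₁ y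
  obtain ⟨Z₂, q₂, _, y₂, hy₂⟩ := hb.exact_up_to_refinements (y₁ ≫ f') (by
    dsimp only
    rw [Category.assoc, ← hh, ← reassoc_of% hy₁, hy, comp_zero])
  dsimp only at hy₂
  obtain ⟨Z₃, q₃, _, y₃, hy₃⟩ := hfg.exact_up_to_refinements y₂ (by
    dsimp only
    rw [← cancel_mono c, Category.assoc, hg, ← reassoc_of% hy₂, w', comp_zero, comp_zero,
      zero_comp])
  dsimp only at hy₃
  have key : q₃ ≫ q₂ ≫ y₁ = y₃ ≫ a := by
    rw [← cancel_mono f', Category.assoc, Category.assoc, hy₂, reassoc_of% hy₃, hf, Category.assoc]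
  rw [← cancel_epi q₁, hy₁, comp_zero, ← cancel_epi q₂, comp_zero, ← cancel_epi q₃, comp_zero,
    reassoc_of% key, h₁, comp_zero]

variable {B : Type u'} [Category.{v'} B] [Abelian B]

/-- A version of `extVanishes_adj_iff` in which the left adjoint is given by universal arrows. -/
theorem extVanishes_iff_of_universal {R : B ⥤ A} [PreservesFiniteLimits R]
    [PreservesFiniteColimits R] (L : A → B) (η : ∀ X, X ⟶ R.obj (L X))
    (universal : ∀ X Y (f : X ⟶ R.obj Y), ∃! g : L X ⟶ Y, η X ≫ R.map g = f)
    (good : A → Prop)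
    (good_of_mono : ∀ {X' X : A} (f : X' ⟶ X) [Mono f], good X → good X')
    (enough : ∀ X : A, ∃ (P : A) (π : P ⟶ X), good P ∧ Epi π)
    (mono_map : ∀ S : ShortComplex A, S.ShortExact → good S.X₂ → good S.X₃ →
      ∀ g : L S.X₁ ⟶ L S.X₂, η S.X₁ ≫ R.map g = S.f ≫ η S.X₂ → Mono g)
    {X : A} (hX : good X) (Y : B) (i : ℕ) :
    ExtVanishes (L X) Y i ↔ ExtVanishes X (R.obj Y) i := by
  let e (X : A) (Y : B) : (L X ⟶ Y) ≃ (X ⟶ R.obj Y) :=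
    Equiv.ofBijective (fun g => η X ≫ R.map g) (Function.bijective_iff_existsUnique _ |>.2
      fun f => universal X Y f)
  have he : ∀ X Y Y' g h, e X Y' (h ≫ g) = e X Y h ≫ R.map g := fun X Y Y' g h => by simp [e]
  refine extVanishes_adj_iff (Adjunction.adjunctionOfEquivLeft e he) good good_of_mono enough
    (fun S hS h₂ h₃ => mono_map S hS h₂ h₃ _ ?_) hX Y i
  refine ((e S.X₁ (L S.X₂)).apply_symm_apply _).trans ?_
  simp [e]

end

/-! ### The universal property of the reflections -/

namespace RootData

variable {C : Type u} [Category.{v} C] [Abelian C] {σ : Type} [DecidableEq σ] {D : RootData C σ}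

section Index

variable (i j : σ) (x : Fin (D.p i)) (y : Fin (D.p j)) (s : D.Idx)

lemma raise_fn_self : ((raise i x).fn s).coord i = max (s.coord i) x := by
  rw [Reindex.coord_fn, Box.set_self]
  rfl

lemma raise_fn_of_ne {j : σ} (h : j ≠ i) : ((raise i x).fn s).coord j = s.coord j := by
  rw [Reindex.coord_fn, Box.set_of_ne _ _ h]

lemma raise_fn_eq (h : x ≤ s.coord i) : (raise i x).fn s = s := by
  ext j : 2
  by_cases hj : j = i
  · subst hj; rw [raise_fn_self]; exact max_eq_left h
  · rw [raise_fn_of_ne _ _ _ hj]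

lemma raise_fn_raise_fn : (raise i x).fn ((raise i x).fn s) = (raise i x).fn s :=
  raise_fn_eq _ _ _ (by rw [raise_fn_self]; exact le_max_right _ _)

lemma raise_fn_self_eq (k : D.Idx) : (raise i (k.coord i)).fn k = k :=
  raise_fn_eq _ _ _ le_rfl

lemma raise_fn_comm (h : i ≠ j) :
    (raise i x).fn ((raise j y).fn s) = (raise j y).fn ((raise i x).fn s) := by
  ext l : 2
  by_cases hi : l = i
  · subst hi; simp only [raise_fn_self, raise_fn_of_ne _ _ _ h]
  · by_cases hj : l = j
    · subst hj; simp only [raise_fn_self, raise_fn_of_ne _ _ _ hi]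
    · simp only [raise_fn_of_ne _ _ _ hi, raise_fn_of_ne _ _ _ hj]

lemma top_coord_self : ((D.top i s).coord i : ℕ) = D.p i - 1 := by
  simp [top]

lemma top_coord_of_ne {j : σ} (h : j ≠ i) : (D.top i s).coord j = s.coord j := by
  simp [top, Box.set_of_ne _ _ h]

lemma bot_coord_of_ne {j : σ} (h : j ≠ i) : (D.bot i s).coord j = s.coord j := by
  simp [bot, Box.set_of_ne _ _ h]

lemma bot_bot_self : D.bot i (D.bot i s) = D.bot i s := by
  ext j : 2
  by_cases hj : j = i
  · subst hj; simp [bot]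
  · rw [bot_coord_of_ne _ _ hj]

lemma top_bot_self : D.top i (D.bot i s) = D.top i s := by
  ext j : 2
  by_cases hj : j = i
  · subst hj; simp [top]
  · rw [top_coord_of_ne _ _ hj, top_coord_of_ne _ _ hj, bot_coord_of_ne _ _ hj]

lemma top_raise_fn : D.top i ((raise i x).fn s) = D.top i s := by
  ext l : 2
  by_cases hi : l = i
  · subst hi; ext; simp only [top_coord_self]
  · simp only [top_coord_of_ne _ _ hi, raise_fn_of_ne _ _ _ hi]

lemma top_raise_fn_of_ne (h : i ≠ j) : D.top i ((raise j y).fn s) = (raise j y).fn (D.top i s) := by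
  ext l : 2
  by_cases hi : l = i
  · subst hi; ext; simp only [top_coord_self, raise_fn_of_ne _ _ _ h]
  · by_cases hj : l = j
    · subst hj; simp only [raise_fn_self, top_coord_of_ne _ _ hi]
    · simp only [top_coord_of_ne _ _ hi, raise_fn_of_ne _ _ _ hj]

end Index

namespace Grid

/-- A map from the pullback along `raise i x` to a grid of the given type is determined by its
composite with `X ⟶ (reindex (raise i x)).obj X`. -/
lemma reindex_raise_hom_ext {k : D.Idx} {i : σ} {X Z : D.Grid} (hZ : Typed k i Z)
    {a b : (reindex (raise i (k.coord i))).obj X ⟶ Z}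
    (h : (toReindex (le_raise i (k.coord i))).app X ≫ a =
      (toReindex (le_raise i (k.coord i))).app X ≫ b) : a = b := by
  ext s
  have := hZ.isIso_map s
  rw [← cancel_mono (Z.M.map (homOfLE (le_raise i (k.coord i) s)))]
  have ha := app_map a (le_raise i (k.coord i) s)
  have hb := app_map b (le_raise i (k.coord i) s)
  have h' := congrArg (fun f => f.app.app ((raise i (k.coord i)).fn s)) h
  rw [← ha, ← hb]
  exact h'

lemma isIso_toReindex_app {k : D.Idx} {i : σ} {Z : D.Grid} (hZ : Typed k i Z) :
    IsIso ((toReindex (le_raise i (k.coord i))).app Z) :=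
  isIso_of_app _ fun s => hZ.isIso_map s

variable (X : D.Grid)

lemma typed_reindex_of_isTop {k : D.Idx} {i : σ} (hk : ∀ y, y ≤ k.coord i) :
    Typed k i ((reindex (raise i (k.coord i))).obj X) where
  isIso_map s := isIso_map_of_eq X.M _ (by
    rw [raise_fn_raise_fn])
  isZero_obj _ hs := (hs (hk _)).elim

variable {X} in
lemma typed_reindex_raise {k : D.Idx} {i j : σ} (hij : j ≠ i) (x : Fin (D.p i))
    (hX : Typed k j X) : Typed k j ((reindex (raise i x)).obj X) where
  isIso_map s := by
    have := hX.isIso_map ((raise i x).fn s)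
    exact isIso_map_congr X.M _ rfl (raise_fn_comm _ _ _ _ _ hij)
  isZero_obj s hs := hX.isZero_obj _ (by rwa [raise_fn_of_ne _ _ _ hij])

variable (i : σ) (x : Fin (D.p i))

instance (s : D.Idx) : Epi ((toCut X i x).app.app s) :=
  inferInstanceAs (Epi ((toCutFun X i x).app s))

instance : Epi (toCut X i x) := epi_of_app _ fun _ => inferInstance

lemma cut_isZero {s : D.Idx} (h : ¬ s.coord i ≤ x) : IsZero ((cut X i x).M.obj s) :=
  cutFun_isZero X i x h

lemma wrapTo_toCut (s : D.Idx) : (wrapTo X i x).app s ≫ (toCut X i x).app.app s = 0 :=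
  wrapTo_toCutFun X i x s

lemma toCut_desc {s : D.Idx} (h : s.coord i ≤ x) {A : C} (f : X.M.obj ((raise i x).fn s) ⟶ A)
    (w : (wrapTo X i x).app s ≫ f = 0) :
    ∃ l : (cut X i x).M.obj s ⟶ A, (toCut X i x).app.app s ≫ l = f :=
  toCutFun_desc X i x h (𝟭 C) f w

lemma toCut_exact {s : D.Idx} (h : s.coord i ≤ x) :
    (ShortComplex.mk ((wrapTo X i x).app s) ((toCut X i x).app.app s)
      (wrapTo_toCut X i x s)).Exact :=
  ShortComplex.exact_of_g_is_cokernel _ (CokernelCofork.IsColimit.ofπ' _ _ fun f hf =>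
    ⟨_, (toCut_desc X i x h f hf).choose_spec⟩)

/-- The map `s ⟶ t` is invertible on `cut` if it is so on the pullback of `X` and surjective on the
sources of the steps. -/
lemma isIso_cut_map {s t : D.Idx} (h : s ≤ t) (ht : t.coord i ≤ x)
    (h₁ : IsIso (X.M.map (homOfLE ((raise i x).mono h))))
    (h₂ : Epi ((D.F i).map (X.M.map (homOfLE (D.top_mono i h))))) :
    IsIso ((cut X i x).M.map (homOfLE h)) := by
  have nat : X.M.map (homOfLE ((raise i x).mono h)) ≫ (toCut X i x).app.app t =
    (toCut X i x).app.app s ≫ (cut X i x).M.map (homOfLE h) := app_map (toCut X i x) h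
  have nat' : (D.F i).map (X.M.map (homOfLE (D.top_mono i h))) ≫ (wrapTo X i x).app t =
    (wrapTo X i x).app s ≫ X.M.map (homOfLE ((raise i x).mono h)) :=
    (wrapTo X i x).naturality (homOfLE h)
  obtain ⟨l, hl⟩ := toCut_desc X i x ht
    (inv (X.M.map (homOfLE ((raise i x).mono h))) ≫ (toCut X i x).app.app s) (by
      rw [← cancel_epi ((D.F i).map (X.M.map (homOfLE (D.top_mono i h)))), comp_zero]
      have := wrapTo_toCut X i x s
      have e : X.M.map (homOfLE ((raise i x).mono h)) ≫
        inv (X.M.map (homOfLE ((raise i x).mono h))) = 𝟙 _ := IsIso.hom_inv_id _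
      refine (Category.assoc _ _ _).symm.trans ((congrArg (· ≫ _) nat').trans ?_)
      rw [Category.assoc, reassoc_of% e]
      exact this)
  refine ⟨l, ?_, ?_⟩
  · rw [← cancel_epi ((toCut X i x).app.app s), ← reassoc_of% nat, hl, IsIso.hom_inv_id_assoc,
      Category.comp_id]
  · rw [← cancel_epi ((toCut X i x).app.app t), reassoc_of% hl, ← nat, IsIso.inv_hom_id_assoc,
      Category.comp_id]

lemma typed_cut (k : D.Idx) : Typed k i (cut X i (k.coord i)) where
  isIso_map s := by
    by_cases hs : s.coord i ≤ k.coord i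
    · refine isIso_cut_map _ _ _ _ ?_ (isIso_map_of_eq X.M _ ?_) ?_
      · rw [raise_fn_self, max_eq_right hs]
      · rw [raise_fn_raise_fn]
      · have := isIso_map_of_eq X.M (D.top_mono i (le_raise i (k.coord i) s))
          (top_raise_fn i _ s).symm
        infer_instance
    · exact isIso_map_of_eq _ _ (raise_fn_eq _ _ _ (le_of_not_ge hs)).symm
  isZero_obj s hs := cut_isZero X i _ hs

variable {X} in
lemma typed_cut_of_ne {k : D.Idx} {j : σ} (hij : j ≠ i) (hX : Typed k j X) :
    Typed k j (cut X i x) where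
  isIso_map s := by
    by_cases hs : s.coord i ≤ x
    · refine isIso_cut_map _ _ _ _ ?_ ?_ ?_
      · rwa [raise_fn_of_ne _ _ _ hij.symm]
      · exact (typed_reindex_raise hij x hX).isIso_map s
      · have := hX.isIso_map (D.top i s)
        have := isIso_map_congr X.M (D.top_mono i (le_raise j (k.coord j) s)) rfl
          (top_raise_fn_of_ne i j _ s hij.symm).symm
        infer_instance
    · exact isIso_of_source_target_iso_zero _ (cut_isZero X i _ hs).isoZero
        (cut_isZero X i _ (by rwa [raise_fn_of_ne _ _ _ hij.symm])).isoZero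
  isZero_obj s hs := by
    have := (typed_reindex_raise hij x hX).isZero_obj s hs
    exact this.of_epi ((toCut X i x).app.app s)

/-- `X ⟶ cut X i (k.coord i)` is universal among the maps to grids of the type given by `k` in the
direction `i`. -/
lemma cut_universal {k : D.Idx} (hk : (k.coord i : ℕ) < D.p i - 1) {Z : D.Grid} (hZ : Typed k i Z)
    (f : X ⟶ Z) : ∃! g : cut X i (k.coord i) ⟶ Z,
      ((toReindex (le_raise i (k.coord i))).app X ≫ toCut X i (k.coord i)) ≫ g = f := by
  have := isIso_toReindex_app hZ
  -- the extension of `f` to the pullback of `X`, which descends to the quotient `cut`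
  let f' := (reindex (raise i (k.coord i))).map f ≫ inv ((toReindex (le_raise i (k.coord i))).app Z)
  have hf' : (toReindex (le_raise i (k.coord i))).app X ≫ f' = f := by
    have := (toReindex (le_raise i (k.coord i))).naturality f
    dsimp only [f']
    rw [← reassoc_of% this, IsIso.hom_inv_id]
    exact Category.comp_id _
  have hd : ∀ s, ∃ l : (cut X i (k.coord i)).M.obj s ⟶ Z.M.obj s,
      (toCut X i (k.coord i)).app.app s ≫ l = f'.app.app s := fun s => by
    by_cases hs : s.coord i ≤ k.coord i
    · refine toCut_desc X i _ hs _ ?_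
      have := hZ.isIso_map s
      rw [← cancel_mono (Z.M.map (homOfLE (le_raise i (k.coord i) s))), zero_comp, Category.assoc]
      have e : f'.app.app s ≫ Z.M.map (homOfLE (le_raise i (k.coord i) s)) =
          f.app.app ((raise i (k.coord i)).fn s) := by
        have e1 : f' ≫ (toReindex (le_raise i (k.coord i))).app Z =
            (reindex (raise i (k.coord i))).map f := by simp [f']
        exact congrArg (fun f => f.app.app s) e1
      refine (congrArg (_ ≫ ·) e).trans ?_
      -- as `k_i` is not maximal, the steps of `Z` in the direction `i` have source zero
      have z : IsZero ((D.F i).obj (Z.M.obj (D.top i s))) := (D.F i).map_isZero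
        (hZ.isZero_obj _ (by rw [Fin.le_def, top_coord_self]; omega))
      have h1 := f.comm i s
      have h2 := app_map f ((D.bot_le i s).trans (le_raise i (k.coord i) s))
      rw [wrapTo_app, Category.assoc, h2, reassoc_of% h1, z.eq_of_tgt ((D.F i).map _) 0, zero_comp]
    · exact ⟨0, (hZ.isZero_obj s hs).eq_of_tgt _ _⟩
  choose l hl using hd
  have nat : ∀ s t (h : s ⟶ t), (cut X i (k.coord i)).M.map h ≫ l t = l s ≫ Z.M.map h :=
    fun s t h => by
      have e1 := f'.app.naturality h
      have e2 := (toCut X i (k.coord i)).app.naturality h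
      rw [← cancel_epi ((toCut X i (k.coord i)).app.app s), ← reassoc_of% e2, hl, e1,
        reassoc_of% hl]
      rfl
  let g : cut X i (k.coord i) ⟶ Z := homOfEpi (toCut X i (k.coord i)) f'
    { app := l, naturality := nat } (by ext s; exact hl s)
  have hg : toCut X i (k.coord i) ≫ g = f' := by ext s; exact hl s
  refine ⟨g, ?_, fun g' hg' => ?_⟩
  · dsimp only
    rw [Category.assoc, hg, hf']
  · rw [← cancel_epi (toCut X i (k.coord i))]
    refine reindex_raise_hom_ext hZ ?_
    rw [hg, hf', ← hg', Category.assoc]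

/-- The analogue of `cut_universal` for grids that are constant in the direction `i`. -/
lemma reindex_universal {k : D.Idx} {i : σ} {Z : D.Grid} (hZ : Typed k i Z)
    (f : X ⟶ Z) : ∃! g : (reindex (raise i (k.coord i))).obj X ⟶ Z,
      (toReindex (le_raise i (k.coord i))).app X ≫ g = f := by
  have := isIso_toReindex_app hZ
  have hf : (toReindex (le_raise i (k.coord i))).app X ≫ (reindex (raise i (k.coord i))).map f ≫
      inv ((toReindex (le_raise i (k.coord i))).app Z) = f := by
    have := (toReindex (le_raise i (k.coord i))).naturality f
    rw [← reassoc_of% this, IsIso.hom_inv_id]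
    exact Category.comp_id _
  exact ⟨_, hf, fun g hg => reindex_raise_hom_ext hZ (hg.trans hf.symm)⟩

/-- All maps `F_i M_{s with s_i = p_i} ⟶ M_{s with s_i = max (s_i, x)}` are monomorphisms. On short
exact sequences of such grids, `cut` is exact. -/
def Good : Prop := ∀ s, Mono ((wrapTo X i x).app s)

variable {X i x}

lemma wrapTo_naturality {Y : D.Grid} (f : X ⟶ Y) (s : D.Idx) :
    (D.F i).map (f.app.app (D.top i s)) ≫ (wrapTo Y i x).app s =
      (wrapTo X i x).app s ≫ f.app.app ((raise i x).fn s) := by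
  have h1 := f.comm i s
  have h2 := app_map f ((D.bot_le i s).trans (le_raise i x s))
  rw [wrapTo_app, wrapTo_app, Category.assoc, h2, reassoc_of% h1]

lemma Good.of_mono {Y : D.Grid} (hY : Good Y i x) (f : X ⟶ Y) [Mono f] : Good X i x := fun s => by
  have := hY s
  have h : Mono ((wrapTo X i x).app s ≫ f.app.app ((raise i x).fn s)) := by
    rw [← wrapTo_naturality]
    infer_instance
  exact mono_of_mono _ (f.app.app ((raise i x).fn s))

lemma mono_cut_of_shortExact {S : ShortComplex D.Grid} (hS : S.ShortExact) (h₃ : Good S.X₃ i x)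
    (g : cut S.X₁ i x ⟶ cut S.X₂ i x) (hg : toCut S.X₁ i x ≫ g =
      (reindex (raise i x)).map S.f ≫ toCut S.X₂ i x) : Mono g := by
  refine mono_of_app _ fun s => ?_
  by_cases hs : s.coord i ≤ x
  · have := h₃ s
    have e1 := (exact_app hS (D.top i s)).map_of_exact (D.F i)
    have e2 := exact_app hS ((raise i x).fn s)
    have := e2.mono_f
    exact mono_of_cokernel _ _ ((wrapTo S.X₃ i x).app s) _ _ (S.f.app.app ((raise i x).fn s))
      (S.g.app.app ((raise i x).fn s)) _ e1.exact (wrapTo_naturality S.f s)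
      (wrapTo_naturality S.g s)
      (by rw [← comp_app_app, S.zero]; rfl) ((toCut S.X₁ i x).app.app s) _ (wrapTo_toCut _ _ _ _) _
      (toCut_exact S.X₂ i x hs) _ (congrArg (fun f => f.app.app s) hg)
  · exact ⟨fun _ _ _ => (cut_isZero S.X₁ i x hs).eq_of_tgt _ _⟩

end Grid

end RootData

namespace RootData

variable {C : Type u} [Category.{v} C] [Abelian C] {σ : Type} [DecidableEq σ] {D : RootData C σ}

/-! ### Ext groups and the reflections -/

section Step

variable {k : D.Idx} {S : Finset σ} {i : σ}

/-- The reflection of a grid into those that are blocks in the direction `i`. -/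
abbrev Shape.cut (X : Shape k S) (i : σ) : Shape k (insert i S) :=
  ⟨X.obj.cut i (k.coord i), fun j hj => by
    by_cases hji : j = i
    · subst hji; exact Grid.typed_cut _ _ _
    · exact Grid.typed_cut_of_ne _ _ hji (X.property j (Finset.mem_of_mem_insert_of_ne hj hji))⟩

/-- The reflection of a grid into those that are constant in the direction `i`. -/
abbrev Shape.flat (X : Shape k S) (i : σ) (hk : ∀ y, y ≤ k.coord i) : Shape k (insert i S) :=
  ⟨(Grid.reindex (raise i (k.coord i))).obj X.obj, fun j hj => by
    by_cases hji : j = i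
    · subst hji; exact Grid.typed_reindex_of_isTop _ hk
    · exact Grid.typed_reindex_raise hji _
        (X.property j (Finset.mem_of_mem_insert_of_ne hj hji))⟩

/-- The inclusion of the grids of a given type in the directions `S` and `i`. -/
abbrev Shape.incl (k : D.Idx) (S : Finset σ) (i : σ) : Shape k (insert i S) ⥤ Shape k S :=
  ObjectProperty.ιOfLE (shape_anti (Finset.subset_insert i S))

/-- `Ext^n(L X, Y) ≅ Ext^n(X, Y)` for the reflection `L` to blocks in the direction `i`. -/
theorem extVanishes_cut (hk : (k.coord i : ℕ) < D.p i - 1)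
    (enough : ∀ X : Shape k S, ∃ (P : Shape k S) (π : P ⟶ X), P.obj.Good i (k.coord i) ∧ Epi π)
    (X : Shape k S) (hX : X.obj.Good i (k.coord i)) (Y : Shape k (insert i S)) (n : ℕ) :
    ExtVanishes (X.cut i) Y n ↔ ExtVanishes X ((Shape.incl k S i).obj Y) n := by
  refine extVanishes_iff_of_universal (R := Shape.incl k S i) (fun X => X.cut i)
    (fun X => ⟨(Grid.toReindex (le_raise i (k.coord i))).app X.obj ≫ X.obj.toCut i (k.coord i)⟩)
    (fun X Y f => ?_) (fun X => X.obj.Good i (k.coord i)) (fun {X' X} f _ hX => ?_) enough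
    (fun T hT _ h₃ g hg => ?_) hX Y n
  · obtain ⟨g, hg, hg'⟩ := Grid.cut_universal X.obj i hk (Y.property i (by simp)) f.hom
    exact ⟨⟨g⟩, ObjectProperty.hom_ext _ hg, fun g' h => ObjectProperty.hom_ext _
      (hg' g'.hom (congrArg (fun f => f.hom) h))⟩
  · have : Mono f.hom := inferInstanceAs (Mono ((shape k S).ι.map f))
    exact hX.of_mono f.hom
  · have h1 : Mono g.hom := by
      refine Grid.mono_cut_of_shortExact (hT.map_of_exact (shape k S).ι) h₃ g.hom ?_
      refine Grid.reindex_raise_hom_ext (Grid.typed_cut _ i k) ?_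
      have h2 := congrArg (fun f => f.hom) hg
      have h3 := (Grid.toReindex (le_raise i (k.coord i))).naturality T.f.hom
      have h4 := (reassoc_of% h3) (T.X₂.obj.toCut i (k.coord i))
      exact (Category.assoc _ _ _).symm.trans (h2.trans h4)
    exact (shape k (insert i S)).ι.mono_of_mono_map h1

/-- `Ext^n(L X, Y) ≅ Ext^n(X, Y)` for the reflection `L` to grids that are constant in the
direction `i`. -/
theorem extVanishes_flat (hk : ∀ y, y ≤ k.coord i) (X : Shape k S) (Y : Shape k (insert i S))
    (n : ℕ) :
    ExtVanishes (X.flat i hk) Y n ↔ ExtVanishes X ((Shape.incl k S i).obj Y) n := by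
  refine extVanishes_iff_of_universal (R := Shape.incl k S i) (fun X => X.flat i hk)
    (fun X => ⟨(Grid.toReindex (le_raise i (k.coord i))).app X.obj⟩)
    (fun X Y f => ?_) (fun X => True) (fun _ _ _ => trivial)
    (fun X => ⟨X, 𝟙 X, trivial, inferInstance⟩) (fun T hT _ h₃ g hg => ?_) trivial Y n
  · obtain ⟨g, hg, hg'⟩ := Grid.reindex_universal X.obj (Y.property i (by simp)) f.hom
    exact ⟨⟨g⟩, ObjectProperty.hom_ext _ hg, fun g' h => ObjectProperty.hom_ext _
      (hg' g'.hom (congrArg (fun f => f.hom) h))⟩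
  · have h1 : Mono g.hom := by
      have : g.hom = (Grid.reindex (raise i (k.coord i))).map T.f.hom := by
        refine Grid.reindex_raise_hom_ext (Grid.typed_reindex_of_isTop _ hk) ?_
        have h2 := congrArg (fun f => f.hom) hg
        exact h2.trans ((Grid.toReindex (le_raise i (k.coord i))).naturality T.f.hom)
      rw [this]
      have := (hT.map_of_exact (shape k S).ι).mono_f
      have : Mono T.f.hom := this
      exact Grid.mono_of_app _ fun s => inferInstanceAs (Mono (T.f.hom.app.app _))
    exact (shape k (insert i S)).ι.mono_of_mono_map h1

end Step

/-! ### Maps out of grids generated by one level -/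

section Level

variable (i : σ) (x : Fin (D.p i))

/-- The self-map of the index set that replaces the `i`-th coordinate by `x`. -/
abbrev level : D.Reindex := Reindex.coord i (OrderHom.const _ x)

lemma level_fn_self (s : D.Idx) : ((level i x).fn s).coord i = x := by
  rw [Reindex.coord_fn, Box.set_self]; rfl

lemma level_fn_of_ne {j : σ} (h : j ≠ i) (s : D.Idx) : ((level i x).fn s).coord j = s.coord j := by
  rw [Reindex.coord_fn, Box.set_of_ne _ _ h]

variable {i x} in
lemma level_le {s : D.Idx} (hs : x ≤ s.coord i) : (level i x).fn s ≤ s := by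
  intro j
  by_cases hj : j = i
  · subst hj; rwa [level_fn_self]
  · rw [level_fn_of_ne _ _ hj]

lemma le_top_coord (s : D.Idx) : x ≤ (D.top i s).coord i := by
  rw [Fin.le_def, top_coord_self]
  omega

lemma level_fn_raise (y : Fin (D.p i)) (s : D.Idx) :
    (level i x).fn ((raise i y).fn s) = (level i x).fn s := by
  ext j : 2
  by_cases hj : j = i
  · subst hj; simp only [level_fn_self]
  · simp only [level_fn_of_ne _ _ hj, raise_fn_of_ne _ _ _ hj]

lemma level_fn_raise_of_ne {j : σ} (h : j ≠ i) (y : Fin (D.p j)) (s : D.Idx) :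
    (level i x).fn ((raise j y).fn s) = (raise j y).fn ((level i x).fn s) := by
  ext l : 2
  by_cases hi : l = i
  · subst hi; simp only [level_fn_self, raise_fn_of_ne _ _ _ h.symm]
  · by_cases hj : l = j
    · subst hj; simp only [level_fn_of_ne _ _ hi, raise_fn_self]
    · simp only [level_fn_of_ne _ _ hi, raise_fn_of_ne _ _ _ hj]

end Level

namespace Grid

lemma typed_level {k : D.Idx} {i : σ} (hk : ∀ y, y ≤ k.coord i) (x : Fin (D.p i)) (X : D.Grid) :
    Typed k i ((reindex (level i x)).obj X) where
  isIso_map s := isIso_map_of_eq X.M _ (level_fn_raise i x _ s).symm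
  isZero_obj _ hs := (hs (hk _)).elim

lemma typed_level_of_ne {k : D.Idx} {i j : σ} (h : j ≠ i) (x : Fin (D.p i)) {X : D.Grid}
    (hX : Typed k j X) : Typed k j ((reindex (level i x)).obj X) where
  isIso_map s := by
    have := hX.isIso_map ((level i x).fn s)
    exact isIso_map_congr X.M _ rfl (level_fn_raise_of_ne i x h _ s).symm
  isZero_obj s hs := hX.isZero_obj _ (by rwa [level_fn_of_ne _ _ h])

/-- Consecutive steps in two directions commute, with the target `M` at `bot j s`. -/
lemma wrap_comm_map (X : D.Grid) {i j : σ} (h : i ≠ j) (s : D.Idx) :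
    (D.F j).map (X.wrap i (D.top j s)) ≫ (D.F j).map (X.M.map (homOfLE (D.bot_le i (D.top j s)))) ≫
      X.wrap j s =
    (D.comm i j).hom.app (X.M.obj (D.top i (D.top j s))) ≫
      (D.F i).map ((D.F j).map (X.M.map (homOfLE (D.top_top h s).le))) ≫
      (D.F i).map (X.wrap j (D.top i s)) ≫
      (D.F i).map (X.M.map (homOfLE (D.bot_top h.symm s).le)) ≫
      X.wrap i (D.bot j s) ≫ X.M.map (homOfLE (D.bot_le i (D.bot j s))) := by
  have e := X.wrap_comm i j h s
  have e' := X.wrap_map j (D.bot_le i s) (𝟙 _)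
  rw [Category.comp_id, Category.comp_id] at e'
  rw [← F_thin (D.F j) X.M (D.bot_top h s).le (D.top_mono j (D.bot_le i s)), Category.assoc, e',
    reassoc_of% e, thin]

lemma le_top_bot (i : σ) (s : D.Idx) : D.top i s ≤ D.top i (D.bot i s) := by
  intro j
  by_cases hj : j = i
  · subst hj; exact le_top_coord _ _ _
  · rw [top_coord_of_ne _ _ hj, top_coord_of_ne _ _ hj, bot_coord_of_ne _ _ hj]

lemma wrap_bot (X : D.Grid) (i : σ) (s : D.Idx) :
    (D.F i).map (X.M.map (homOfLE (le_top_bot i s))) ≫ X.wrap i (D.bot i s) ≫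
      X.M.map (homOfLE (D.bot_le i (D.bot i s))) = X.wrap i s := by
  have h := X.wrap_map i (D.bot_le i s) (𝟙 _)
  rw [Category.comp_id, Category.comp_id] at h
  rw [← h, reassoc_of% F_thin]
  simp

/-- Let `K` be the subgrid of `Y` with `K_s = Y_s` for `s_i ≥ x` and `K_s = F_i Y` for `s_i < x`,
the latter by the maps `e`. A map from `Y` to the `x`-th level of `X` induces one from `K`
to `X`. -/
theorem exists_hom_of_level {X Y K : D.Grid} {i : σ} {x : Fin (D.p i)}
    (φ : Y ⟶ (reindex (level i x)).obj X) (ι : K ⟶ Y) [Mono ι]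
    (e : ∀ s, (D.F i).obj (Y.M.obj (D.top i s)) ⟶ K.M.obj s)
    (he : ∀ s, e s ≫ ι.app.app s = Y.wrap i s ≫ Y.M.map (homOfLE (D.bot_le i s)))
    (hiso : ∀ s : D.Idx, ¬ x ≤ s.coord i → IsIso (e s)) :
    ∃ f : K ⟶ X, ∀ (s : D.Idx) (hs : x ≤ s.coord i),
      f.app.app s = ι.app.app s ≫ φ.app.app s ≫ X.M.map (homOfLE (level_le hs)) := by
  have e_nat : ∀ s t (h : s ≤ t), e s ≫ K.M.map (homOfLE h) =
      (D.F i).map (Y.M.map (homOfLE (D.top_mono i h))) ≫ e t := fun s t h => by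
    rw [← cancel_mono (ι.app.app t), Category.assoc, Category.assoc, app_map, he,
      reassoc_of% he, thin, Y.wrap_map i h, thin]
  have e_wrap : ∀ s, K.wrap i s = (D.F i).map (ι.app.app (D.top i s)) ≫
      (D.F i).map (Y.M.map (homOfLE (le_top_bot i s))) ≫ e (D.bot i s) := fun s => by
    rw [← cancel_mono (ι.app.app (D.bot i s)), Category.assoc, Category.assoc, he, wrap_bot]
    exact ι.comm i s
  have e_wrap' : ∀ j (h : i ≠ j) s, (D.F j).map (e (D.top j s)) ≫ K.wrap j s =
      (D.comm i j).hom.app (Y.M.obj (D.top i (D.top j s))) ≫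
      (D.F i).map ((D.F j).map (Y.M.map (homOfLE (D.top_top h s).le))) ≫
      (D.F i).map (Y.wrap j (D.top i s)) ≫
      (D.F i).map (Y.M.map (homOfLE (D.bot_top h.symm s).le)) ≫ e (D.bot j s) := fun j h s => by
    rw [← cancel_mono (ι.app.app (D.bot j s))]
    simp only [Category.assoc]
    rw [he, ι.comm, ← Functor.map_comp_assoc, he, Functor.map_comp_assoc, wrap_comm_map Y h]
  -- the map on the entries with `s_i ≥ x`
  let b (s : D.Idx) (hs : x ≤ s.coord i) : Y.M.obj s ⟶ X.M.obj s :=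
    φ.app.app s ≫ X.M.map (homOfLE (level_le hs))
  have b_nat : ∀ s t (h : s ≤ t) (hs : x ≤ s.coord i), Y.M.map (homOfLE h) ≫ b t (hs.trans (h i)) =
      b s hs ≫ X.M.map (homOfLE h) := fun s t h hs => by
    have e1 : Y.M.map (homOfLE h) ≫ φ.app.app t =
      φ.app.app s ≫ X.M.map (homOfLE ((level i x).mono h)) := app_map φ h
    simp only [b, Category.assoc, thin]
    rw [reassoc_of% e1, thin]
  have b_wrap : ∀ j s t (h : D.bot j s ≤ t) (hs : x ≤ s.coord i) (ht : x ≤ t.coord i),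
      Y.wrap j s ≫ Y.M.map (homOfLE h) ≫ b t ht =
      (D.F j).map (b (D.top j s) (hs.trans (D.le_top j s i))) ≫ X.wrap j s ≫
        X.M.map (homOfLE h) := fun j s t h hs ht => by
    have e1 : Y.M.map (homOfLE h) ≫ φ.app.app t =
      φ.app.app (D.bot j s) ≫ X.M.map (homOfLE ((level i x).mono h)) := app_map φ h
    have e2 : Y.wrap j s ≫ φ.app.app (D.bot j s) = (D.F j).map (φ.app.app (D.top j s)) ≫
      (D.F j).map (X.M.map (homOfLE ((level i x).top_le j s))) ≫ X.wrap j ((level i x).fn s) ≫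
        X.M.map (homOfLE ((level i x).bot_le j s)) := φ.comm j s
    have e3 := X.wrap_map j (level_le hs) (X.M.map (homOfLE h))
    simp only [b, Functor.map_comp, Category.assoc]
    rw [reassoc_of% e1, reassoc_of% e2]
    simp only [thin] at e3 ⊢
    rw [← e3, reassoc_of% F_thin]
  -- the map on the entries with `s_i < x`, there read through `e`
  let a (s : D.Idx) : (D.F i).obj (Y.M.obj (D.top i s)) ⟶ X.M.obj s :=
    (D.F i).map (b (D.top i s) (le_top_coord i x s)) ≫ X.wrap i s ≫ X.M.map (homOfLE (D.bot_le i s))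
  have a_nat : ∀ s t (h : s ≤ t), a s ≫ X.M.map (homOfLE h) =
      (D.F i).map (Y.M.map (homOfLE (D.top_mono i h))) ≫ a t := fun s t h => by
    have e1 := congrArg (D.F i).map (b_nat _ _ (D.top_mono i h) (le_top_coord i x s))
    simp only [Functor.map_comp] at e1
    simp only [a, Category.assoc, thin]
    rw [reassoc_of% e1, X.wrap_map i h, thin]
  -- both descriptions agree where they overlap
  have hl : ∀ s, ∃ l : K.M.obj s ⟶ X.M.obj s, e s ≫ l = a s ∧
      ∀ hs : x ≤ s.coord i, l = ι.app.app s ≫ b s hs := fun s => by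
    by_cases hs : x ≤ s.coord i
    · refine ⟨ι.app.app s ≫ b s hs, ?_, fun _ => rfl⟩
      rw [reassoc_of% he, b_wrap i s s (D.bot_le i s) hs hs]
    · have := hiso s hs
      exact ⟨inv (e s) ≫ a s, by rw [IsIso.hom_inv_id_assoc], fun h => (hs h).elim⟩
  choose l hel hl using hl
  refine ⟨{ app := { app := l, naturality := fun s t h => ?_ }, comm := fun j s => ?_ }, hl⟩
  · by_cases hs : x ≤ s.coord i
    · rw [hl s hs, hl t (hs.trans (h.le i)), Category.assoc]
      have e1 := b_nat s t h.le hs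
      have e2 := app_map ι h.le
      exact (reassoc_of% e2) _ |>.trans (congrArg (_ ≫ ·) e1)
    · have := hiso s hs
      rw [← cancel_epi (e s)]
      have e1 := e_nat s t h.le
      have e2 := a_nat s t h.le
      refine ((reassoc_of% e1) _).trans ?_
      rw [hel, reassoc_of% hel]
      exact e2.symm
  · dsimp only
    by_cases hj : i = j
    · subst hj
      rw [e_wrap, Category.assoc, Category.assoc, hel, hl _ (le_top_coord i x s),
        Functor.map_comp_assoc]
      simp only [a]
      rw [← Functor.map_comp_assoc (D.F i) (Y.M.map _), b_nat _ _ _ (le_top_coord i x s),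
        Functor.map_comp_assoc, wrap_bot]
    · by_cases hs : x ≤ s.coord i
      · have hs' : x ≤ (D.bot j s).coord i := by rwa [bot_coord_of_ne _ _ hj]
        rw [hl _ hs', hl _ (hs.trans (D.le_top j s i)), Functor.map_comp_assoc,
          reassoc_of% ι.comm]
        have e1 := b_wrap j s _ le_rfl hs hs'
        simp only [homOfLE_refl, CategoryTheory.Functor.map_id, Category.id_comp,
          Category.comp_id] at e1
        rw [e1]
      · have := hiso (D.top j s) (by rwa [top_coord_of_ne _ _ hj])
        rw [← cancel_epi ((D.F j).map (e (D.top j s))), ← Functor.map_comp_assoc, hel,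
          reassoc_of% e_wrap' j hj s, hel]
        simp only [a, Functor.map_comp, Category.assoc]
        have e1 := wrap_comm_map X hj s
        have e2 := (D.comm i j).hom.naturality (b (D.top i (D.top j s)) (le_top_coord i x _))
        simp only [Functor.comp_map] at e2
        have e3 := b_wrap j (D.top i s) (D.top i (D.bot j s)) (D.bot_top (Ne.symm hj) s).le
          (le_top_coord i x s) (le_top_coord i x _)
        have e4 := congrArg (D.F i).map e3
        have e5 := b_nat _ _ (D.top_top hj s).le (le_top_coord i x _)
        have e6 := congrArg (fun f => (D.F i).map ((D.F j).map f)) e5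
        simp only [Functor.map_comp] at e4 e6
        rw [e1, reassoc_of% e4, reassoc_of% e6, reassoc_of% e2]

end Grid

end RootData

/-! ### Covers in the presence of a free direction -/

namespace RootData

variable {C : Type u} [Category.{v} C] [Abelian C] {σ : Type} [DecidableEq σ] {D : RootData C σ}

lemma Typed.congr {k k' : D.Idx} {i : σ} (h : k.coord i = k'.coord i) {X : D.Grid}
    (hX : Typed k i X) : Typed k' i X where
  isIso_map s := by have := hX.isIso_map s; rwa [h] at this
  isZero_obj s hs := hX.isZero_obj s (by rwa [h])

lemma Typed.isIso_map_of_raise {k : D.Idx} {i : σ} {X : D.Grid} (hX : Typed k i X) {s t : D.Idx}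
    (h : s ≤ t) (h' : (raise i (k.coord i)).fn s = (raise i (k.coord i)).fn t) :
    IsIso (X.M.map (homOfLE h)) := by
  have h1 := hX.isIso_map s
  have h2 := hX.isIso_map t
  have h3 := isIso_map_congr X.M (h.trans (le_raise i (k.coord i) t)) rfl h'
  rw [← thin X.M h (le_raise i (k.coord i) t)] at h3
  exact IsIso.of_isIso_comp_right _ (X.M.map (homOfLE (le_raise i (k.coord i) t)))

lemma raise_fn_top {k : D.Idx} {i : σ} (hk : ∀ y, y ≤ k.coord i) (s : D.Idx) :
    (raise i (k.coord i)).fn s = D.top i s := by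
  ext j : 2
  by_cases hj : j = i
  · subst hj
    refine le_antisymm (le_top_coord _ _ _) ?_
    rw [raise_fn_self]
    exact (hk _).trans (le_max_right _ _)
  · rw [raise_fn_of_ne _ _ _ hj, top_coord_of_ne _ _ hj]

lemma shape_insert {k : D.Idx} {S : Finset σ} {i : σ} {X : D.Grid} :
    shape k (insert i S) X ↔ Typed k i X ∧ shape k S X :=
  Finset.forall_mem_insert _ _ _

lemma shape_biproduct {k : D.Idx} {S : Finset σ} {A : Type} [Finite A] {X : A → D.Grid}
    (h : ∀ a, shape k S (X a)) : shape k S (⨁ X) :=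
  (shape k S).prop_of_isLimit (biproduct.isLimit X) fun a => h a.as

namespace Grid

/-- The subgrid `K` of a grid `Y` that is constant in the direction `i`, with `K_s = Y_s` for
`s_i ≥ x` and `K_s` the image of `F_i Y` for `s_i < x`. -/
lemma exists_subgrid {k : D.Idx} {i : σ} (hk : ∀ y, y ≤ k.coord i) {Y : D.Grid} (hY : Typed k i Y)
    (hmono : ∀ s, Mono ((D.η i).app (Y.M.obj s))) (x : Fin (D.p i)) :
    ∃ (K : D.Grid) (ι : K ⟶ Y) (e : ∀ s, (D.F i).obj (Y.M.obj (D.top i s)) ⟶ K.M.obj s), Mono ι ∧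
    (∀ s, e s ≫ ι.app.app s = Y.wrap i s ≫ Y.M.map (homOfLE (D.bot_le i s))) ∧
    (∀ s : D.Idx, ¬ x ≤ s.coord i → IsIso (e s)) ∧
    (∀ s : D.Idx, x ≤ s.coord i → Epi (ι.app.app s)) ∧
    (∀ (k : D.Idx) (j : σ), j ≠ i → Typed k j Y → Typed k j K) := by
  by_cases hx : (x : ℕ) = 0
  · refine ⟨Y, 𝟙 Y, fun s => Y.wrap i s ≫ Y.M.map (homOfLE (D.bot_le i s)), inferInstance,
      fun s => Category.comp_id _, fun s hs => ?_, fun s _ => inferInstance, fun _ _ _ h => h⟩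
    rw [Fin.le_def] at hs
    omega
  -- `K` is the kernel of the projection to the block with range `s_i < x`
  let y : Fin (D.p i) := ⟨x - 1, by omega⟩
  have hy : ∀ z : Fin (D.p i), ¬ x ≤ z ↔ z ≤ y := fun z => by
    simp only [Fin.le_def, y]
    omega
  let q : Y ⟶ cut Y i y := (toReindex (le_raise i y)).app Y ≫ toCut Y i y
  have hq : ∀ s, q.app.app s = Y.M.map (homOfLE (le_raise i y s)) ≫ (toCut Y i y).app.app s :=
    fun s => rfl
  have hex : (ShortComplex.mk (kernel.ι q) q (kernel.condition q)).Exact :=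
    ShortComplex.exact_of_f_is_kernel _ (kernelIsKernel q)
  have hw : ∀ s, (Y.wrap i s ≫ Y.M.map (homOfLE (D.bot_le i s))) ≫
      Y.M.map (homOfLE (le_raise i y s)) = (wrapTo Y i y).app s := fun s => by
    rw [Category.assoc, thin]
  have hl : ∀ s, ∃ l : (D.F i).obj (Y.M.obj (D.top i s)) ⟶ (kernel q).M.obj s,
      l ≫ (kernel.ι q).app.app s = Y.wrap i s ≫ Y.M.map (homOfLE (D.bot_le i s)) := fun s => by
    have h := exact_app' hex s
    have : Mono ((kernel.ι q).app.app s) := inferInstance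
    refine ⟨h.lift _ ?_, h.lift_f _ _⟩
    exact (congrArg (_ ≫ ·) (hq s)).trans ((Category.assoc _ _ _).symm.trans
      ((congrArg (· ≫ _) (hw s)).trans (wrapTo_toCut Y i y s)))
  choose e he using hl
  have hiso : ∀ s, IsIso (Y.M.map (homOfLE (le_raise i y s))) := fun s =>
    hY.isIso_map_of_raise _ (by rw [raise_fn_top hk, raise_fn_top hk, top_raise_fn])
  refine ⟨kernel q, kernel.ι q, e, inferInstance, he, fun s hs => ?_, fun s hs => ?_,
    fun k j hj hYj => ?_⟩
  · have h1 : Mono (e s) := by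
      have h2 : IsIso (Y.M.map (homOfLE (D.le_top i s))) :=
        hY.isIso_map_of_raise _ (by
          rw [← raise_fn_top hk s, raise_fn_raise_fn])
      have h3 : Mono ((D.F i).map (Y.M.map (homOfLE (D.le_top i s))) ≫ e s ≫
          (kernel.ι q).app.app s) := by
        rw [he, Y.cycle]
        exact hmono s
      have h4 : Mono (e s ≫ (kernel.ι q).app.app s) := by
        have h5 : Mono (inv ((D.F i).map (Y.M.map (homOfLE (D.le_top i s)))) ≫
          (D.F i).map (Y.M.map (homOfLE (D.le_top i s))) ≫ e s ≫
          (kernel.ι q).app.app s) := mono_comp _ _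
        rwa [IsIso.inv_hom_id_assoc] at h5
      exact mono_of_mono _ ((kernel.ι q).app.app s)
    have h2 : Epi (e s) := by
      rw [epi_iff_surjective_up_to_refinements]
      intro A z
      obtain ⟨A', r, hr, w, hwz⟩ := (toCut_exact Y i y ((hy _).1 hs)).exact_up_to_refinements
        (z ≫ (kernel.ι q).app.app s ≫ Y.M.map (homOfLE (le_raise i y s))) (by
          have := congrArg (fun f => f.app.app s) (kernel.condition q)
          have h3 : (kernel.ι q).app.app s ≫ Y.M.map (homOfLE (le_raise i y s)) ≫
            (toCut Y i y).app.app s = 0 := this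
          dsimp only
          rw [Category.assoc, Category.assoc, h3, comp_zero])
      refine ⟨A', r, hr, w, ?_⟩
      rw [← cancel_mono ((kernel.ι q).app.app s),
        ← cancel_mono (Y.M.map (homOfLE (le_raise i y s)))]
      simp only [Category.assoc]
      exact hwz.trans (congrArg (w ≫ ·) ((hw s).symm.trans
        (by rw [reassoc_of% he, Category.assoc])))
    exact isIso_of_mono_of_epi _
  · exact (exact_app' hex s).epi_f ((cut_isZero Y i y fun h => (hy _).2 h hs).eq_of_tgt _ _)
  · exact Typed.of_isLimit (limit.isLimit (parallelPair q 0)) (by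
      rintro (_ | _)
      exacts [hYj, typed_cut_of_ne i y hj hYj])

/-- In the induction step, a grid `X` is covered by the direct sum `X'` of the grids generated by
its levels in the direction `i`. As `X'` is a subobject of a grid `Y` that is constant in that
direction, the cover of `Y` given by induction can be pulled back. -/
theorem exists_cover_of_free {k : D.Idx} {S : Finset σ} {i : σ} (hi : i ∉ S)
    (hk : ∀ y, y ≤ k.coord i) {c : σ}
    (ih : ∀ c', (c' = i ∨ c' = c) → ∀ X, shape k (insert i S) X → ∃ (P : D.Grid) (π : P ⟶ X),
      shape k (insert i S) P ∧ Epi π ∧ ∀ s, Mono ((D.η c').app (P.M.obj s)))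
    (X : D.Grid) (hX : shape k S X) :
    ∃ (P : D.Grid) (π : P ⟶ X), shape k S P ∧ Epi π ∧ ∀ s, Mono ((D.η c).app (P.M.obj s)) := by
  have hne : ∀ {j}, j ∈ S → j ≠ i := fun hj h => hi (h ▸ hj)
  choose Y φ hY hφ hYm using fun x => ih i (Or.inl rfl) ((reindex (level i x)).obj X)
    (shape_insert.2 ⟨typed_level hk x X, fun j hj => typed_level_of_ne (hne hj) x (hX j hj)⟩)
  choose K ι e hι he heι hιe hK using fun x => exists_subgrid hk (shape_insert.1 (hY x)).1 (hYm x) x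
  choose f hf using fun x => exists_hom_of_level (φ x) (ι x) (e x) (he x) (heι x)
  have hKS : ∀ x, shape k S (K x) := fun x j hj =>
    hK x k j (hne hj) ((shape_insert.1 (hY x)).2 j hj)
  -- `⨁ Y` is the grid called `Y` above, `⨁ K` is `X'`, and `Z` is the cover of `Y`
  obtain ⟨Z, ψ, hZ, _, hZm⟩ := ih c (Or.inr rfl) (⨁ Y) (shape_biproduct hY)
  have hd : Epi (biproduct.desc f) := by
    refine epi_of_app _ fun s => ?_
    have h1 : Epi ((f (s.coord i)).app.app s) := by
      rw [hf (s.coord i) s le_rfl]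
      have := hιe (s.coord i) s le_rfl
      have : Epi ((φ (s.coord i)).app.app s) := inferInstance
      have : IsIso (X.M.map (homOfLE (level_le (le_refl (s.coord i))))) :=
        isIso_map_of_eq _ _ (by
          ext j : 2
          by_cases hj : j = i
          · subst hj; rw [level_fn_self]
          · rw [level_fn_of_ne _ _ hj])
      have : Epi ((φ (s.coord i)).app.app s ≫
        X.M.map (homOfLE (level_le (le_refl (s.coord i))))) := epi_comp _ _
      exact epi_comp _ _
    have h2 : (biproduct.ι K (s.coord i)).app.app s ≫ (biproduct.desc f).app.app s =
      (f (s.coord i)).app.app s := by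
      rw [← comp_app_app, biproduct.ι_desc]
    exact epi_of_epi_fac h2
  refine ⟨pullback ψ (biproduct.map ι), pullback.snd _ _ ≫ biproduct.desc f, ?_,
    epi_comp _ _, fun s => ?_⟩
  · refine fun j hj => Typed.of_isLimit (limit.isLimit (cospan ψ (biproduct.map ι))) ?_
    rintro (_ | _ | _)
    exacts [shape_biproduct (fun x => (shape_insert.1 (hY x)).2) j hj,
      (shape_insert.1 hZ).2 j hj, shape_biproduct hKS j hj]
  · exact mono_η_of_mono c ((pullback.fst ψ (biproduct.map ι)).app.app s) (hZm s)

end Grid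

end RootData

/-! ### Functoriality of `ι^H` and `π_ρ` -/

namespace RootData

variable {C : Type u} [Category.{v} C] [Abelian C] {σ : Type} [DecidableEq σ] (D : RootData C σ)

namespace Grid

variable (H : Finset σ)

lemma iota_obj_isZero (N : D.SubIdx H ⥤ D.Vanish H) {s : (D.restrict H).Idx}
    (h : ¬ D.IsLower H s) : IsZero ((iota D H N).M.obj s) :=
  IsZero.of_iso (isZero_zero C) (eqToIso (dif_neg h))

variable {H} in
/-- The entries of `iota H N` at the indices without maximal coordinate. -/
def iotaObjIso (N : D.SubIdx H ⥤ D.Vanish H) {s : (D.restrict H).Idx} (h : D.IsLower H s) :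
    (iota D H N).M.obj s ≅ (N.obj (D.lower H s h)).obj :=
  eqToIso (dif_pos h)

variable {H} in
lemma iota_map (N : D.SubIdx H ⥤ D.Vanish H) {s t : (D.restrict H).Idx} (f : s ⟶ t)
    (h : D.IsLower H t) : (iota D H N).M.map f = (iotaObjIso D N (h.of_le f.le)).hom ≫
      (N.map (homOfLE (show D.lower H s (h.of_le f.le) ≤ D.lower H t h from
        fun i => f.le i))).hom ≫ (iotaObjIso D N h).inv :=
  dif_pos h

open Classical in
/-- `iota` on morphisms. -/
def iotaMap {N N' : D.SubIdx H ⥤ D.Vanish H} (α : N ⟶ N') : iota D H N ⟶ iota D H N' where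
  app :=
    { app s := if h : D.IsLower H s then
        (iotaObjIso D N h).hom ≫ (α.app (D.lower H s h)).hom ≫ (iotaObjIso D N' h).inv else 0
      naturality s t f := by
        by_cases h : D.IsLower H t
        · have h' := h.of_le f.le
          have := congrArg (fun g => g.hom) (α.naturality (homOfLE
            (show D.lower H s (h.of_le f.le) ≤ D.lower H t h from fun i => f.le i)))
          simp only [ObjectProperty.FullSubcategory.comp_hom] at this
          simp only [h, h', dite_true, iota_map D _ f h, Category.assoc, Iso.inv_hom_id_assoc,
            reassoc_of% this]
        · exact (iota_obj_isZero D H N' h).eq_of_tgt _ _ }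
  comm i s := by
    exact zero_comp.trans comp_zero.symm

lemma iotaMap_app {N N' : D.SubIdx H ⥤ D.Vanish H} (α : N ⟶ N') {s : (D.restrict H).Idx}
    (h : D.IsLower H s) : (iotaMap D H α).app.app s =
      (iotaObjIso D N h).hom ≫ (α.app (D.lower H s h)).hom ≫ (iotaObjIso D N' h).inv :=
  dif_pos h

/-- `iota` as a functor. -/
@[simps]
def iotaFunctor : (D.SubIdx H ⥤ D.Vanish H) ⥤ (D.restrict H).Grid where
  obj N := iota D H N
  map α := iotaMap D H α
  map_id N := by
    ext s
    by_cases h : D.IsLower H s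
    · rw [iotaMap_app D H _ h]
      simp
    · exact (iota_obj_isZero D H N h).eq_of_tgt _ _
  map_comp α β := by
    ext s
    by_cases h : D.IsLower H s
    · rw [comp_app, NatTrans.comp_app]
      simp only [iotaMap_app D H _ h]
      simp
    · exact (iota_obj_isZero D H _ h).eq_of_tgt _ _

instance : (iotaFunctor D H).Additive where
  map_add {N N' α β} := by
    ext s
    by_cases h : D.IsLower H s
    · have e : ((iotaFunctor D H).map α + (iotaFunctor D H).map β).app.app s =
        ((iotaFunctor D H).map α).app.app s + ((iotaFunctor D H).map β).app.app s := rfl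
      rw [e]
      simp only [iotaFunctor_map, iotaMap_app D H _ h]
      have e' : ((α + β).app (D.lower H s h)).hom =
        (α.app (D.lower H s h)).hom + (β.app (D.lower H s h)).hom := rfl
      rw [e', Preadditive.add_comp, Preadditive.comp_add]
      rfl
    · exact (iota_obj_isZero D H N' h).eq_of_tgt _ _

/-- `piRho` as a functor. -/
@[simps obj]
def piRhoFunctor : (D.restrict H).Grid ⥤ D.Grid where
  obj X := piRho D H X
  map {X Y} f :=
    { app :=
        { app s := f.app.app (D.res H s)
          naturality s t h := f.app.naturality _ }
      comm i s := by
        by_cases h : i ∈ H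
        · have e1 := app_map f (D.res_bot h s).ge
          have e2 := F_app_map (D.F i) f (D.res_top h s).le
          have e3 := f.comm ⟨i, h⟩ (D.res H s)
          simp only [piRho, h, dite_true, Category.assoc]
          rw [e1, reassoc_of% e3, reassoc_of% e2]
        · have e1 := app_map f (D.res_bot_of_notMem h s).ge
          have e2 := F_app_map (D.F i) f (D.res_top_of_notMem h s).le
          have e3 : (D.F i).map (f.app.app (D.res H s)) ≫ (D.η i).app (Y.M.obj (D.res H s)) =
            (D.η i).app (X.M.obj (D.res H s)) ≫ f.app.app (D.res H s) := η_nat i _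
          simp only [piRho, h, dite_false, Category.assoc]
          rw [e1, ← reassoc_of% e2, reassoc_of% e3] }
  map_id _ := rfl
  map_comp _ _ := rfl

instance : (piRhoFunctor D H).Additive where
  map_add := rfl

/-- The grid with value `M` at the indices `s` with `s_i ≤ κ_i` for all `i ∈ H`, and zero
elsewhere. -/
abbrev blockGrid (H : Finset σ) (κ : D.SubIdx H) (M : D.Vanish H) : D.Grid :=
  piRho D H (iota D H (block κ M))

/-- `π_ρ ι^H T^H` is the direct sum of the grids `blockGrid H κ T`. -/
def piRhoIotaDeltaIso (M : D.Vanish H) :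
    piRho D H (iota D H (delta D H M)) ≅ ⨁ fun κ => blockGrid D H κ M :=
  (iotaFunctor D H ⋙ piRhoFunctor D H).mapIso
    (Iso.refl (⨁ fun κ : D.SubIdx H => block κ M)) ≪≫
  (iotaFunctor D H ⋙ piRhoFunctor D H).mapBiproduct fun κ : D.SubIdx H => block κ M

end Grid

end RootData

namespace RootData

variable {C : Type u} [Category.{v} C] [Abelian C] {σ : Type} [DecidableEq σ] {D : RootData C σ}

/-! ### Concentrated grids -/

/-- Within the range given by `k`, the maps of a grid that only change coordinates in `S` are
invertible if the grid is of the type given by `k` in the directions in `S`. -/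
lemma isIso_map_of_typed {k : D.Idx} {X : D.Grid} (S : Finset σ) (hX : shape k S X) {s t : D.Idx}
    (h : s ≤ t) (ht : t ≤ k) (hS : ∀ i, i ∉ S → s.coord i = t.coord i) :
    IsIso (X.M.map (homOfLE h)) := by
  induction S using Finset.induction generalizing s t with
  | empty => exact isIso_map_of_eq _ _ (Box.ext (funext fun i => hS i (by simp)))
  | insert i S hi ih =>
    have hX' := shape_insert.1 hX
    -- the index that agrees with `t` in the direction `i` and with `s` in all others
    let r := s.set i (t.coord i)
    have hsr : s ≤ r := fun j => by
      by_cases hj : j = i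
      · subst hj; simpa [r] using h j
      · simp [r, Box.set_of_ne _ _ hj]
    have hrt : r ≤ t := fun j => by
      by_cases hj : j = i
      · subst hj; simp [r]
      · simpa [r, Box.set_of_ne _ _ hj] using h j
    have h1 : IsIso (X.M.map (homOfLE hrt)) := ih hX'.2 hrt ht fun j hj => by
      by_cases hji : j = i
      · subst hji; simp [r]
      · simpa [r, Box.set_of_ne _ _ hji] using hS j (by simp [hj, hji])
    have h2 : IsIso (X.M.map (homOfLE hsr)) := hX'.1.isIso_map_of_raise hsr (by
      ext j : 2
      by_cases hj : j = i
      · subst hj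
        rw [raise_fn_self, raise_fn_self, max_eq_right ((h j).trans (ht j)),
          max_eq_right (by simpa [r] using ht j)]
      · rw [raise_fn_of_ne _ _ _ hj, raise_fn_of_ne _ _ _ hj]
        simp [r, Box.set_of_ne _ _ hj])
    rw [← thin X.M hsr hrt]
    infer_instance

section

variable [Fintype σ] {k : D.Idx} {X Y : D.Grid}

lemma isIso_map_of_shape_univ (hX : shape k Finset.univ X) {s t : D.Idx} (h : s ≤ t) (ht : t ≤ k) :
    IsIso (X.M.map (homOfLE h)) :=
  isIso_map_of_typed _ hX h ht (by simp)

lemma isZero_of_shape_univ (hX : shape k Finset.univ X) {s : D.Idx} (hs : ¬ s ≤ k) :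
    IsZero (X.M.obj s) := by
  rw [Box.le_def, not_forall] at hs
  obtain ⟨i, hi⟩ := hs
  exact (hX i (by simp)).isZero_obj s hi

lemma shape_univ_of (h : ∀ s t (h : s ≤ t), t ≤ k → IsIso (X.M.map (homOfLE h)))
    (h' : ∀ s, ¬ s ≤ k → IsZero (X.M.obj s)) : shape k Finset.univ X := fun i _ =>
  { isIso_map s := by
      by_cases hs : s ≤ k
      · refine h _ _ _ fun j => ?_
        by_cases hj : j = i
        · subst hj; rw [raise_fn_self]; exact max_le (hs j) le_rfl
        · rw [raise_fn_of_ne _ _ _ hj]; exact hs j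
      · exact isIso_of_source_target_iso_zero _ (h' _ hs).isoZero
          (h' _ fun h => hs ((le_raise i _ s).trans h)).isoZero
    isZero_obj s hs := h' s fun h => hs (h i) }

lemma hom_ext_of_shape_univ (hY : shape k Finset.univ Y) {f g : X ⟶ Y} (h : f.app.app k = g.app.app k) : f = g := by
  ext s
  by_cases hs : s ≤ k
  · have := isIso_map_of_shape_univ hY hs le_rfl
    rw [← cancel_mono (Y.M.map (homOfLE hs)), ← Grid.app_map, ← Grid.app_map, h]
  · exact (isZero_of_shape_univ hY hs).eq_of_tgt _ _

/-- The steps of a grid with invertible maps `M_s ⟶ M_k`, `s ≤ k`, are determined by the cycle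
condition, so that all maps `X_k ⟶ Y_k` extend to maps of grids. -/
lemma exists_hom_of_shape_univ (hX : shape k Finset.univ X) (hY : shape k Finset.univ Y)
    (φ : X.M.obj k ⟶ Y.M.obj k) : ∃ f : X ⟶ Y, f.app.app k = φ := by
  have hl : ∀ s, ∃ l : X.M.obj s ⟶ Y.M.obj s, ∀ hs : s ≤ k,
      l ≫ Y.M.map (homOfLE hs) = X.M.map (homOfLE hs) ≫ φ := fun s => by
    by_cases hs : s ≤ k
    · have := isIso_map_of_shape_univ hY hs le_rfl
      exact ⟨X.M.map (homOfLE hs) ≫ φ ≫ inv (Y.M.map (homOfLE hs)), fun _ => by simp⟩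
    · exact ⟨0, fun h => (hs h).elim⟩
  choose l hl using hl
  have nat : ∀ s t (h : s ≤ t), X.M.map (homOfLE h) ≫ l t = l s ≫ Y.M.map (homOfLE h) :=
    fun s t h => by
      by_cases ht : t ≤ k
      · have := isIso_map_of_shape_univ hY ht le_rfl
        rw [← cancel_mono (Y.M.map (homOfLE ht)), Category.assoc, Category.assoc, thin, hl, hl,
          reassoc_of% thin]
      · exact (isZero_of_shape_univ hY ht).eq_of_tgt _ _
  refine ⟨{ app := { app := l, naturality := fun s t h => nat s t h.le },
            comm := fun i s => ?_ }, ?_⟩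
  · dsimp only
    by_cases hb : D.bot i s ≤ k
    · by_cases ht : D.top i s ≤ k
      · have ht' : D.top i (D.bot i s) ≤ k := by rwa [top_bot_self]
        have h1 := isIso_map_of_shape_univ hX (D.le_top i (D.bot i s)) ht'
        have h2 := isIso_map_of_shape_univ hX (Grid.le_top_bot i s) ht'
        have h3 := isIso_map_of_eq Y.M (D.bot_le i (D.bot i s)) (bot_bot_self i s)
        have e1 := nat _ _ (D.bot_le i (D.bot i s))
        have e2 := congrArg (D.F i).map (nat _ _ (D.le_top i (D.bot i s)))
        have e3 := congrArg (D.F i).map (nat _ _ (Grid.le_top_bot i s))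
        simp only [Functor.map_comp] at e2 e3
        have e4 := η_nat (D := D) i (l (D.bot i s))
        rw [← Y.cycle, ← X.cycle] at e4
        rw [← Grid.wrap_bot X, ← Grid.wrap_bot Y]
        simp only [Category.assoc] at e4 ⊢
        rw [← reassoc_of% e3]
        congr 1
        rw [← cancel_epi ((D.F i).map (X.M.map (homOfLE (D.le_top i (D.bot i s))))), ← e4,
          reassoc_of% e2]
      · exact ((D.F i).map_isZero (isZero_of_shape_univ hX ht)).eq_of_src _ _
    · exact (isZero_of_shape_univ hY hb).eq_of_tgt _ _
  · have := hl k le_rfl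
    have e : ∀ Z : D.Grid, Z.M.map (homOfLE (le_refl k)) = 𝟙 _ := fun Z => Z.M.map_id k
    rwa [e, e, Category.id_comp, Category.comp_id] at this

end

/-! ### Blocks -/

section Block

variable (H : Finset σ) (κ : D.SubIdx H) (M : D.Vanish H)

/-- The largest index at which `blockGrid H κ M` is nonzero. -/
def center : D.Idx where
  coord i := if h : i ∈ H then ⟨κ.coord ⟨i, h⟩, by
    have : (κ.coord ⟨i, h⟩ : ℕ) < D.p i - 1 := (κ.coord ⟨i, h⟩).2
    omega⟩ else
    ⟨D.p i - 1, by have := D.two_le_p i; omega⟩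

lemma center_coord {i : σ} (h : i ∈ H) : ((center H κ).coord i : ℕ) = κ.coord ⟨i, h⟩ := by
  simp [center, h]

lemma center_coord_lt {i : σ} (h : i ∈ H) : ((center H κ).coord i : ℕ) < D.p i - 1 := by
  rw [center_coord H κ h]
  exact (κ.coord ⟨i, h⟩).2

lemma le_center_coord {i : σ} (h : i ∉ H) (y : Fin (D.p i)) : y ≤ (center H κ).coord i := by
  simp only [center, h, dite_false, Fin.le_def]
  omega

lemma le_center_iff {s : D.Idx} : s ≤ center H κ ↔
    ∃ h : D.IsLower H (D.res H s), D.lower H (D.res H s) h ≤ κ := by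
  constructor
  · intro h
    have h1 : ∀ i : H, (s.coord i : ℕ) ≤ κ.coord i := fun i => by
      rw [← center_coord H κ i.2]; exact h i
    exact ⟨fun i => (h1 i).trans_lt (κ.coord i).2, fun i => h1 i⟩
  · rintro ⟨h, h'⟩ i
    by_cases hi : i ∈ H
    · rw [Fin.le_def, center_coord H κ hi]
      exact h' ⟨i, hi⟩
    · exact le_center_coord H κ hi _

namespace Grid

lemma blockGrid_isZero {s : D.Idx} (hs : ¬ s ≤ center H κ) :
    IsZero ((blockGrid D H κ M).M.obj s) := by
  by_cases h : D.IsLower H (D.res H s)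
  · have h' : ¬ D.lower H (D.res H s) h ≤ κ := fun h' => hs ((le_center_iff H κ).2 ⟨h, h'⟩)
    have h1 : IsZero ((block κ M).obj (D.lower H (D.res H s) h)) :=
      IsZero.of_iso (isZero_zero _) (eqToIso (if_neg h'))
    exact IsZero.of_iso ((D.vanishing H).ι.map_isZero h1) (iotaObjIso D (block κ M) h)
  · exact iota_obj_isZero D H _ h

lemma isIso_blockGrid_map {s t : D.Idx} (h : s ≤ t) (ht : t ≤ center H κ) :
    IsIso ((blockGrid D H κ M).M.map (homOfLE h)) := by
  obtain ⟨h₁, h₂⟩ := (le_center_iff H κ).1 ht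
  have e := iota_map D (block κ M) (homOfLE (D.res_mono H h)) h₁
  let f := (block κ M).map (homOfLE (show D.lower H (D.res H s) (h₁.of_le (D.res_mono H h)) ≤
      D.lower H (D.res H t) h₁ from fun i => h i))
  have h' : IsIso f := by
    have q : (block κ M).obj (D.lower H (D.res H s) (h₁.of_le (D.res_mono H h))) =
        (block κ M).obj (D.lower H (D.res H t) h₁) :=
      (if_pos (le_trans (show D.lower H (D.res H s) (h₁.of_le (D.res_mono H h)) ≤
        D.lower H (D.res H t) h₁ from fun i => h i) h₂)).trans (if_pos h₂).symm
    have e' : f = eqToHom q := dif_pos h₂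
    rw [e']
    infer_instance
  have : IsIso f.hom := inferInstanceAs (IsIso ((D.vanishing H).ι.map f))
  have h3 : IsIso ((iota D H (block κ M)).M.map (homOfLE (D.res_mono H h))) := by
    rw [e]
    exact inferInstanceAs (IsIso (_ ≫ f.hom ≫ _))
  exact h3

/-- The value of `blockGrid H κ M` at its center. -/
def blockGridIso : (blockGrid D H κ M).M.obj (center H κ) ≅ M.obj :=
  have h := (le_center_iff H κ).1 le_rfl
  iotaObjIso D (block κ M) h.1 ≪≫ (D.vanishing H).ι.mapIso (eqToIso (if_pos h.2))

lemma shape_blockGrid [Fintype σ] : shape (center H κ) Finset.univ (blockGrid D H κ M) :=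
  shape_univ_of (fun _ _ h ht => isIso_blockGrid_map H κ M h ht)
    (fun _ hs => blockGrid_isZero H κ M hs)

end Grid

end Block

end RootData

/-! ### Evaluation at the last nonzero entry -/

lemma extVanishes_map_iff {A : Type*} [Category* A] [Abelian A] {B : Type*} [Category* B]
    [Abelian B] (G : A ⥤ B) [G.IsEquivalence] (X Y : A) (n : ℕ) :
    ExtVanishes (G.obj X) (G.obj Y) n ↔ ExtVanishes X Y n :=
  (extVanishes_adj_iff_of_exact G.asEquivalence.toAdjunction X (G.obj Y) n).trans
    (ExtVanishes.congr_right (G.asEquivalence.unitIso.app Y)).symm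

namespace RootData

variable {C : Type u} [Category.{v} C] [Abelian C] {σ : Type} [Fintype σ] {D : RootData C σ}

/-- The directions in which the index `k` is not maximal. -/
def support (k : D.Idx) : Finset σ := Finset.univ.filter fun i => (k.coord i : ℕ) < D.p i - 1

lemma mem_support {k : D.Idx} {i : σ} : i ∈ support k ↔ (k.coord i : ℕ) < D.p i - 1 := by
  simp [support]

lemma le_coord_of_notMem_support {k : D.Idx} {i : σ} (h : i ∉ support k) (y : Fin (D.p i)) :
    y ≤ k.coord i := by
  rw [mem_support] at h
  rw [Fin.le_def]
  omega

/-- The index `k`, restricted to its support. -/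
def supportIdx (k : D.Idx) : D.SubIdx (support k) := ⟨fun i => ⟨k.coord i, mem_support.1 i.2⟩⟩

variable [DecidableEq σ]

lemma center_supportIdx (k : D.Idx) : center (support k) (supportIdx k) = k := by
  ext i
  by_cases h : i ∈ support k
  · rw [center_coord _ _ h]; rfl
  · have h1 := le_coord_of_notMem_support h ((center (support k) (supportIdx k)).coord i)
    have h2 := le_center_coord (support k) (supportIdx k) h (k.coord i)
    exact congrArg _ (le_antisymm h1 h2)

lemma support_center (H : Finset σ) (κ : D.SubIdx H) : support (center H κ) = H := by
  ext i
  rw [mem_support]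
  refine ⟨fun h => ?_, center_coord_lt H κ⟩
  by_contra hi
  have := le_center_coord H κ hi ⟨D.p i - 1, by have := D.two_le_p i; omega⟩
  rw [Fin.le_def] at this
  dsimp only at this
  omega

lemma vanishing_of_shape_univ {k : D.Idx} {X : D.Grid} (hX : shape k Finset.univ X) :
    D.vanishing (support k) (X.M.obj k) := fun i hi => by
  have h : IsZero ((D.F i).obj (X.M.obj (D.top i k))) := (D.F i).map_isZero
    ((hX i (by simp)).isZero_obj _ (by
      have := mem_support.1 hi
      rw [Fin.le_def, top_coord_self]
      omega))
  rw [← X.cycle, h.eq_of_tgt ((D.F i).map _) 0, zero_comp]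

/-- Evaluation at the last nonzero entry `k`, as a functor from the grids concentrated at `k`. It is
an equivalence. -/
@[simps, reducible]
def evCenter (k : D.Idx) : Shape k Finset.univ ⥤ D.Vanish (support k) where
  obj X := ⟨X.obj.M.obj k, vanishing_of_shape_univ X.property⟩
  map f := ⟨f.hom.app.app k⟩

instance (k : D.Idx) : (evCenter k).Faithful where
  map_injective {_ Y _ _} h := ObjectProperty.hom_ext _ (hom_ext_of_shape_univ Y.property
    (congrArg (fun f => f.hom) h))

instance (k : D.Idx) : (evCenter k).Full where
  map_surjective {X Y} φ := by
    obtain ⟨f, hf⟩ := exists_hom_of_shape_univ X.property Y.property φ.hom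
    exact ⟨⟨f⟩, ObjectProperty.hom_ext _ hf⟩

lemma exists_shape_univ (k : D.Idx) (M : D.Vanish (support k)) : ∃ X : D.Grid,
    shape k Finset.univ X ∧ Nonempty (X.M.obj k ≅ M.obj) := by
  have h1 := Grid.shape_blockGrid (support k) (supportIdx k) M
  have h2 := Grid.blockGridIso (support k) (supportIdx k) M
  rw [center_supportIdx] at h1 h2
  exact ⟨_, h1, ⟨h2⟩⟩

instance (k : D.Idx) : (evCenter k).EssSurj where
  mem_essImage M := by
    obtain ⟨X, hX, ⟨e⟩⟩ := exists_shape_univ k M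
    exact ⟨⟨X, hX⟩, ⟨(D.vanishing (support k)).isoMk e⟩⟩

instance (k : D.Idx) : (evCenter k).IsEquivalence where

lemma extVanishes_evCenter_iff {k : D.Idx} (X Y : Shape k Finset.univ) (n : ℕ) :
    ExtVanishes X Y n ↔ ExtVanishes ((evCenter k).obj X) ((evCenter k).obj Y) n :=
  (extVanishes_map_iff (evCenter k) X Y n).symm

/-! ### Covers -/

/-- Every grid of a given type is a quotient of one of the same type on whose entries `η_c` is a
monomorphism. -/
theorem exists_cover (hD : D.EnoughMono) (c : σ) (S : Finset σ) (k : D.Idx)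
    (hc : c ∈ S → ∀ y, y ≤ k.coord c) (X : D.Grid) (hX : shape k S X) :
    ∃ (P : D.Grid) (π : P ⟶ X), shape k S P ∧ Epi π ∧ ∀ s, Mono ((D.η c).app (P.M.obj s)) := by
  -- induction on the number of directions that are not in `S`
  obtain ⟨m, hm⟩ : ∃ m, m = (Finset.univ \ S).card := ⟨_, rfl⟩
  induction m generalizing c S k X with
  | zero =>
    have hS : S = Finset.univ := by
      have := Finset.card_eq_zero.1 hm.symm
      rw [Finset.sdiff_eq_empty_iff_subset] at this
      exact Finset.univ_subset_iff.1 this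
    subst hS
    have hck : c ∉ support k := fun h => by
      have h1 := hc (by simp) ⟨D.p c - 1, by have := D.two_le_p c; omega⟩
      have h2 := mem_support.1 h
      rw [Fin.le_def] at h1
      dsimp only at h1
      omega
    obtain ⟨M, q, hq, hM⟩ := hD (support k) c hck ((evCenter k).obj ⟨X, hX⟩)
    obtain ⟨P, hP, ⟨e⟩⟩ := exists_shape_univ k M
    obtain ⟨π, hπ⟩ := exists_hom_of_shape_univ hP hX (e.hom ≫ q.hom)
    have hq' : Epi q.hom := by
      have : PreservesFiniteColimits (D.vanishing (support k)).ι := by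
        have := (D.vanishing (support k)).preservesCokernels_ι
        exact (D.vanishing (support k)).ι.preservesFiniteColimits_of_preservesCokernels
      exact inferInstanceAs (Epi ((D.vanishing (support k)).ι.map q))
    refine ⟨P, π, hP, Grid.epi_of_app _ fun s => ?_, fun s => ?_⟩
    · by_cases hs : s ≤ k
      · have h1 := isIso_map_of_shape_univ hP hs le_rfl
        have h2 := isIso_map_of_shape_univ hX hs le_rfl
        have h3 := Grid.app_map π hs
        have h4 : Epi (π.app.app s ≫ X.M.map (homOfLE hs)) := by
          rw [← h3, hπ]
          exact epi_comp _ _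
        have h5 : Epi ((π.app.app s ≫ X.M.map (homOfLE hs)) ≫ inv (X.M.map (homOfLE hs))) :=
          epi_comp _ _
        rwa [Category.assoc, IsIso.hom_inv_id, Category.comp_id] at h5
      · exact ⟨fun _ _ _ => (isZero_of_shape_univ hX hs).eq_of_src _ _⟩
    · by_cases hs : s ≤ k
      · have h1 := isIso_map_of_shape_univ hP hs le_rfl
        exact mono_η_of_mono c (P.M.map (homOfLE hs) ≫ e.hom) hM
      · exact ⟨fun _ _ _ => ((D.F c).map_isZero (isZero_of_shape_univ hP hs)).eq_of_tgt _ _⟩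
  | succ m ih =>
    obtain ⟨i, hi⟩ : ∃ i, i ∉ S := by
      by_contra! h
      rw [Finset.eq_univ_iff_forall.2 h] at hm
      simp at hm
    have hkS : ∀ j ∈ S, (D.top i k).coord j = k.coord j := fun j hj =>
      top_coord_of_ne _ _ fun h => hi (h ▸ hj)
    have hk : ∀ y, y ≤ (D.top i k).coord i := fun y => le_top_coord i y k
    obtain ⟨P, π, hP, h⟩ := Grid.exists_cover_of_free hi hk (c := c) (fun c' hc' X hX => by
      refine ih c' _ _ (fun h => ?_) X hX ?_
      · rcases eq_or_ne c' i with rfl | hne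
        · exact hk
        · obtain rfl := hc'.resolve_left hne
          have h' := Finset.mem_of_mem_insert_of_ne h hne
          rw [hkS _ h']
          exact hc h'
      · rw [Finset.sdiff_insert, Finset.card_erase_of_mem (by simpa using hi)]
        omega) X (fun j hj => (hX j hj).congr (hkS j hj).symm)
    exact ⟨P, π, fun j hj => (hP j hj).congr (hkS j hj), h⟩

end RootData

namespace RootData

variable {C : Type u} [Category.{v} C] [Abelian C] {σ : Type} [DecidableEq σ] {D : RootData C σ}

/-! ### The entries of the reflections -/

namespace Grid

variable {X : D.Grid} {i : σ} {x : Fin (D.p i)}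

lemma wrap_top (X : D.Grid) (i : σ) (s : D.Idx) :
    X.wrap i s ≫ X.M.map (homOfLE ((D.bot_le i s).trans (D.le_top i s))) =
      (D.η i).app (X.M.obj (D.top i s)) := by
  have h := X.wrap_map i (D.le_top i s) (X.M.map (homOfLE (D.bot_le i (D.top i s))))
  rw [thin] at h
  exact h.symm.trans (X.cycle i (D.top i s))

lemma raise_fn_le_top (i : σ) (x : Fin (D.p i)) (s : D.Idx) : (raise i x).fn s ≤ D.top i s := by
  intro j
  by_cases hj : j = i
  · subst hj; exact le_top_coord _ _ _
  · rw [raise_fn_of_ne _ _ _ hj, top_coord_of_ne _ _ hj]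

/-- Continued to the last entry, the steps `wrapTo` are the `η_i`. -/
lemma wrapTo_map_top (X : D.Grid) (i : σ) (x : Fin (D.p i)) (s : D.Idx) :
    (wrapTo X i x).app s ≫ X.M.map (homOfLE (raise_fn_le_top i x s)) =
      (D.η i).app (X.M.obj (D.top i s)) := by
  rw [wrapTo_app, Category.assoc, thin, wrap_top]

lemma good_of_mono_η (h : ∀ s, Mono ((D.η i).app (X.M.obj s))) : Good X i x := fun s => by
  have h1 := h (D.top i s)
  rw [← wrapTo_map_top X i x] at h1
  exact mono_of_mono _ (X.M.map (homOfLE (raise_fn_le_top i x s)))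

lemma good_of_isZero (h : ∀ s, IsZero (X.M.obj (D.top i s))) : Good X i x := fun s =>
  ⟨fun _ _ _ => ((D.F i).map_isZero (h s)).eq_of_tgt _ _⟩

/-- If no step in the direction `i` enters, then `cut` does not change the entries. -/
lemma nonempty_cut_iso_of_isZero {s : D.Idx} (hs : s.coord i ≤ x)
    (h : IsZero (X.M.obj (D.top i s))) :
    Nonempty ((cut X i x).M.obj s ≅ X.M.obj ((raise i x).fn s)) := by
  have : Mono ((toCut X i x).app.app s) :=
    (toCut_exact X i x hs).mono_g (((D.F i).map_isZero h).eq_of_src _ _)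
  have : IsIso ((toCut X i x).app.app s) := isIso_of_mono_of_epi _
  exact ⟨(asIso ((toCut X i x).app.app s)).symm⟩

/-- If `X` is constant in the direction `i`, then the entries of `cut` are the cokernels of the
`η_i` on the entries of `X`. -/
lemma nonempty_cut_iso_of_isIso {s : D.Idx} (hs : s.coord i ≤ x)
    (h : IsIso (X.M.map (homOfLE (raise_fn_le_top i x s)))) :
    Nonempty ((cut X i x).M.obj s ≅ cokernel ((D.η i).app (X.M.obj (D.top i s)))) := by
  have h1 : IsColimit (CokernelCofork.ofπ (f := (wrapTo X i x).app s) _ (wrapTo_toCut X i x s)) :=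
    CokernelCofork.IsColimit.ofπ' _ _ fun f hf => ⟨_, (toCut_desc X i x hs f hf).choose_spec⟩
  have h2 := wrapTo_map_top X i x s
  have e2 := cokernelCompIsIso ((wrapTo X i x).app s) (X.M.map (homOfLE (raise_fn_le_top i x s)))
  have e3 := cokernelIsoOfEq h2
  exact ⟨(h1.coconePointUniqueUpToIso (cokernelIsCokernel _)) ≪≫ e2.symm ≪≫ e3⟩

end Grid

variable {k : D.Idx} {S : Finset σ} {i : σ}

lemma shape_empty (k : D.Idx) (X : D.Grid) : shape k ∅ X := fun _ h =>
  (Finset.notMem_empty _ h).elim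

lemma shape_isZero {X : Shape k S} (h : IsZero X.obj) : IsZero X := by
  rw [IsZero.iff_id_eq_zero]
  exact ObjectProperty.hom_ext _ (h.eq_of_src _ _)

lemma extVanishes_shape_empty {X Y : D.Grid} (hX : shape k ∅ X) (hY : shape k ∅ Y) (n : ℕ) :
    ExtVanishes (⟨X, hX⟩ : Shape k ∅) ⟨Y, hY⟩ n ↔ ExtVanishes X Y n := by
  have : (shape k ∅).ι.EssSurj := ⟨fun X => ⟨⟨X, shape_empty k X⟩, ⟨Iso.refl _⟩⟩⟩
  have : (shape k ∅).ι.IsEquivalence := {}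
  exact (extVanishes_map_iff (shape k ∅).ι ⟨X, hX⟩ ⟨Y, hY⟩ n).symm

lemma shape_flat (hk : ∀ y, y ≤ k.coord i) {X : D.Grid} (hX : shape k S X) :
    shape k (insert i S) ((Grid.reindex (raise i (k.coord i))).obj X) :=
  (Shape.flat ⟨X, hX⟩ i hk).property

lemma shape_cut (i : σ) {X : D.Grid} (hX : shape k S X) :
    shape k (insert i S) (X.cut i (k.coord i)) :=
  (Shape.cut ⟨X, hX⟩ i).property

/-- `extVanishes_flat`, with the objects of the subcategories written as grids. -/
lemma extVanishes_shape_flat (hk : ∀ y, y ≤ k.coord i) {X Y : D.Grid} (hX : shape k S X)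
    (hY : shape k (insert i S) Y) (n : ℕ) :
    ExtVanishes (⟨_, shape_flat hk hX⟩ : Shape k (insert i S)) ⟨Y, hY⟩ n ↔
      ExtVanishes (⟨X, hX⟩ : Shape k S) ⟨Y, shape_anti (Finset.subset_insert i S) _ hY⟩ n :=
  extVanishes_flat hk ⟨X, hX⟩ ⟨Y, hY⟩ n

/-- `extVanishes_cut`, with the objects of the subcategories written as grids, and with the required
covers provided by `exists_cover`. -/
lemma extVanishes_shape_cut [Fintype σ] (hD : D.EnoughMono) (hi : i ∉ S)
    (hk : (k.coord i : ℕ) < D.p i - 1) {X Y : D.Grid}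
    (hX : shape k S X) (hgood : X.Good i (k.coord i)) (hY : shape k (insert i S) Y) (n : ℕ) :
    ExtVanishes (⟨_, shape_cut i hX⟩ : Shape k (insert i S)) ⟨Y, hY⟩ n ↔
      ExtVanishes (⟨X, hX⟩ : Shape k S) ⟨Y, shape_anti (Finset.subset_insert i S) _ hY⟩ n := by
  refine extVanishes_cut hk (fun X => ?_) ⟨X, hX⟩ hgood ⟨Y, hY⟩ n
  obtain ⟨P, π, hP, hπ, h⟩ := exists_cover hD i S k (fun h => (hi h).elim) X.obj X.property
  exact ⟨⟨P, hP⟩, ⟨π⟩, Grid.good_of_mono_η h, (shape k S).ι.epi_of_epi_map hπ⟩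

/-- `Ext` does not depend on whether it is formed in all grids or in those that are constant in
some directions. -/
lemma extVanishes_of_typed_top {B : Finset σ} (hk : ∀ i ∈ B, ∀ y, y ≤ k.coord i) {X Y : D.Grid}
    (hX : shape k B X) (hY : shape k B Y) (n : ℕ) :
    ExtVanishes (⟨X, hX⟩ : Shape k B) ⟨Y, hY⟩ n ↔ ExtVanishes X Y n := by
  induction B using Finset.induction with
  | empty => exact extVanishes_shape_empty hX hY n
  | insert i B _ ih =>
    have hk' := hk i (by simp)
    have := Grid.isIso_toReindex_app (shape_insert.1 hX).1
    refine Iff.trans ?_ (ih (fun j hj => hk j (by simp [hj])) (shape_insert.1 hX).2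
      (shape_insert.1 hY).2)
    rw [← extVanishes_shape_flat hk' _ hY]
    exact ExtVanishes.congr_left ((shape k (insert i B)).isoMk
      (asIso ((Grid.toReindex (le_raise i (k.coord i))).app X)))

end RootData

/-! ### Cogeneration -/

namespace RootData

variable {C : Type u} [Category.{v} C] [Abelian C]

section Cogenerate

variable {σ : Type} [DecidableEq σ] [Fintype σ] {D : RootData C σ}

lemma mem_support_raise {k t : D.Idx} {i : σ} (hk : i ∉ support k) (j : σ) :
    j ∈ support ((raise i (k.coord i)).fn t) ↔ j ∈ support t ∧ j ≠ i := by
  rw [raise_fn_top (le_coord_of_notMem_support hk)]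
  simp only [mem_support]
  by_cases hj : j = i
  · subst hj
    simp [top_coord_self]
  · simp [top_coord_of_ne _ _ hj, hj]

/-- A grid `X` with `X_t = 0` for all `t` of smaller support than `k` can be replaced, as regards
`Ext` to grids concentrated at `k`, by one that is constant in the directions outside of the
support of `k`. -/
lemma exists_flat {k : D.Idx} {X : D.Grid}
    (hX : ∀ t, support t ⊂ support k → IsZero (X.M.obj t)) (B : Finset σ)
    (hB : ∀ i ∈ B, i ∉ support k) :
    ∃ (Z : D.Grid) (hZ : shape k B Z), Nonempty (Z.M.obj k ≅ X.M.obj k) ∧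
      (∀ t, support t \ B ⊂ support k → IsZero (Z.M.obj t)) ∧
      ∀ (Y : D.Grid) (hY : shape k Finset.univ Y) (n : ℕ), ExtVanishes X Y n →
        ExtVanishes (⟨Z, hZ⟩ : Shape k B) ⟨Y, shape_anti (Finset.subset_univ B) _ hY⟩ n := by
  induction B using Finset.induction with
  | empty =>
    exact ⟨X, shape_empty k X, ⟨Iso.refl _⟩, fun t ht => hX t (by simpa using ht),
      fun Y hY n h => (extVanishes_shape_empty _ _ n).2 h⟩
  | insert i B _ ih =>
    obtain ⟨Z, hZ, ⟨e⟩, h0, hE⟩ := ih fun j hj => hB j (by simp [hj])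
    have hi := hB i (by simp)
    have hk := le_coord_of_notMem_support hi
    refine ⟨_, shape_flat hk hZ, ⟨eqToIso (congrArg Z.M.obj (raise_fn_self_eq i k)) ≪≫ e⟩,
      fun t ht => h0 _ ?_, fun Y hY n h => (extVanishes_shape_flat hk hZ _ n).2 (hE Y hY n h)⟩
    have : support ((raise i (k.coord i)).fn t) \ B = support t \ insert i B := by
      ext j
      simp only [Finset.mem_sdiff, mem_support_raise hi, Finset.mem_insert]
      tauto
    rwa [this]

/-- The second step after `exists_flat`: the reflections to blocks in the directions in the support
of `k`. -/
lemma exists_concentrated (hD : D.EnoughMono) {k : D.Idx} {X : D.Grid}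
    (hX : ∀ t, support t ⊂ support k → IsZero (X.M.obj t)) (A : Finset σ) (hA : A ⊆ support k) :
    ∃ (Z : D.Grid) (hZ : shape k (A ∪ (support k)ᶜ) Z), Nonempty (Z.M.obj k ≅ X.M.obj k) ∧
      (∀ i ∈ support k, i ∉ A → ∀ t, IsZero (Z.M.obj (D.top i t))) ∧
      ∀ (Y : D.Grid) (hY : shape k Finset.univ Y) (n : ℕ), ExtVanishes X Y n →
        ExtVanishes (⟨Z, hZ⟩ : Shape k (A ∪ (support k)ᶜ))
          ⟨Y, shape_anti (Finset.subset_univ _) _ hY⟩ n := by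
  induction A using Finset.induction with
  | empty =>
    obtain ⟨Z, hZ, e, h0, hE⟩ := exists_flat hX (support k)ᶜ (by simp)
    rw [Finset.empty_union]
    refine ⟨Z, hZ, e, fun i hi _ t => h0 _ ?_, hE⟩
    rw [Finset.ssubset_iff_of_subset (fun j => by simp)]
    refine ⟨i, hi, ?_⟩
    simp [mem_support, top_coord_self]
  | insert i A hiA ih =>
    obtain ⟨Z, hZ, ⟨e⟩, h0, hE⟩ := ih fun j hj => hA (by simp [hj])
    have hi := hA (Finset.mem_insert_self i A)
    have hi' : i ∉ A ∪ (support k)ᶜ := by simp [hiA, hi]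
    have hzero := h0 i hi hiA
    rw [Finset.insert_union]
    obtain ⟨e'⟩ := Grid.nonempty_cut_iso_of_isZero (X := Z) (s := k) (le_refl (k.coord i)) (hzero k)
    refine ⟨_, shape_cut i hZ, ⟨e' ≪≫ eqToIso (congrArg Z.M.obj (raise_fn_self_eq i k)) ≪≫ e⟩,
      fun j hj hjA t => ?_, fun Y hY n h => (extVanishes_shape_cut hD hi' (mem_support.1 hi) hZ
        (Grid.good_of_isZero hzero) _ n).2 (hE Y hY n h)⟩
    have hji : j ≠ i := fun h => hjA (by simp [h])
    have h1 := h0 j hj (fun h => hjA (by simp [h])) ((raise i (k.coord i)).fn t)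
    rw [top_raise_fn_of_ne _ _ _ _ hji] at h1
    exact IsZero.of_epi ((Z.toCut i (k.coord i)).app.app (D.top j t)) h1

/-- A grid `X` without extensions by the grids concentrated at some `k` with value `T_{supp k}` is
zero. By induction on the support of `k`, one has `X_k = 0`: if the entries of smaller support
vanish, the reflections of `X` to grids concentrated at `k` do not change the entry at `k`. -/
lemma isZero_of_extVanishes (hD : D.EnoughMono) (T : ∀ H : Finset σ, D.Vanish H)
    (hT : ∀ H, IsCotilting (T H)) (X : D.Grid)
    (hX : ∀ (k : D.Idx) (Y : D.Grid), shape k Finset.univ Y →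
      Nonempty (Y.M.obj k ≅ (T (support k)).obj) → ∀ n, ExtVanishes X Y n) : IsZero X := by
  rw [Grid.isZero_iff]
  suffices ∀ (H : Finset σ) (k : D.Idx), support k = H → IsZero (X.M.obj k) from
    fun k => this _ k rfl
  intro H
  induction H using Finset.strongInduction with
  | H H ih =>
    rintro k rfl
    obtain ⟨Z, hZ, ⟨e⟩, -, hE⟩ := exists_concentrated hD (fun t ht => ih _ ht t rfl)
      (support k) subset_rfl
    have hu : support k ∪ (support k)ᶜ = Finset.univ := by simp
    rw! [hu] at hZ hE
    obtain ⟨Y, hY, ⟨eY⟩⟩ := exists_shape_univ k (T (support k))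
    have h := (hT (support k)).cogenerates ((evCenter k).obj ⟨Z, hZ⟩) fun n => by
      have h1 := (extVanishes_evCenter_iff _ _ n).1 (hE Y hY n (hX k Y hY ⟨eY⟩ n))
      exact (ExtVanishes.congr_right ((D.vanishing (support k)).isoMk eY)).1 h1
    exact ((D.vanishing (support k)).ι.map_isZero h).of_iso e.symm

end Cogenerate

end RootData

/-! ### Rigidity -/

namespace RootData

variable {C : Type u} [Category.{v} C] [Abelian C]

section Rigid

variable {n : ℕ} {D : RootData C (Fin n)}

/-- If `X` is a block in a direction `d` in which `Y` is constant, then the last entries of `X` in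
this direction, and with them the reflection of `X` to grids constant in this direction, are
zero. -/
lemma extVanishes_of_not_subset {k l : D.Idx} (h : ¬ support l ⊆ support k) {X Y : D.Grid}
    (hX : shape l Finset.univ X) (hY : shape k Finset.univ Y) (m : ℕ) : ExtVanishes X Y m := by
  rw [Finset.not_subset] at h
  obtain ⟨d, hd, hdk⟩ := h
  have hk := le_coord_of_notMem_support hdk
  refine (extVanishes_shape_empty (shape_empty k X) (shape_empty k Y) m).1
    ((extVanishes_shape_flat hk (shape_empty k X)
      (shape_anti (Finset.subset_univ (insert d ∅)) Y hY) m).1 ?_)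
  refine ExtVanishes.of_isZero_left (shape_isZero (Grid.isZero_iff.2 fun s => ?_)) m
  refine isZero_of_shape_univ hX (s := (raise d (k.coord d)).fn s) fun hs => ?_
  have h1 := hs d
  have h2 := mem_support.1 hd
  rw [raise_fn_top hk, Fin.le_def, top_coord_self] at h1
  omega

/-- The values of the reflections of a grid `X` concentrated at `l` to blocks in the directions in
`A`. These are taken in descending order, as `cokList` applies the `η_c` with the smallest `c`
last. -/
lemma exists_reflection (hD : D.EnoughMono) {k l : D.Idx} (hlk : support l ⊆ support k)
    {X : D.Grid} (hX : shape l Finset.univ X)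
    (hmono : ∀ J : Finset (Fin n), Disjoint (support l) J → ∀ a, a ∉ support l ∪ J →
      Mono ((D.η a).app (D.cokList (J.sort (· ≤ ·)) (X.M.obj l))))
    (A : Finset (Fin n)) (hA : A ⊆ support k) :
    ∃ (Z : D.Grid) (hZ : shape k (A ∪ (support k)ᶜ) Z),
      (∀ t, IsZero (Z.M.obj t) ∨
        Nonempty (Z.M.obj t ≅ D.cokList ((A \ support l).sort (· ≤ ·)) (X.M.obj l))) ∧
      (∀ i ∈ support l, i ∉ A → ∀ t, IsZero (Z.M.obj (D.top i t))) ∧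
      (∀ i ∈ support k, i ∉ support l → i ∉ A → Typed l i Z) ∧
      ∀ (Y : D.Grid) (hY : shape k Finset.univ Y) (m : ℕ),
        ExtVanishes (⟨Z, hZ⟩ : Shape k (A ∪ (support k)ᶜ))
          ⟨Y, shape_anti (Finset.subset_univ _) _ hY⟩ m → ExtVanishes X Y m := by
  induction A using Finset.induction_on_min with
  | empty =>
    rw [Finset.empty_union]
    have hXk : shape k (support k)ᶜ X := fun i hi => (hX i (by simp)).congr (by
      have h1 : i ∉ support k := by simpa using hi
      have h2 : i ∉ support l := fun h => h1 (hlk h)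
      exact le_antisymm (le_coord_of_notMem_support h1 _) (le_coord_of_notMem_support h2 _))
    refine ⟨X, hXk, fun t => ?_, fun i hi _ t => isZero_of_shape_univ hX fun h => ?_,
      fun i _ _ _ => hX i (by simp), fun Y hY m h => ?_⟩
    · by_cases ht : t ≤ l
      · have := isIso_map_of_shape_univ hX ht le_rfl
        let e : X.M.obj t ≅ X.M.obj l := asIso (X.M.map (homOfLE ht))
        refine Or.inr ⟨?_⟩
        rw [Finset.empty_sdiff, Finset.sort_empty]
        exact e
      · exact Or.inl (isZero_of_shape_univ hX ht)
    · have h1 := h i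
      have h2 := mem_support.1 hi
      rw [Fin.le_def, top_coord_self] at h1
      omega
    · exact (extVanishes_of_typed_top
        (fun i hi => le_coord_of_notMem_support (by simpa using hi)) hXk _ m).1 h
  | insert i A hmin ih =>
    obtain ⟨Z, hZ, hv, h0, ht, hE⟩ := ih fun j hj => hA (by simp [hj])
    have hi := hA (Finset.mem_insert_self i A)
    have hiA : i ∉ A := fun h => lt_irrefl _ (hmin i h)
    have hi' : i ∉ A ∪ (support k)ᶜ := by simp [hiA, hi]
    rw [Finset.insert_union]
    have h0' : ∀ j ∈ support l, j ∉ insert i A → ∀ t,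
        IsZero ((Z.cut i (k.coord i)).M.obj (D.top j t)) := fun j hj hjA t => by
      have hji : j ≠ i := fun h => hjA (by simp [h])
      have h1 := h0 j hj (fun h => hjA (by simp [h])) ((raise i (k.coord i)).fn t)
      rw [top_raise_fn_of_ne _ _ _ _ hji] at h1
      exact IsZero.of_epi ((Z.toCut i (k.coord i)).app.app (D.top j t)) h1
    have ht' : ∀ j ∈ support k, j ∉ support l → j ∉ insert i A →
        Typed l j (Z.cut i (k.coord i)) := fun j hj hjl hjA =>
      Grid.typed_cut_of_ne i _ (fun h => hjA (by simp [h])) (ht j hj hjl fun h => hjA (by simp [h]))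
    by_cases hil : i ∈ support l
    -- no steps enter in the direction `i`, and the values do not change
    · have hzero := h0 i hil hiA
      refine ⟨_, shape_cut i hZ, fun t => ?_, h0', ht', fun Y hY m h => hE Y hY m
        ((extVanishes_shape_cut hD hi' (mem_support.1 hi) hZ (Grid.good_of_isZero hzero) _ m).1 h)⟩
      rw [Finset.insert_sdiff_of_mem _ hil]
      by_cases hti : t.coord i ≤ k.coord i
      · obtain ⟨e⟩ := Grid.nonempty_cut_iso_of_isZero (X := Z) hti (hzero t)
        exact (hv ((raise i (k.coord i)).fn t)).imp (fun h => h.of_iso e)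
          (fun ⟨e'⟩ => ⟨e ≪≫ e'⟩)
      · exact Or.inl (Grid.cut_isZero Z i _ hti)
    -- `Z` is constant in the direction `i`, and the values are replaced by their cokernels of `η_i`
    · have hti := ht i hi hil hiA
      have hm := hmono (A \ support l) Finset.disjoint_sdiff i (by simp [hil, hiA])
      have hgood : Z.Good i (k.coord i) := Grid.good_of_mono_η fun s => by
        rcases hv s with h | ⟨⟨e⟩⟩
        · exact ⟨fun _ _ _ => ((D.F i).map_isZero h).eq_of_tgt _ _⟩
        · exact mono_η_of_mono i e.hom hm
      refine ⟨_, shape_cut i hZ, fun t => ?_, h0', ht', fun Y hY m h => hE Y hY m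
        ((extVanishes_shape_cut hD hi' (mem_support.1 hi) hZ hgood _ m).1 h)⟩
      rw [Finset.insert_sdiff_of_notMem _ hil, Finset.sort_insert (· ≤ ·)
        (fun b hb => (hmin b (Finset.mem_sdiff.1 hb).1).le) (by simp [hiA])]
      by_cases htk : t.coord i ≤ k.coord i
      · have hiso : IsIso (Z.M.map (homOfLE (Grid.raise_fn_le_top i (k.coord i) t))) :=
          hti.isIso_map_of_raise _ (by
            rw [raise_fn_top (le_coord_of_notMem_support hil),
              raise_fn_top (le_coord_of_notMem_support hil), top_raise_fn,
              ← raise_fn_top (le_coord_of_notMem_support hil) t, ← raise_fn_top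
                (le_coord_of_notMem_support hil) ((raise i (l.coord i)).fn t), raise_fn_raise_fn])
        obtain ⟨e⟩ := Grid.nonempty_cut_iso_of_isIso htk hiso
        rcases hv (D.top i t) with h | ⟨⟨e'⟩⟩
        · exact Or.inl ((IsZero.of_epi (cokernel.π _) h).of_iso e)
        · exact Or.inr ⟨e ≪≫ cokernel.mapIso _ _ ((D.F i).mapIso e') e' (by
            exact (η_nat i e'.hom).symm)⟩
      · exact Or.inl (Grid.cut_isZero Z i _ htk)

end Rigid

lemma nonempty_blockGrid_obj_iso {σ : Type} [DecidableEq σ] [Fintype σ] {D : RootData C σ}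
    (T : ∀ H : Finset σ, D.Vanish H) (H : Finset σ) (κ : D.SubIdx H) :
    Nonempty ((Grid.blockGrid D H κ (T H)).M.obj (center H κ) ≅
      (T (support (center H κ))).obj) := by
  rw [support_center]
  exact ⟨Grid.blockGridIso H κ (T H)⟩

lemma nonempty_iso_blockGrid {σ : Type} [DecidableEq σ] [Fintype σ] {D : RootData C σ}
    (T : ∀ H : Finset σ, D.Vanish H) (k : D.Idx) {Y : D.Grid} (hY : shape k Finset.univ Y)
    (e : Nonempty (Y.M.obj k ≅ (T (support k)).obj)) :
    Nonempty (Y ≅ Grid.blockGrid D (support k) (supportIdx k) (T (support k))) := by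
  have h1 := Grid.shape_blockGrid (support k) (supportIdx k) (T (support k))
  have h2 := Grid.blockGridIso (support k) (supportIdx k) (T (support k))
  rw [center_supportIdx] at h1 h2
  obtain ⟨e⟩ := e
  let i := (evCenter k).preimageIso (X := ⟨Y, hY⟩) (Y := ⟨_, h1⟩)
    ((D.vanishing (support k)).isoMk (e ≪≫ h2.symm))
  exact ⟨(shape k Finset.univ).ι.mapIso i⟩

/-- There are no extensions between grids concentrated at `l` and `k` with values `T_H` and
`T_{H'}`, where `H` and `H'` are the supports of `l` and `k`. If `H` is contained in `H'`, the
successive reflections of the first grid lead to a grid concentrated at `k` whose value there is zero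
or the restriction of `T_H` to `H' \ H`. -/
theorem extVanishes_of_support {n : ℕ} {D : RootData C (Fin n)} (hD : D.EnoughMono)
    (T : ∀ H : Finset (Fin n), D.Vanish H)
    (hmono : ∀ H J : Finset (Fin n), Disjoint H J → ∀ a, a ∉ H ∪ J →
      Mono ((D.η a).app (D.restr H J (T H)).obj))
    (hExt : ∀ H J : Finset (Fin n), Disjoint H J → ∀ i : ℕ, 0 < i →
      ExtVanishes (D.restr H J (T H)) (T (H ∪ J)) i) {k l : D.Idx} {X Y : D.Grid}
    (hX : shape l Finset.univ X) (eX : X.M.obj l ≅ (T (support l)).obj)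
    (hY : shape k Finset.univ Y) (eY : Y.M.obj k ≅ (T (support k)).obj) {m : ℕ} (hm : 0 < m) :
    ExtVanishes X Y m := by
  by_cases hlk : support l ⊆ support k
  · have hcok : ∀ L : List (Fin n), Nonempty (D.cokList L (X.M.obj l) ≅
        D.cokList L (T (support l)).obj) := fun L => by
      induction L with
      | nil => exact ⟨eX⟩
      | cons c L ih =>
        obtain ⟨e⟩ := ih
        exact ⟨cokernel.mapIso _ _ ((D.F c).mapIso e) e (η_nat c e.hom).symm⟩
    obtain ⟨Z, hZ, hv, -, -, hE⟩ := exists_reflection hD hlk hX (fun J hJ a ha => by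
      obtain ⟨e⟩ := hcok (J.sort (· ≤ ·))
      exact mono_η_of_mono a e.hom (hmono _ J hJ a ha)) (support k) subset_rfl
    have hu : support k ∪ (support k)ᶜ = Finset.univ := by simp
    rw! [hu] at hZ hE
    refine hE Y hY m ((extVanishes_evCenter_iff _ _ m).2 ?_)
    rw [ExtVanishes.congr_right ((D.vanishing (support k)).isoMk eY :
      (evCenter k).obj ⟨Y, hY⟩ ≅ T (support k))]
    rcases hv k with h | ⟨⟨e⟩⟩
    · refine ExtVanishes.of_isZero_left ?_ m
      rw [IsZero.iff_id_eq_zero]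
      exact ObjectProperty.hom_ext _ (h.eq_of_src _ _)
    · obtain ⟨e'⟩ := hcok ((support k \ support l).sort (· ≤ ·))
      have hJ : Disjoint (support l) (support k \ support l) := Finset.disjoint_sdiff
      have hu' : support l ∪ (support k \ support l) = support k := Finset.union_sdiff_of_subset hlk
      have key : ∀ (K : Finset (Fin n)) (hK : support l ∪ (support k \ support l) = K)
          (W : D.Vanish K) (_ : W.obj ≅ (D.restr (support l) (support k \ support l)
            (T (support l))).obj), ExtVanishes W (T K) m := by
        rintro K rfl W e
        exact (ExtVanishes.congr_left ((D.vanishing _).isoMk e)).2 (hExt _ _ hJ m hm)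
      exact key _ hu' _ (e ≪≫ e')
  · exact extVanishes_of_not_subset hlk hX hY m

end RootData

end

theorem mainTheorem2 {C : Type u} [Category.{v} C] [Abelian C] {n : ℕ} (D : RootData C (Fin n))
    (hD : D.EnoughMono)
    (T : ∀ H : Finset (Fin n), D.Vanish H)
    (hT : ∀ H, IsCotilting (T H))
    (hmono : ∀ H J : Finset (Fin n), Disjoint H J → ∀ a, a ∉ H ∪ J →
      Mono ((D.η a).app (D.restr H J (T H)).obj))
    (hExt : ∀ H J : Finset (Fin n), Disjoint H J → ∀ i : ℕ, 0 < i →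
      ExtVanishes (D.restr H J (T H)) (T (H ∪ J)) i) :
    IsCotilting (⨁ fun H : Finset (Fin n) => D.piRho H (D.iota H (D.delta H (T H)))) where
  rigid i hi := by
    refine ExtVanishes.biproduct_left fun H => ?_
    refine (ExtVanishes.congr_left (RootData.Grid.piRhoIotaDeltaIso D H (T H))).2 ?_
    refine ExtVanishes.biproduct_left fun κ => ExtVanishes.biproduct_right fun H' => ?_
    refine (ExtVanishes.congr_right (RootData.Grid.piRhoIotaDeltaIso D H' (T H'))).2 ?_
    refine ExtVanishes.biproduct_right fun κ' => ?_
    obtain ⟨e⟩ := RootData.nonempty_blockGrid_obj_iso T H κ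
    obtain ⟨e'⟩ := RootData.nonempty_blockGrid_obj_iso T H' κ'
    exact RootData.extVanishes_of_support hD T hmono hExt
      (RootData.Grid.shape_blockGrid H κ (T H)) e (RootData.Grid.shape_blockGrid H' κ' (T H')) e' hi
  cogenerates X hX := by
    refine RootData.isZero_of_extVanishes hD T hT X fun k Y hY e m => ?_
    obtain ⟨f⟩ := RootData.nonempty_iso_blockGrid T k hY e
    let H := RootData.support k
    have h1 : ExtVanishes X (D.piRho H (D.iota H (D.delta H (T H)))) m :=
      (hX m).of_retract_right
        (biproduct.ι (fun H => D.piRho H (D.iota H (D.delta H (T H)))) H) (biproduct.π _ H)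
        (biproduct.ι_π_self _ H)
    have h2 := (ExtVanishes.congr_right (RootData.Grid.piRhoIotaDeltaIso D H (T H))).1 h1
    have h3 : ExtVanishes X (RootData.Grid.blockGrid D H (RootData.supportIdx k) (T H)) m :=
      h2.of_retract_right
        (biproduct.ι (fun κ => RootData.Grid.blockGrid D H κ (T H)) (RootData.supportIdx k))
        (biproduct.π _ (RootData.supportIdx k)) (biproduct.ι_π_self _ _)
    exact (ExtVanishes.congr_right f).2 h3
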